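/- **Setting.** Let $U$ be a complex Hopf algebra with bijective antipode $S$, and let $\mathcal C$ be a full subcategory of the finite-dimensional $U$-modules that contains the trivial module $\mathbb 1$, is closed under tensor products and under both duals $V^*$ (action through $S$) and ${}^*V$ (action through $S^{-1}$), and separates the elements of $U$ (if $x\in U$ acts by $0$ on every object of $\mathcal C$, then $x=0$). Let $\mathcal R=\sum r_i\otimes r_i'$ be a universal $R$-matrix in the completion of $U\otimes U$ with respect to the modules $V\otimes W$, $V,W\in\mathcal C$: it is invertible, $\mathcal R\Delta(x)=\Delta^{cop}(x)\mathcal R$ for $x\in U$, $(\Delta\otimes\mathrm{id})(\mathcal R)=\mathcal R_{13}\mathcal R_{23}$, $(\mathrm{id}\otimes\Delta)(\mathcal R)=\mathcal R_{13}\mathcal R_{12}$, and the elements $L_V^+=(\mathrm{id}\otimes\rho_V)(\mathcal R)$ and $L_V^-=(\rho_V\otimes\mathrm{id})(\mathcal R^{-1})$ lie in $U\otimes\mathrm{End}(V)$ and $\mathrm{End}(V)\otimes U$, for $V\in\mathcal C$. Write $L_V^+(1\otimes e_j)=\sum_i l^{V+}_{ij}\otimes e_i$ and $L_V^-(e_j\otimes1)=\sum_i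 e_i\otimes l^{V-}_{ij}$ for a basis $(e_i)$ of $V$ with dual basis $(e^i)$. The braiding is $\sigma=\tau\circ\mathcal R$ ($\tau$ the flip); $\sigma_{V,M}$ and $\sigma_{M,V}$ are defined for $V\in\mathcal C$ and every $U$-module $M$. **The algebra $\mathbf A$.** Let $\mathbf A=\bigoplus_{V\in\mathcal C}V^*\boxtimes V$ modulo $\varphi^*\alpha\boxtimes v=\alpha\boxtimes\varphi v$ for all $\varphi:V\to W$ in $\mathcal C$, with the action $(x\otimes y)\rhd(\alpha\boxtimes v)=x\alpha\boxtimes yv$ of $U\otimes U$. The algebra $\widetilde{\mathbf A}$ is $\mathbf A$ with product $(\alpha\boxtimes v)(\beta\boxtimes w)=\sigma_{V^*,W^*}(\alpha\otimes\beta)\boxtimes(v\otimes w)$, where $W^*\otimes V^*=(V\otimes W)^*$. The algebra $F_2(\mathbf A)$ is the same space with the product obtained by first applying $\sigma_{V,W^*}$ to the middle factors of $V^*\otimes V\otimes W^*\otimes W$. For characters $f,g:F_2(\mathbf A)\to\mathbb C$ and $V\in\mathcal C$, put $J_V(v)=\sum_i f(e^i\boxtimes v)\,e_i$ and $J'_V(v)=\sum_i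 g(v\boxtimes e^i)\,e_i$, where $v\boxtimes e^i\in V\boxtimes{}^*V=({}^*V)^*\boxtimes{}^*V$ (solutions of the right-handed reflection equation for $f$ and of the left-handed one for $g$). **Coideal subalgebra.** Fix $V\in\mathcal C$ and a class $\mathcal W$ of objects of $\mathcal C$ with $V\in\mathcal W$ (for example $\mathcal W=\{V\}$, or all objects). Let $\mathbf B_f\subset U$ be the subalgebra generated by the elements $c^W_{il}=\sum_{j,k}l^{W+}_{ij}(J_W)_{jk}S(l^{W-}_{kl})$, $W\in\mathcal W$, and let $\chi:\mathbf B_f\to\mathbb C$ be a character. **Modules.** $D_U$ is the algebra $\widetilde{\mathbf A}\otimes U$ with subalgebras $\widetilde{\mathbf A}$ and $U$ and the relations $xa=((x_{(1)}\otimes1)\rhd a)\,x_{(2)}$. Write $\partial_\lhd:U\to D_U$ for the inclusion. Let $U'\subset U$ be the set of elements that lie in a finite-dimensional submodule, belonging to $\mathcal C$, for the adjoint action $x\rhd u=x_{(1)}uS(x_{(2)})$. For $u\in U'$ let $\mathrm{ad}^*(u)=\sum_i u_i\otimes g_i\in U'\otimes\widetilde{\mathbf A}$ be its coaction ($\sum_i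 g_i(x)u_i=x\rhd u$) and $\partial_\rhd(u)=\sum_{i,j}((r_j\otimes1)\rhd g_i)\,\partial_\lhd(S^{-1}(u_ir'_j))$. A non-degenerate $D_U$-module is a $U\otimes U$-module $M$ with a $D_U$-module structure such that $\partial_\lhd(x)$ acts as $x\otimes1$ for $x\in U$, $\partial_\rhd(u)$ acts as $1\otimes u$ for $u\in U'$, and the action map $\mu_M:\mathbf A\otimes M\to M$ is linear for the second copy of $U$. Morphisms are the linear maps that commute with $D_U$ and with $U\otimes U$. **Operators.** Let $n\ge1$, let $V_1=\dots=V_n=V$, and let $M$ be a non-degenerate $D_U$-module. On $M\otimes V_1\otimes\cdots\otimes V_n$, where all braidings and the diagonal action of $U$ use the second copy of $U$ on $M$, put $T_i=\sigma_{V_i,V_{i+1}}$ for $1\le i<n$, $T_n=J_{V_n}$, $P_1=T_1\cdots T_{n-1}T_nT_{n-1}\cdots T_1$, $T_0=P_1^{-1}(\sigma_{V_1,M}\sigma_{M,V_1})^{-1}$, and $$K_0=\mu_M\circ\sigma_{\mathbb 1\boxtimes V,M}\circ\bigl((J'_V\otimes1)\mathrm{coev}_V\boxtimes(\mathrm{id}\otimes\mathrm{coev}_{{}^*V})\bigr)\circ\sigma_{\mathbb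 1\boxtimes V_1,M}^{-1},$$ where the middle map sends $v\in V_1$ to $\sum_{i,j}\bigl[(J'_Ve_i\otimes e^i)\boxtimes(v\otimes e^j)\bigr]\otimes e_j\in\mathbf A\otimes V$, with $(V\otimes V^*)\boxtimes(V\otimes{}^*V)=X^*\boxtimes X$ for $X=V\otimes{}^*V$. **The group.** $\widetilde{\mathcal B}_n$ is generated by $T_0,\dots,T_n,K_0$. For $n\ge2$ the relations are $T_iT_j=T_jT_i$ ($|i-j|>1$); $T_iT_{i+1}T_i=T_{i+1}T_iT_{i+1}$ ($1\le i\le n-2$); $T_0T_1T_0T_1=T_1T_0T_1T_0$; $T_{n-1}T_nT_{n-1}T_n=T_nT_{n-1}T_nT_{n-1}$; $K_0T_i=T_iK_0$ ($2\le i\le n$); $T_1K_0T_1K_0=K_0T_1K_0T_1$; $T_0T_1^{-1}K_0T_1=T_1^{-1}K_0T_1T_0$. For $n=1$ there are no relations. **Theorem.** Let $$F^{f,\chi,g}_{n,V}(M)=\mathrm{Hom}_{\mathbf B_f}\bigl(\mathbb 1_\chi,\;M\otimes_2(\mathbb 1\boxtimes V_1)\otimes_2\cdots\otimes_2(\mathbb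 1\boxtimes V_n)\bigr),$$ with $\mathbf B_f$ acting through the second copy of $U$. For every non-degenerate $D_U$-module $M$ the operators $P_1$ and $\sigma_{V_1,M}\sigma_{M,V_1}$ are invertible, and composition with $T_0,\dots,T_n,K_0$ preserves $F^{f,\chi,g}_{n,V}(M)$ and defines a representation of $\widetilde{\mathcal B}_n$ on it. For a morphism $h:M\to N$, composition with $h\otimes\mathrm{id}^{\otimes n}$ is a $\widetilde{\mathcal B}_n$-equivariant map $F^{f,\chi,g}_{n,V}(M)\to F^{f,\chi,g}_{n,V}(N)$, compatible with identities and composition. So $F^{f,\chi,g}_{n,V}$ is a functor from non-degenerate $D_U$-modules to $\widetilde{\mathcal B}_n$-modules. -/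

import Mathlib

open scoped TensorProduct DirectSum

universe u v w

noncomputable section

/-! ### Modules over a Hopf algebra -/

/-- A (bundled, possibly infinite-dimensional) left module over the complex algebra `U`. -/
structure URep (U : Type u) [Ring U] [Algebra ℂ U] : Type (max u (v + 1)) where
  carrier : Type v
  [acg : AddCommGroup carrier]
  [mod : Module ℂ carrier]
  ρ : U →ₐ[ℂ] Module.End ℂ carrier

attribute [instance] URep.acg URep.mod

instance URep.instCoeSort (U : Type u) [Ring U] [Algebra ℂ U] :
    CoeSort (URep.{u, v} U) (Type v) := ⟨URep.carrier⟩

/-- The antipode is invertible (its inverse enters left duals and right translations). -/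
class BijectiveAntipode (U : Type u) [Ring U] [HopfAlgebra ℂ U] : Prop where
  bij : Function.Bijective (HopfAlgebra.antipode ℂ : U →ₗ[ℂ] U)

/-- The inverse of the antipode. -/
def antipodeInv (U : Type u) [Ring U] [HopfAlgebra ℂ U] [BijectiveAntipode U] : U →ₗ[ℂ] U :=
  (LinearEquiv.ofBijective (HopfAlgebra.antipode ℂ : U →ₗ[ℂ] U)
    BijectiveAntipode.bij).symm.toLinearMap

theorem antipode_antipodeInv {U : Type u} [Ring U] [HopfAlgebra ℂ U] [BijectiveAntipode U]
    (x : U) : HopfAlgebra.antipode ℂ (antipodeInv U x) = x :=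
  (LinearEquiv.ofBijective (HopfAlgebra.antipode ℂ : U →ₗ[ℂ] U)
    BijectiveAntipode.bij).apply_symm_apply x

theorem antipodeInv_one {U : Type u} [Ring U] [HopfAlgebra ℂ U] [BijectiveAntipode U] :
    antipodeInv U (1 : U) = 1 := by
  apply (BijectiveAntipode.bij (U := U)).1
  rw [antipode_antipodeInv, HopfAlgebra.antipode_one]

theorem antipodeInv_mul {U : Type u} [Ring U] [HopfAlgebra ℂ U] [BijectiveAntipode U] (x y : U) :
    antipodeInv U (x * y) = antipodeInv U y * antipodeInv U x := by
  apply (BijectiveAntipode.bij (U := U)).1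
  rw [antipode_antipodeInv, HopfAlgebra.antipode_mul_antidistrib, antipode_antipodeInv,
    antipode_antipodeInv]

namespace URep

variable {U : Type u} [Ring U] [HopfAlgebra ℂ U]

/-- `φ : V → W` is a homomorphism of `U`-modules. -/
def IsHom (V : URep.{u, v} U) (W : URep.{u, w} U) (φ : V →ₗ[ℂ] W) : Prop :=
  ∀ (x : U) (a : V), φ (V.ρ x a) = W.ρ x (φ a)

/-- The action of `U ⊗ U` on `V ⊗ W`, factor by factor. -/
def act₂ (V : URep.{u, v} U) (W : URep.{u, w} U) :
    U ⊗[ℂ] U →ₐ[ℂ] Module.End ℂ (V ⊗[ℂ] W) :=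
  (Module.endTensorEndAlgHom (R := ℂ) (S := ℂ) (A := ℂ)).comp (Algebra.TensorProduct.map V.ρ W.ρ)

/-- The tensor product of two `U`-modules; `U` acts through the coproduct. -/
abbrev tensor (V : URep.{u, v} U) (W : URep.{u, w} U) : URep.{u, max v w} U where
  carrier := V ⊗[ℂ] W
  ρ := (act₂ V W).comp (Bialgebra.comulAlgHom ℂ U)

/-- The trivial module. -/
abbrev unit (U : Type u) [Ring U] [HopfAlgebra ℂ U] : URep.{u, u} U where
  carrier := ULift.{u} ℂ
  ρ := (Algebra.ofId ℂ (Module.End ℂ (ULift.{u} ℂ))).comp (Bialgebra.counitAlgHom ℂ U)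

/-- The dual `V^*`: `(x α)(a) = α(S(x) a)`. -/
abbrev dual (V : URep.{u, v} U) : URep.{u, v} U where
  carrier := Module.Dual ℂ V
  ρ := AlgHom.ofLinearMap
    (Module.Dual.transpose (R := ℂ) (M := V) (M' := V) ∘ₗ V.ρ.toLinearMap ∘ₗ
      HopfAlgebra.antipode ℂ)
    (by
      ext α a
      simp [Module.Dual.transpose_apply])
    (by
      intro x y
      ext α a
      simp [Module.Dual.transpose_apply, HopfAlgebra.antipode_mul_antidistrib])

/-- The dual `^*V`: `(x α)(a) = α(S⁻¹(x) a)`. -/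
abbrev ldual [BijectiveAntipode U] (V : URep.{u, v} U) : URep.{u, v} U where
  carrier := Module.Dual ℂ V
  ρ := AlgHom.ofLinearMap
    (Module.Dual.transpose (R := ℂ) (M := V) (M' := V) ∘ₗ V.ρ.toLinearMap ∘ₗ antipodeInv U)
    (by
      ext α a
      simp [Module.Dual.transpose_apply, antipodeInv_one])
    (by
      intro x y
      ext α a
      simp [Module.Dual.transpose_apply, antipodeInv_mul])

theorem tensor_apply (V : URep.{u, v} U) (W : URep.{u, w} U) (x : U) :
    (tensor V W).ρ x = act₂ V W (Coalgebra.comul x) := rfl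

theorem act₂_tmul (V : URep.{u, v} U) (W : URep.{u, w} U) (x y : U) :
    act₂ V W (x ⊗ₜ y) = TensorProduct.map (V.ρ x) (W.ρ y) := rfl

/-- Homomorphisms commute with the action of `U ⊗ U`. -/
theorem act₂_natural {V : URep.{u, v} U} {V' : URep.{u, v} U} {W : URep.{u, w} U}
    {W' : URep.{u, w} U} {φ : V →ₗ[ℂ] V'} {ψ : W →ₗ[ℂ] W'}
    (hφ : IsHom V V' φ) (hψ : IsHom W W' ψ) (a : U ⊗[ℂ] U) (t : V ⊗[ℂ] W) :
    act₂ V' W' a (TensorProduct.map φ ψ t) = TensorProduct.map φ ψ (act₂ V W a t) := by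
  induction a using TensorProduct.induction_on with
  | zero => simp
  | add a b h1 h2 =>
    rw [map_add, map_add, LinearMap.add_apply, LinearMap.add_apply, map_add, h1, h2]
  | tmul x y =>
    rw [act₂_tmul, act₂_tmul]
    induction t using TensorProduct.induction_on with
    | zero => simp
    | add s t h1 h2 => simp only [map_add, h1, h2]
    | tmul p q => simp [hφ x p, hψ y q]

theorem IsHom.transpose {V : URep.{u, v} U} {V' : URep.{u, v} U} {φ : V →ₗ[ℂ] V'}
    (hφ : IsHom V V' φ) :
    IsHom V'.dual V.dual (Module.Dual.transpose (R := ℂ) (M := V) (M' := V') φ) := by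
  intro x α
  refine LinearMap.ext fun a => ?_
  exact congrArg (DFunLike.coe (F := Module.Dual ℂ V') α) (hφ (HopfAlgebra.antipode ℂ x) a).symm

theorem IsHom.id (V : URep.{u, v} U) : IsHom V V LinearMap.id := fun _ _ => rfl

theorem IsHom.tensor {V : URep.{u, v} U} {V' : URep.{u, v} U} {W : URep.{u, w} U}
    {W' : URep.{u, w} U} {φ : V →ₗ[ℂ] V'} {ψ : W →ₗ[ℂ] W'}
    (hφ : IsHom V V' φ) (hψ : IsHom W W' ψ) :
    IsHom (V.tensor W) (V'.tensor W') (TensorProduct.map φ ψ) :=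
  fun x t => (act₂_natural hφ hψ (Coalgebra.comul x) t).symm

end URep

/-! ### The tensor category and the universal R-matrix -/

/-- A full tensor subcategory of the finite-dimensional `U`-modules, closed under both duals.
(Such a category is locally finite as soon as it is abelian; abelianness plays no further role,
so nothing more is required.) -/
structure TensorSubcat (U : Type u) [Ring U] [HopfAlgebra ℂ U] [BijectiveAntipode U] where
  mem : URep.{u, u} U → Prop
  finite : ∀ V, mem V → FiniteDimensional ℂ V
  unit_mem : mem (URep.unit U)
  tensor_mem : ∀ V W, mem V → mem W → mem (V.tensor W)
  dual_mem : ∀ V, mem V → mem V.dual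
  ldual_mem : ∀ V, mem V → mem V.ldual

namespace TensorSubcat

variable {U : Type u} [Ring U] [HopfAlgebra ℂ U] [BijectiveAntipode U] (C : TensorSubcat U)

/-- The objects of `C`. -/
structure Obj : Type (u + 1) where
  rep : URep.{u, u} U
  mem : C.mem rep

variable {C}

instance Obj.instCoeSort : CoeSort C.Obj (Type u) := ⟨fun V => V.rep.carrier⟩

instance Obj.instFinite (V : C.Obj) : FiniteDimensional ℂ V := C.finite V.rep V.mem

/-- The unit object. -/
abbrev Obj.one (C : TensorSubcat U) : C.Obj := ⟨URep.unit U, C.unit_mem⟩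

/-- The tensor product of objects. -/
abbrev Obj.tensor (V W : C.Obj) : C.Obj :=
  ⟨V.rep.tensor W.rep, C.tensor_mem _ _ V.mem W.mem⟩

/-- The dual object `V^*`. -/
abbrev Obj.dual (V : C.Obj) : C.Obj := ⟨V.rep.dual, C.dual_mem _ V.mem⟩

/-- The dual object `^*V`. -/
abbrev Obj.ldual (V : C.Obj) : C.Obj := ⟨V.rep.ldual, C.ldual_mem _ V.mem⟩

/-- The Hopf algebra has enough modules in `C`: they separate its elements. -/
def Separating (C : TensorSubcat U) : Prop :=
  ∀ x : U, (∀ V : C.Obj, V.rep.ρ x = 0) → x = 0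

end TensorSubcat

open TensorSubcat (Obj)

section Legs

variable {A B D : Type*} [AddCommGroup A] [Module ℂ A] [AddCommGroup B] [Module ℂ B]
  [AddCommGroup D] [Module ℂ D]

/-- `X₁₂` on `(A ⊗ B) ⊗ D`. -/
def leg12 (D : Type*) [AddCommGroup D] [Module ℂ D] (X : Module.End ℂ (A ⊗[ℂ] B)) :
    Module.End ℂ ((A ⊗[ℂ] B) ⊗[ℂ] D) :=
  X.rTensor D

/-- `X₂₃` on `(A ⊗ B) ⊗ D`. -/
def leg23 (A : Type*) [AddCommGroup A] [Module ℂ A] (X : Module.End ℂ (B ⊗[ℂ] D)) :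
    Module.End ℂ ((A ⊗[ℂ] B) ⊗[ℂ] D) :=
  (TensorProduct.assoc ℂ A B D).symm.toLinearMap ∘ₗ X.lTensor A ∘ₗ
    (TensorProduct.assoc ℂ A B D).toLinearMap

/-- `X₁₃` on `(A ⊗ B) ⊗ D`. -/
def leg13 (B : Type*) [AddCommGroup B] [Module ℂ B] (X : Module.End ℂ (A ⊗[ℂ] D)) :
    Module.End ℂ ((A ⊗[ℂ] B) ⊗[ℂ] D) :=
  (TensorProduct.rightComm ℂ A D B).toLinearMap ∘ₗ X.rTensor B ∘ₗ
    (TensorProduct.rightComm ℂ A B D).toLinearMap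

end Legs

/-- A quasi-triangular structure on `U`, relative to the finite-dimensional modules in `C`.

`R V W` is the operator by which the universal R-matrix acts on `V ⊗ W`.  The R-matrix is an
element of the completion of `U ⊗ U` with respect to the modules `V ⊗ W`, that is, a family of
operators which agrees on any two of these modules with the action of one element of `U ⊗ U`.
`Lplus V` is `(id ⊗ ρ_V)(R)`, and `Lminus V` is `(ρ_V ⊗ id)(R⁻¹)`; they lie in `U ⊗ End V` and
`End V ⊗ U`, so that `R` also acts on `M ⊗ V` and `V ⊗ M` for an arbitrary `U`-module `M`. -/
structure QuasiTriangular {U : Type u} [Ring U] [HopfAlgebra ℂ U] [BijectiveAntipode U]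
    (C : TensorSubcat U) where
  R : ∀ V W : C.Obj, Module.End ℂ (V ⊗[ℂ] W)
  mem_completion : ∀ V W V' W' : C.Obj, ∃ a : U ⊗[ℂ] U,
    URep.act₂ V.rep W.rep a = R V W ∧ URep.act₂ V'.rep W'.rep a = R V' W'
  isUnit_R : ∀ V W : C.Obj, IsUnit (R V W)
  /-- `R Δ(x) = Δᶜᵒᵖ(x) R` -/
  R_comul : ∀ (V W : C.Obj) (x : U),
    R V W * URep.act₂ V.rep W.rep (Coalgebra.comul x) =
      URep.act₂ V.rep W.rep (TensorProduct.comm ℂ U U (Coalgebra.comul x)) * R V W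
  /-- `(Δ ⊗ id)(R) = R₁₃ R₂₃` -/
  comul_left : ∀ V W X : C.Obj,
    (R (V.tensor W) X : Module.End ℂ ((V ⊗[ℂ] W) ⊗[ℂ] X)) =
      leg13 W (R V X) * leg23 V (R W X)
  /-- `(id ⊗ Δ)(R) = R₁₃ R₁₂` -/
  comul_right : ∀ V W X : C.Obj,
    (TensorProduct.assoc ℂ V W X).symm.toLinearMap ∘ₗ
        (R V (W.tensor X) : Module.End ℂ (V ⊗[ℂ] (W ⊗[ℂ] X))) ∘ₗ
        (TensorProduct.assoc ℂ V W X).toLinearMap =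
      leg13 W (R V X) * leg12 X (R V W)
  Lplus : ∀ V : C.Obj, U ⊗[ℂ] Module.End ℂ V
  Lplus_spec : ∀ V W : C.Obj,
    Module.endTensorEndAlgHom (R := ℂ) (S := ℂ) (A := ℂ)
      (Algebra.TensorProduct.map W.rep.ρ (AlgHom.id ℂ (Module.End ℂ V)) (Lplus V)) = R W V
  Lminus : ∀ V : C.Obj, Module.End ℂ V ⊗[ℂ] U
  Lminus_spec : ∀ V W : C.Obj,
    Module.endTensorEndAlgHom (R := ℂ) (S := ℂ) (A := ℂ)
      (Algebra.TensorProduct.map (AlgHom.id ℂ (Module.End ℂ V)) W.rep.ρ (Lminus V)) * R V W = 1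

namespace QuasiTriangular

variable {U : Type u} [Ring U] [HopfAlgebra ℂ U] [BijectiveAntipode U] {C : TensorSubcat U}
  (Q : QuasiTriangular C)

/-- `(ρ_V ⊗ id)(R) = (id ⊗ S)(L_V⁻)`, an element of `End V ⊗ U`. -/
def Rhalf (V : C.Obj) : Module.End ℂ V ⊗[ℂ] U :=
  (HopfAlgebra.antipode ℂ : U →ₗ[ℂ] U).lTensor (Module.End ℂ V) (Q.Lminus V)

/-- `σ_{V,W} = τ ∘ R` for two objects of `C`. -/
def braid (V W : C.Obj) : V ⊗[ℂ] W →ₗ[ℂ] W ⊗[ℂ] V :=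
  (TensorProduct.comm ℂ V W).toLinearMap ∘ₗ Q.R V W

/-- `σ_{M,V} = τ ∘ R` for an arbitrary module `M` and an object `V` of `C`. -/
def braidMV (M : URep.{u, v} U) (V : C.Obj) : M ⊗[ℂ] V →ₗ[ℂ] V ⊗[ℂ] M :=
  (TensorProduct.comm ℂ M V).toLinearMap ∘ₗ
    Module.endTensorEndAlgHom (R := ℂ) (S := ℂ) (A := ℂ)
      (Algebra.TensorProduct.map M.ρ (AlgHom.id ℂ (Module.End ℂ V)) (Q.Lplus V))

/-- `σ_{V,M} = τ ∘ R` for an arbitrary module `M` and an object `V` of `C`. -/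
def braidVM (V : C.Obj) (M : URep.{u, v} U) : V ⊗[ℂ] M →ₗ[ℂ] M ⊗[ℂ] V :=
  (TensorProduct.comm ℂ V M).toLinearMap ∘ₗ
    Module.endTensorEndAlgHom (R := ℂ) (S := ℂ) (A := ℂ)
      (Algebra.TensorProduct.map (AlgHom.id ℂ (Module.End ℂ V)) M.ρ (Q.Rhalf V))

/-- `σ_{V,M}⁻¹ = R⁻¹ ∘ τ` for an arbitrary module `M` and an object `V` of `C`. -/
def braidVMInv (V : C.Obj) (M : URep.{u, v} U) : M ⊗[ℂ] V →ₗ[ℂ] V ⊗[ℂ] M :=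
  Module.endTensorEndAlgHom (R := ℂ) (S := ℂ) (A := ℂ)
      (Algebra.TensorProduct.map (AlgHom.id ℂ (Module.End ℂ V)) M.ρ (Q.Lminus V)) ∘ₗ
    (TensorProduct.comm ℂ M V).toLinearMap

/-- The R-matrix commutes with homomorphisms in both arguments. -/
theorem R_natural {V V' W W' : C.Obj} (φ : V →ₗ[ℂ] V') (ψ : W →ₗ[ℂ] W')
    (hφ : URep.IsHom V.rep V'.rep φ) (hψ : URep.IsHom W.rep W'.rep ψ) (t : V ⊗[ℂ] W) :
    Q.R V' W' (TensorProduct.map φ ψ t) = TensorProduct.map φ ψ (Q.R V W t) := by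
  obtain ⟨a, ha, ha'⟩ := Q.mem_completion V W V' W'
  rw [← ha, ← ha']
  exact URep.act₂_natural hφ hψ a t

end QuasiTriangular

/-! ### The CoEnd algebra -/

section CoEndSection

variable {U : Type u} [Ring U] [HopfAlgebra ℂ U] [BijectiveAntipode U]

/-- The direct sum of all `V^* ⊗ V`, `V ∈ C`. -/
def PreCoEnd (C : TensorSubcat U) : Type (u + 1) := ⨁ V : C.Obj, Module.Dual ℂ V ⊗[ℂ] V

instance PreCoEnd.instAddCommGroup (C : TensorSubcat U) : AddCommGroup (PreCoEnd C) :=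
  inferInstanceAs (AddCommGroup (⨁ V : C.Obj, Module.Dual ℂ V ⊗[ℂ] V))

instance PreCoEnd.instModule (C : TensorSubcat U) : Module ℂ (PreCoEnd C) :=
  inferInstanceAs (Module ℂ (⨁ V : C.Obj, Module.Dual ℂ V ⊗[ℂ] V))

open Classical in
/-- The inclusion of a summand. -/
def PreCoEnd.of {C : TensorSubcat U} (V : C.Obj) : Module.Dual ℂ V ⊗[ℂ] V →ₗ[ℂ] PreCoEnd C :=
  DirectSum.lof ℂ C.Obj (fun V : C.Obj => Module.Dual ℂ V ⊗[ℂ] V) V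

open Classical in
/-- Linear maps out of the direct sum. -/
def PreCoEnd.desc {C : TensorSubcat U} {X : Type*} [AddCommGroup X] [Module ℂ X]
    (F : ∀ V : C.Obj, Module.Dual ℂ V ⊗[ℂ] V →ₗ[ℂ] X) : PreCoEnd C →ₗ[ℂ] X :=
  DirectSum.toModule ℂ C.Obj X F

theorem PreCoEnd.desc_of {C : TensorSubcat U} {X : Type*} [AddCommGroup X] [Module ℂ X]
    (F : ∀ V : C.Obj, Module.Dual ℂ V ⊗[ℂ] V →ₗ[ℂ] X) (V : C.Obj)
    (x : Module.Dual ℂ V ⊗[ℂ] V) : PreCoEnd.desc F (PreCoEnd.of V x) = F V x := by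
  classical
  exact DirectSum.toModule_lof (M := fun V : C.Obj => Module.Dual ℂ V ⊗[ℂ] V) ℂ V x

theorem PreCoEnd.hom_ext {C : TensorSubcat U} {X : Type*} [AddCommGroup X] [Module ℂ X]
    {f g : PreCoEnd C →ₗ[ℂ] X} (h : ∀ V : C.Obj, f ∘ₗ PreCoEnd.of V = g ∘ₗ PreCoEnd.of V) :
    f = g := by
  classical
  exact DirectSum.linearMap_ext (M := fun V : C.Obj => Module.Dual ℂ V ⊗[ℂ] V) ℂ h

/-- The relations `φ^*α ⊗ v - α ⊗ φ v`, for `φ : V → W` in `C`, `α ∈ W^*` and `v ∈ V`. -/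
def coEndRel (C : TensorSubcat U) : Submodule ℂ (PreCoEnd C) :=
  Submodule.span ℂ {z | ∃ (V W : C.Obj) (φ : V →ₗ[ℂ] W) (_ : URep.IsHom V.rep W.rep φ)
    (α : Module.Dual ℂ W) (v : V),
    z = PreCoEnd.of V ((α ∘ₗ φ) ⊗ₜ v) - PreCoEnd.of W (α ⊗ₜ φ v)}

/-- The vector space underlying the coend `A` of `V^* ⊠ V`, `V ∈ C`. -/
def CoEnd (C : TensorSubcat U) : Type (u + 1) := PreCoEnd C ⧸ coEndRel C

instance CoEnd.instAddCommGroup (C : TensorSubcat U) : AddCommGroup (CoEnd C) :=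
  inferInstanceAs (AddCommGroup (PreCoEnd C ⧸ coEndRel C))

instance CoEnd.instModule (C : TensorSubcat U) : Module ℂ (CoEnd C) :=
  inferInstanceAs (Module ℂ (PreCoEnd C ⧸ coEndRel C))

namespace CoEnd

variable {C : TensorSubcat U}

/-- The canonical map `V^* ⊗ V → A`. -/
def mk (V : C.Obj) : Module.Dual ℂ V ⊗[ℂ] V →ₗ[ℂ] CoEnd C :=
  (coEndRel C).mkQ ∘ₗ PreCoEnd.of V

theorem mk_dinatural {V W : C.Obj} {φ : V →ₗ[ℂ] W} (hφ : URep.IsHom V.rep W.rep φ)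
    (α : Module.Dual ℂ W) (v : V) :
    mk V ((α ∘ₗ φ) ⊗ₜ v) = mk W (α ⊗ₜ φ v) := by
  refine (Submodule.Quotient.eq (coEndRel C)).2 (Submodule.subset_span ?_)
  exact ⟨V, W, φ, hφ, α, v, rfl⟩

/-- Linear maps out of `A` are dinatural families of linear maps out of `V^* ⊗ V`. -/
def lift {X : Type*} [AddCommGroup X] [Module ℂ X]
    (F : ∀ V : C.Obj, Module.Dual ℂ V ⊗[ℂ] V →ₗ[ℂ] X)
    (hF : ∀ (V W : C.Obj) (φ : V →ₗ[ℂ] W), URep.IsHom V.rep W.rep φ →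
      ∀ (α : Module.Dual ℂ W) (v : V), F V ((α ∘ₗ φ) ⊗ₜ v) = F W (α ⊗ₜ φ v)) :
    CoEnd C →ₗ[ℂ] X :=
  (coEndRel C).liftQ (PreCoEnd.desc F) (by
    refine Submodule.span_le.2 ?_
    rintro z ⟨V, W, φ, hφ, α, v, rfl⟩
    rw [SetLike.mem_coe, LinearMap.mem_ker, map_sub, PreCoEnd.desc_of, PreCoEnd.desc_of,
      hF V W φ hφ α v, sub_self])

theorem lift_mk {X : Type*} [AddCommGroup X] [Module ℂ X]
    (F : ∀ V : C.Obj, Module.Dual ℂ V ⊗[ℂ] V →ₗ[ℂ] X)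
    (hF : ∀ (V W : C.Obj) (φ : V →ₗ[ℂ] W), URep.IsHom V.rep W.rep φ →
      ∀ (α : Module.Dual ℂ W) (v : V), F V ((α ∘ₗ φ) ⊗ₜ v) = F W (α ⊗ₜ φ v))
    (V : C.Obj) (x : Module.Dual ℂ V ⊗[ℂ] V) : lift F hF (mk V x) = F V x :=
  PreCoEnd.desc_of F V x

theorem hom_ext {X : Type*} [AddCommGroup X] [Module ℂ X] {f g : CoEnd C →ₗ[ℂ] X}
    (h : ∀ (V : C.Obj) (x : Module.Dual ℂ V ⊗[ℂ] V), f (mk V x) = g (mk V x)) : f = g := by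
  have h' : f ∘ₗ (coEndRel C).mkQ = g ∘ₗ (coEndRel C).mkQ :=
    PreCoEnd.hom_ext fun V => LinearMap.ext fun x => h V x
  exact Submodule.linearMap_qext _ h'

/-- `x ↦ lift (fun W => B W x)`, for dinatural `B`. -/
def liftRow {X Y : Type*} [AddCommGroup X] [Module ℂ X] [AddCommGroup Y] [Module ℂ Y]
    (B : ∀ W : C.Obj, Y →ₗ[ℂ] Module.Dual ℂ W ⊗[ℂ] W →ₗ[ℂ] X)
    (hr : ∀ (W W' : C.Obj) (ψ : W →ₗ[ℂ] W'), URep.IsHom W.rep W'.rep ψ →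
      ∀ (x : Y) (β : Module.Dual ℂ W') (w : W), B W x ((β ∘ₗ ψ) ⊗ₜ w) = B W' x (β ⊗ₜ ψ w)) :
    Y →ₗ[ℂ] CoEnd C →ₗ[ℂ] X where
  toFun x := lift (fun W => B W x) (fun W W' ψ hψ β w => hr W W' ψ hψ x β w)
  map_add' x y := hom_ext fun W z => by
    rw [lift_mk, LinearMap.add_apply, lift_mk, lift_mk, map_add, LinearMap.add_apply]
  map_smul' c x := hom_ext fun W z => by
    rw [lift_mk, RingHom.id_apply, LinearMap.smul_apply, lift_mk, map_smul, LinearMap.smul_apply]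

theorem liftRow_mk {X Y : Type*} [AddCommGroup X] [Module ℂ X] [AddCommGroup Y] [Module ℂ Y]
    (B : ∀ W : C.Obj, Y →ₗ[ℂ] Module.Dual ℂ W ⊗[ℂ] W →ₗ[ℂ] X)
    (hr : ∀ (W W' : C.Obj) (ψ : W →ₗ[ℂ] W'), URep.IsHom W.rep W'.rep ψ →
      ∀ (x : Y) (β : Module.Dual ℂ W') (w : W), B W x ((β ∘ₗ ψ) ⊗ₜ w) = B W' x (β ⊗ₜ ψ w))
    (x : Y) (W : C.Obj) (z : Module.Dual ℂ W ⊗[ℂ] W) : liftRow B hr x (mk W z) = B W x z :=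
  lift_mk (fun W => B W x) (fun W W' ψ hψ β w => hr W W' ψ hψ x β w) W z

/-- Bilinear maps on `A`, defined on generators. -/
def lift₂ {X : Type*} [AddCommGroup X] [Module ℂ X]
    (B : ∀ V W : C.Obj, Module.Dual ℂ V ⊗[ℂ] V →ₗ[ℂ] Module.Dual ℂ W ⊗[ℂ] W →ₗ[ℂ] X)
    (hl : ∀ (V V' W : C.Obj) (φ : V →ₗ[ℂ] V'), URep.IsHom V.rep V'.rep φ →
      ∀ (α : Module.Dual ℂ V') (v : V) (y : Module.Dual ℂ W ⊗[ℂ] W),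
        B V W ((α ∘ₗ φ) ⊗ₜ v) y = B V' W (α ⊗ₜ φ v) y)
    (hr : ∀ (V W W' : C.Obj) (ψ : W →ₗ[ℂ] W'), URep.IsHom W.rep W'.rep ψ →
      ∀ (x : Module.Dual ℂ V ⊗[ℂ] V) (β : Module.Dual ℂ W') (w : W),
        B V W x ((β ∘ₗ ψ) ⊗ₜ w) = B V W' x (β ⊗ₜ ψ w)) :
    CoEnd C →ₗ[ℂ] CoEnd C →ₗ[ℂ] X :=
  lift (fun V => liftRow (B V) (hr V)) (fun V V' φ hφ α v => hom_ext fun W z => by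
    rw [liftRow_mk, liftRow_mk, hl V V' W φ hφ])

theorem lift₂_mk {X : Type*} [AddCommGroup X] [Module ℂ X]
    (B : ∀ V W : C.Obj, Module.Dual ℂ V ⊗[ℂ] V →ₗ[ℂ] Module.Dual ℂ W ⊗[ℂ] W →ₗ[ℂ] X)
    (hl : ∀ (V V' W : C.Obj) (φ : V →ₗ[ℂ] V'), URep.IsHom V.rep V'.rep φ →
      ∀ (α : Module.Dual ℂ V') (v : V) (y : Module.Dual ℂ W ⊗[ℂ] W),
        B V W ((α ∘ₗ φ) ⊗ₜ v) y = B V' W (α ⊗ₜ φ v) y)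
    (hr : ∀ (V W W' : C.Obj) (ψ : W →ₗ[ℂ] W'), URep.IsHom W.rep W'.rep ψ →
      ∀ (x : Module.Dual ℂ V ⊗[ℂ] V) (β : Module.Dual ℂ W') (w : W),
        B V W x ((β ∘ₗ ψ) ⊗ₜ w) = B V W' x (β ⊗ₜ ψ w))
    (V W : C.Obj) (x : Module.Dual ℂ V ⊗[ℂ] V) (y : Module.Dual ℂ W ⊗[ℂ] W) :
    lift₂ B hl hr (mk V x) (mk W y) = B V W x y := by
  rw [lift₂, lift_mk, liftRow_mk]

/-- The action of the first copy of `U` on `A`: `x ⊗ 1` sends `α ⊗ v` to `x α ⊗ v`. -/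
def actLeft (x : U) : CoEnd C →ₗ[ℂ] CoEnd C :=
  lift (fun V => mk V ∘ₗ ((V.rep.dual.ρ x : Module.End ℂ (Module.Dual ℂ V)).rTensor V))
    (fun V W φ hφ α v => by
      have h : (V.rep.dual.ρ x : Module.End ℂ (Module.Dual ℂ V)) (α ∘ₗ φ) =
          ((W.rep.dual.ρ x : Module.End ℂ (Module.Dual ℂ W)) α) ∘ₗ φ := (hφ.transpose x α).symm
      rw [LinearMap.comp_apply, LinearMap.comp_apply, LinearMap.rTensor_tmul,
        LinearMap.rTensor_tmul, h, mk_dinatural hφ])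

/-- The action of the second copy of `U` on `A`: `1 ⊗ x` sends `α ⊗ v` to `α ⊗ x v`. -/
def actRight (x : U) : CoEnd C →ₗ[ℂ] CoEnd C :=
  lift (fun V => mk V ∘ₗ ((V.rep.ρ x : Module.End ℂ V).lTensor (Module.Dual ℂ V)))
    (fun V W φ hφ α v => by
      rw [LinearMap.comp_apply, LinearMap.comp_apply, LinearMap.lTensor_tmul,
        LinearMap.lTensor_tmul, mk_dinatural hφ, hφ x v])

theorem actLeft_mk (x : U) (V : C.Obj) (α : Module.Dual ℂ V) (v : V) :
    actLeft x (mk V (α ⊗ₜ v)) = mk V ((V.rep.dual.ρ x : Module.End ℂ (Module.Dual ℂ V)) α ⊗ₜ v) :=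
  lift_mk _ _ V _

theorem actRight_mk (x : U) (V : C.Obj) (α : Module.Dual ℂ V) (v : V) :
    actRight x (mk V (α ⊗ₜ v)) = mk V (α ⊗ₜ V.rep.ρ x v) :=
  lift_mk _ _ V _

/-- `actLeft` is linear in the element of `U`. -/
def actLeftHom (C : TensorSubcat U) : U →ₗ[ℂ] CoEnd C →ₗ[ℂ] CoEnd C where
  toFun := actLeft
  map_add' x y := hom_ext fun V z => by
    induction z using TensorProduct.induction_on with
    | zero => simp
    | add s t h1 h2 => simp only [map_add, h1, h2]
    | tmul α v =>
      simp only [LinearMap.add_apply, actLeft_mk, map_add, TensorProduct.add_tmul]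
  map_smul' c x := hom_ext fun V z => by
    induction z using TensorProduct.induction_on with
    | zero => simp
    | add s t h1 h2 => simp only [map_add, h1, h2]
    | tmul α v =>
      simp only [LinearMap.smul_apply, actLeft_mk, map_smul, RingHom.id_apply]
      exact (mk V).map_smul c
        ((V.rep.dual.ρ x : Module.End ℂ (Module.Dual ℂ V)) α ⊗ₜ[ℂ] v)

/-- `actRight` is linear in the element of `U`. -/
def actRightHom (C : TensorSubcat U) : U →ₗ[ℂ] CoEnd C →ₗ[ℂ] CoEnd C where
  toFun := actRight
  map_add' x y := hom_ext fun V z => by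
    induction z using TensorProduct.induction_on with
    | zero => simp
    | add s t h1 h2 => simp only [map_add, h1, h2]
    | tmul α v =>
      simp only [LinearMap.add_apply, actRight_mk, map_add, TensorProduct.tmul_add]
  map_smul' c x := hom_ext fun V z => by
    induction z using TensorProduct.induction_on with
    | zero => simp
    | add s t h1 h2 => simp only [map_add, h1, h2]
    | tmul α v =>
      simp only [LinearMap.smul_apply, actRight_mk, map_smul, TensorProduct.tmul_smul,
        RingHom.id_apply]

/-- The unit of `A`: the class of `1 ⊗ 1` in `1^* ⊠ 1`. -/
def one (C : TensorSubcat U) : CoEnd C :=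
  mk (Obj.one C) ((ULift.moduleEquiv.toLinearMap : ULift.{u} ℂ →ₗ[ℂ] ℂ) ⊗ₜ (ULift.up 1))

/-- `s ⊗ t ↦ [s ⊠ t]` for `s ∈ V^* ⊗ W^*` and `t ∈ V ⊗ W`.  Here `V^* ⊗ W^*` is flipped to
`W^* ⊗ V^*` and then identified with `(V ⊗ W)^*` by `⟨β ⊗ α, v ⊗ w⟩ = α(v) β(w)`. -/
def pairing (V W : C.Obj) :
    Module.Dual ℂ V ⊗[ℂ] Module.Dual ℂ W →ₗ[ℂ] V ⊗[ℂ] W →ₗ[ℂ] CoEnd C :=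
  (LinearMap.compr₂ (TensorProduct.mk ℂ (Module.Dual ℂ (V ⊗[ℂ] W)) (V ⊗[ℂ] W))
    (mk (V.tensor W))) ∘ₗ TensorProduct.dualDistrib ℂ V W

theorem pairing_dinatural {V V' W W' : C.Obj} {φ : V →ₗ[ℂ] V'} {ψ : W →ₗ[ℂ] W'}
    (hφ : URep.IsHom V.rep V'.rep φ) (hψ : URep.IsHom W.rep W'.rep ψ)
    (s : Module.Dual ℂ V' ⊗[ℂ] Module.Dual ℂ W') (t : V ⊗[ℂ] W) :
    pairing V W (TensorProduct.map (Module.Dual.transpose (R := ℂ) φ)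
      (Module.Dual.transpose (R := ℂ) ψ) s) t = pairing V' W' s (TensorProduct.map φ ψ t) := by
  have h : TensorProduct.dualDistrib ℂ V W (TensorProduct.map (Module.Dual.transpose (R := ℂ) φ)
      (Module.Dual.transpose (R := ℂ) ψ) s) =
      TensorProduct.dualDistrib ℂ V' W' s ∘ₗ TensorProduct.map φ ψ := by
    induction s using TensorProduct.induction_on with
    | zero => simp
    | add s t h1 h2 => simp only [map_add, h1, h2, LinearMap.add_comp]
    | tmul α β =>
      ext v w
      simp [Module.Dual.transpose_apply]
  change mk (V.tensor W) (_ ⊗ₜ t) = mk (V'.tensor W') (_ ⊗ₜ _)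
  rw [h]
  exact mk_dinatural (V := V.tensor W) (W := V'.tensor W') (hφ.tensor hψ) _ t

variable (Q : QuasiTriangular C)

/-- The multiplication of `A` on generators, after reordering the factors:
`(V^* ⊗ W^*) ⊠ (V ⊗ W) → (W^* ⊗ V^*) ⊠ (V ⊗ W) ≅ (V ⊗ W)^* ⊠ (V ⊗ W)`, the first map being
`σ_{V^*,W^*} ⊠ id`. -/
def genMul (V W : C.Obj) :
    (Module.Dual ℂ V ⊗[ℂ] Module.Dual ℂ W) ⊗[ℂ] (V ⊗[ℂ] W) →ₗ[ℂ] CoEnd C :=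
  TensorProduct.lift (pairing V W ∘ₗ
    (Q.R V.dual W.dual : Module.End ℂ (Module.Dual ℂ V ⊗[ℂ] Module.Dual ℂ W)))

theorem genMul_dinatural {V V' W W' : C.Obj} {φ : V →ₗ[ℂ] V'} {ψ : W →ₗ[ℂ] W'}
    (hφ : URep.IsHom V.rep V'.rep φ) (hψ : URep.IsHom W.rep W'.rep ψ)
    (α : Module.Dual ℂ V') (β : Module.Dual ℂ W') (v : V) (w : W) :
    genMul Q V W (((α ∘ₗ φ) ⊗ₜ (β ∘ₗ ψ)) ⊗ₜ (v ⊗ₜ w)) =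
      genMul Q V' W' ((α ⊗ₜ β) ⊗ₜ (φ v ⊗ₜ ψ w)) := by
  have h := Q.R_natural (V := V'.dual) (V' := V.dual) (W := W'.dual) (W' := W.dual)
    (Module.Dual.transpose (R := ℂ) φ) (Module.Dual.transpose (R := ℂ) ψ)
    hφ.transpose hψ.transpose (α ⊗ₜ β)
  change pairing V W (Q.R V.dual W.dual ((α ∘ₗ φ) ⊗ₜ (β ∘ₗ ψ))) (v ⊗ₜ w) =
    pairing V' W' (Q.R V'.dual W'.dual (α ⊗ₜ β)) (TensorProduct.map φ ψ (v ⊗ₜ w))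
  refine Eq.trans ?_ (pairing_dinatural hφ hψ _ _)
  exact congrArg (fun s => pairing V W s (v ⊗ₜ w)) h

/-- The product of `Ã = (F ⊠ F)(A)`:  `(α ⊠ v)(β ⊠ w) = σ_{V^*,W^*}(α ⊗ β) ⊠ (v ⊗ w)`. -/
def mul : CoEnd C →ₗ[ℂ] CoEnd C →ₗ[ℂ] CoEnd C :=
  lift₂
    (fun V W => TensorProduct.curry (genMul Q V W ∘ₗ
      (TensorProduct.tensorTensorTensorComm ℂ (Module.Dual ℂ V) V (Module.Dual ℂ W)
        W).toLinearMap))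
    (fun V V' W φ hφ α v y => by
      induction y using TensorProduct.induction_on with
      | zero => simp
      | add s t h1 h2 => simp only [map_add, h1, h2]
      | tmul β w => exact genMul_dinatural Q hφ (URep.IsHom.id W.rep) α β v w)
    (fun V W W' ψ hψ x β w => by
      induction x using TensorProduct.induction_on with
      | zero => simp
      | add s t h1 h2 => simp only [map_add, LinearMap.add_apply, h1, h2]
      | tmul α v => exact genMul_dinatural Q (URep.IsHom.id V.rep) hψ α β v w)

/-- `V^* ⊗ V ⊗ W^* ⊗ W → V^* ⊗ W^* ⊗ V ⊗ W`, the braiding `σ_{V,W^*}` in the middle. -/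
def middleBraid (V W : C.Obj) :
    (Module.Dual ℂ V ⊗[ℂ] V) ⊗[ℂ] (Module.Dual ℂ W ⊗[ℂ] W) →ₗ[ℂ]
      (Module.Dual ℂ V ⊗[ℂ] Module.Dual ℂ W) ⊗[ℂ] (V ⊗[ℂ] W) :=
  (TensorProduct.assoc ℂ (Module.Dual ℂ V) (Module.Dual ℂ W) (V ⊗[ℂ] W)).symm.toLinearMap ∘ₗ
  LinearMap.lTensor (Module.Dual ℂ V)
    ((TensorProduct.assoc ℂ (Module.Dual ℂ W) V W).toLinearMap ∘ₗ
      LinearMap.rTensor W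
        (Q.braid V W.dual : V ⊗[ℂ] Module.Dual ℂ W →ₗ[ℂ] Module.Dual ℂ W ⊗[ℂ] V) ∘ₗ
      (TensorProduct.assoc ℂ V (Module.Dual ℂ W) W).symm.toLinearMap) ∘ₗ
  (TensorProduct.assoc ℂ (Module.Dual ℂ V) V (Module.Dual ℂ W ⊗[ℂ] W)).toLinearMap

/-- `δ ⊗ v ↦ (α ⊗ δ) ⊗ (v ⊗ w)`. -/
def insertMiddle (V W : C.Obj) (α : Module.Dual ℂ V) (w : W) :
    Module.Dual ℂ W ⊗[ℂ] V →ₗ[ℂ] (Module.Dual ℂ V ⊗[ℂ] Module.Dual ℂ W) ⊗[ℂ] (V ⊗[ℂ] W) :=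
  TensorProduct.map (TensorProduct.mk ℂ _ _ α) ((TensorProduct.mk ℂ V W).flip w)

theorem middleBraid_tmul (V W : C.Obj) (α : Module.Dual ℂ V) (v : V) (β : Module.Dual ℂ W)
    (w : W) : middleBraid Q V W ((α ⊗ₜ v) ⊗ₜ (β ⊗ₜ w)) =
      insertMiddle V W α w (Q.braid V W.dual (v ⊗ₜ β)) := by
  change (TensorProduct.assoc ℂ (Module.Dual ℂ V) (Module.Dual ℂ W) (V ⊗[ℂ] W)).symm
    (α ⊗ₜ (TensorProduct.assoc ℂ (Module.Dual ℂ W) V W)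
      ((Q.braid V W.dual (v ⊗ₜ β) : Module.Dual ℂ W ⊗[ℂ] V) ⊗ₜ w)) = _
  generalize (Q.braid V W.dual (v ⊗ₜ β) : Module.Dual ℂ W ⊗[ℂ] V) = t
  induction t using TensorProduct.induction_on with
  | zero => simp
  | add s t h1 h2 => simp only [map_add, TensorProduct.add_tmul, TensorProduct.tmul_add, h1, h2]
  | tmul δ v => rfl

theorem genMul_insertMiddle {V V' W W' : C.Obj} {φ : V →ₗ[ℂ] V'} {ψ : W →ₗ[ℂ] W'}
    (hφ : URep.IsHom V.rep V'.rep φ) (hψ : URep.IsHom W.rep W'.rep ψ)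
    (α : Module.Dual ℂ V') (w : W) (t : Module.Dual ℂ W' ⊗[ℂ] V) :
    genMul Q V W (insertMiddle V W (α ∘ₗ φ) w
        (TensorProduct.map (Module.Dual.transpose (R := ℂ) ψ) LinearMap.id t)) =
      genMul Q V' W' (insertMiddle V' W' α (ψ w) (TensorProduct.map LinearMap.id φ t)) := by
  induction t using TensorProduct.induction_on with
  | zero => simp
  | add s t h1 h2 => simp only [map_add, h1, h2]
  | tmul δ v => exact genMul_dinatural Q hφ hψ α δ v w

theorem braid_natural {V V' W W' : C.Obj} {φ : V →ₗ[ℂ] V'} {ψ : W →ₗ[ℂ] W'}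
    (hφ : URep.IsHom V.rep V'.rep φ) (hψ : URep.IsHom W.rep W'.rep ψ) (t : V ⊗[ℂ] W) :
    Q.braid V' W' (TensorProduct.map φ ψ t) = TensorProduct.map ψ φ (Q.braid V W t) := by
  change TensorProduct.comm ℂ V' W' (Q.R V' W' _) =
    TensorProduct.map ψ φ (TensorProduct.comm ℂ V W (Q.R V W t))
  rw [Q.R_natural φ ψ hφ hψ, TensorProduct.map_comm]

/-- The product of `F₂(A)`: first `σ_{V,W^*}` in the middle, then the product of `A`. -/
def mul₂ : CoEnd C →ₗ[ℂ] CoEnd C →ₗ[ℂ] CoEnd C :=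
  lift₂
    (fun V W => TensorProduct.curry (genMul Q V W ∘ₗ middleBraid Q V W))
    (fun V V' W φ hφ α v y => by
      induction y using TensorProduct.induction_on with
      | zero => simp
      | add s t h1 h2 => simp only [map_add, h1, h2]
      | tmul β w =>
        change genMul Q V W (middleBraid Q V W (((α ∘ₗ φ) ⊗ₜ v) ⊗ₜ (β ⊗ₜ w))) =
          genMul Q V' W (middleBraid Q V' W ((α ⊗ₜ φ v) ⊗ₜ (β ⊗ₜ w)))
        rw [middleBraid_tmul, middleBraid_tmul]
        have h1 := genMul_insertMiddle Q hφ (URep.IsHom.id W.rep) α w (Q.braid V W.dual (v ⊗ₜ β))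
        have h2 := braid_natural Q (V := V) (V' := V') (W := W.dual) (W' := W.dual) hφ
          (URep.IsHom.id W.rep.dual) (v ⊗ₜ β)
        have h3 : TensorProduct.map (Module.Dual.transpose (R := ℂ) (LinearMap.id : W →ₗ[ℂ] W))
            (LinearMap.id : V →ₗ[ℂ] V) = LinearMap.id := TensorProduct.map_id
        refine Eq.trans (congrArg (fun z => genMul Q V W (insertMiddle V W (α ∘ₗ φ) w z))
          (LinearMap.congr_fun h3 _).symm) (h1.trans ?_)
        exact congrArg (fun z => genMul Q V' W (insertMiddle V' W α w z)) h2.symm)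
    (fun V W W' ψ hψ x β w => by
      induction x using TensorProduct.induction_on with
      | zero => simp
      | add s t h1 h2 => simp only [map_add, LinearMap.add_apply, h1, h2]
      | tmul α v =>
        change genMul Q V W (middleBraid Q V W ((α ⊗ₜ v) ⊗ₜ ((β ∘ₗ ψ) ⊗ₜ w))) =
          genMul Q V W' (middleBraid Q V W' ((α ⊗ₜ v) ⊗ₜ (β ⊗ₜ ψ w)))
        rw [middleBraid_tmul, middleBraid_tmul]
        have h1 := genMul_insertMiddle Q (URep.IsHom.id V.rep) hψ α w
          (Q.braid V W'.dual (v ⊗ₜ β))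
        have h2 := braid_natural Q (V := V) (V' := V) (W := W'.dual) (W' := W.dual)
          (URep.IsHom.id V.rep) hψ.transpose (v ⊗ₜ β)
        have h3 : TensorProduct.map (LinearMap.id : Module.Dual ℂ W' →ₗ[ℂ] Module.Dual ℂ W')
            (LinearMap.id : V →ₗ[ℂ] V) = LinearMap.id := TensorProduct.map_id
        refine Eq.trans (congrArg (fun z => genMul Q V W (insertMiddle V W α w z)) h2)
          (h1.trans ?_)
        exact congrArg (fun z => genMul Q V W' (insertMiddle V W' α (ψ w) z))
          (LinearMap.congr_fun h3 _))

theorem mul_mk (V W : C.Obj) (α : Module.Dual ℂ V) (v : V) (β : Module.Dual ℂ W) (w : W) :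
    mul Q (mk V (α ⊗ₜ v)) (mk W (β ⊗ₜ w)) = genMul Q V W ((α ⊗ₜ β) ⊗ₜ (v ⊗ₜ w)) :=
  lift₂_mk _ _ _ V W _ _

theorem mul₂_mk (V W : C.Obj) (α : Module.Dual ℂ V) (v : V) (β : Module.Dual ℂ W) (w : W) :
    mul₂ Q (mk V (α ⊗ₜ v)) (mk W (β ⊗ₜ w)) =
      genMul Q V W (middleBraid Q V W ((α ⊗ₜ v) ⊗ₜ (β ⊗ₜ w))) :=
  lift₂_mk _ _ _ V W _ _

end CoEnd

end CoEndSection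

/-! ### The double affine braid group -/

/-- Generators `T_0, …, T_n, K_0`. -/
inductive DABGen (n : ℕ) : Type
  | T : Fin (n + 1) → DABGen n
  | K : DABGen n

/-- The generator `T_i` (used for `i ≤ n`). -/
def DABGen.t (n i : ℕ) : FreeGroup (DABGen n) := FreeGroup.of (DABGen.T (Fin.ofNat (n + 1) i))

/-- The generator `K_0`. -/
def DABGen.k (n : ℕ) : FreeGroup (DABGen n) := FreeGroup.of DABGen.K

open DABGen in
/-- The defining relations `a = b` of the double affine braid group of type `C^∨ C_n`.  For `n = 1`
the affine diagram has two nodes joined by a bond without relation, and there is no relation. -/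
inductive DABRel (n : ℕ) : FreeGroup (DABGen n) → FreeGroup (DABGen n) → Prop
  | comm (i j : ℕ) (hij : i + 1 < j) (hj : j ≤ n) : DABRel n (t n i * t n j) (t n j * t n i)
  | braid (i : ℕ) (hi : 1 ≤ i) (hin : i + 1 < n) :
      DABRel n (t n i * t n (i + 1) * t n i) (t n (i + 1) * t n i * t n (i + 1))
  | quad_zero (hn : 2 ≤ n) :
      DABRel n (t n 0 * t n 1 * t n 0 * t n 1) (t n 1 * t n 0 * t n 1 * t n 0)
  | quad_last (hn : 2 ≤ n) :
      DABRel n (t n (n - 1) * t n n * t n (n - 1) * t n n)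
        (t n n * t n (n - 1) * t n n * t n (n - 1))
  | K_comm (i : ℕ) (hi : 2 ≤ i) (hin : i ≤ n) : DABRel n (k n * t n i) (t n i * k n)
  | K_quad (hn : 2 ≤ n) : DABRel n (t n 1 * k n * t n 1 * k n) (k n * t n 1 * k n * t n 1)
  | K_cross (hn : 2 ≤ n) :
      DABRel n (t n 0 * (t n 1)⁻¹ * k n * t n 1) ((t n 1)⁻¹ * k n * t n 1 * t n 0)

/-- The double affine braid group of type `C^∨ C_n`. -/
abbrev DoubleAffineBraidGroup (n : ℕ) : Type :=
  PresentedGroup {r : FreeGroup (DABGen n) | ∃ a b, DABRel n a b ∧ r = a * b⁻¹}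

/-- The element `T_i` of the double affine braid group. -/
def DoubleAffineBraidGroup.T {n : ℕ} (i : Fin (n + 1)) : DoubleAffineBraidGroup n :=
  PresentedGroup.of (DABGen.T i)

/-- The element `K_0` of the double affine braid group. -/
def DoubleAffineBraidGroup.K (n : ℕ) : DoubleAffineBraidGroup n :=
  PresentedGroup.of DABGen.K

/-! ### Characters, the operators `J`, `J'`, and Noumi coideal subalgebras -/

namespace QuasiTriangular

variable {U : Type u} [Ring U] [HopfAlgebra ℂ U] [BijectiveAntipode U] {C : TensorSubcat U}

/-- A character (unital algebra homomorphism to `ℂ`) of the algebra `F₂(A)`. -/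
structure Character (Q : QuasiTriangular C) where
  toLin : CoEnd C →ₗ[ℂ] ℂ
  map_one : toLin (CoEnd.one C) = 1
  map_mul : ∀ a b, toLin (CoEnd.mul₂ Q a b) = toLin a * toLin b

variable {Q : QuasiTriangular C}

/-- `J_V = (id ⊗ f) ∘ (coev_V ⊗ id) : V → V ⊗ V^* ⊗ V → V`, that is
`J_V(v) = ∑ᵢ f([eⁱ ⊗ v]) eᵢ`. -/
def Character.J (f : Q.Character) (V : C.Obj) : Module.End ℂ V :=
  ∑ i, (f.toLin ∘ₗ CoEnd.mk V ∘ₗ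
    TensorProduct.mk ℂ (Module.Dual ℂ V) V ((Module.finBasis ℂ V).coord i)).smulRight
      (Module.finBasis ℂ V i)

/-- `J'_V = (g ⊗ id) ∘ (id ⊗ coev_{^*V}) : V → V ⊗ ^*V ⊗ V → V`, where `V ⊗ ^*V` is
`X^* ⊗ X` for `X = ^*V`; that is `J'_V(v) = ∑ᵢ g([v ⊗ eⁱ]) eᵢ`. -/
def Character.J' (g : Q.Character) (V : C.Obj) : Module.End ℂ V :=
  ∑ i, (g.toLin ∘ₗ CoEnd.mk V.ldual ∘ₗ
    (TensorProduct.mk ℂ (Module.Dual ℂ (Module.Dual ℂ V)) (Module.Dual ℂ V)).flip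
      ((Module.finBasis ℂ V).coord i) ∘ₗ Module.Dual.eval ℂ V).smulRight
      (Module.finBasis ℂ V i)

/-- The matrix coefficient `X ↦ X_{ij}` (the coefficient of `eᵢ` in `X eⱼ`). -/
def coeff (V : C.Obj) (i j : Fin (Module.finrank ℂ V)) : Module.End ℂ V →ₗ[ℂ] ℂ :=
  (Module.finBasis ℂ V).coord i ∘ₗ LinearMap.applyₗ (Module.finBasis ℂ V j)

variable (Q)

/-- `l⁺_{ij}`, defined by `L_V⁺(1 ⊗ eⱼ) = ∑ᵢ l⁺_{ij} ⊗ eᵢ`. -/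
def lplus (V : C.Obj) (i j : Fin (Module.finrank ℂ V)) : U :=
  TensorProduct.rid ℂ U ((coeff V i j).lTensor U (Q.Lplus V))

/-- `l⁻_{ij}`, defined by `L_V⁻(eⱼ ⊗ 1) = ∑ᵢ eᵢ ⊗ l⁻_{ij}`. -/
def lminus (V : C.Obj) (i j : Fin (Module.finrank ℂ V)) : U :=
  TensorProduct.lid ℂ U ((coeff V i j).rTensor U (Q.Lminus V))

variable {Q}

/-- The generator `c_{il} = ∑_{j,k} l⁺_{ij} (J_V)_{jk} S(l⁻_{kl})`. -/
def Character.c (f : Q.Character) (V : C.Obj) (i l : Fin (Module.finrank ℂ V)) : U :=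
  ∑ j, ∑ k, coeff V j k (f.J V) •
    (Q.lplus V i j * HopfAlgebra.antipode ℂ (Q.lminus V k l))

/-- The left Noumi coideal subalgebra `B_f`, generated by the elements `c_{il}` of the modules in
`𝒲` (one module `V`, or all modules in `C`). -/
def Character.noumi (f : Q.Character) (𝒲 : Set C.Obj) : Subalgebra ℂ U :=
  Algebra.adjoin ℂ {c : U | ∃ W ∈ 𝒲, ∃ i l, c = f.c W i l}

end QuasiTriangular

/-! ### Quantum differential operators -/

section DUSection

variable {U : Type u} [Ring U] [HopfAlgebra ℂ U] [BijectiveAntipode U] {C : TensorSubcat U}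

/-- The relations of the smash product of `Ã` and `U`, on the free algebra generated by the vector
space `Ã ⊕ U`: `Ã` and `U` are unital subalgebras, and `x a = ((x₁ ⊗ 1) ▷ a) x₂`. -/
inductive DURel (Q : QuasiTriangular C) :
    TensorAlgebra ℂ (CoEnd C × U) → TensorAlgebra ℂ (CoEnd C × U) → Prop
  | mulA (a b : CoEnd C) :
      DURel Q (TensorAlgebra.ι ℂ (a, 0) * TensorAlgebra.ι ℂ (b, 0))
        (TensorAlgebra.ι ℂ (CoEnd.mul Q a b, 0))
  | oneA : DURel Q (TensorAlgebra.ι ℂ (CoEnd.one C, 0)) 1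
  | mulU (x y : U) :
      DURel Q (TensorAlgebra.ι ℂ (0, x) * TensorAlgebra.ι ℂ (0, y))
        (TensorAlgebra.ι ℂ (0, x * y))
  | oneU : DURel Q (TensorAlgebra.ι ℂ (0, 1)) 1
  | smash (x : U) (a : CoEnd C) :
      DURel Q (TensorAlgebra.ι ℂ (0, x) * TensorAlgebra.ι ℂ (a, 0))
        (TensorProduct.lift
          ((LinearMap.mul ℂ (TensorAlgebra ℂ (CoEnd C × U))).compl₁₂
            (TensorAlgebra.ι ℂ ∘ₗ LinearMap.inl ℂ (CoEnd C) U ∘ₗ (CoEnd.actLeftHom C).flip a)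
            (TensorAlgebra.ι ℂ ∘ₗ LinearMap.inr ℂ (CoEnd C) U))
          (Coalgebra.comul x))

/-- The algebra `D_U` of quantum differential operators. -/
abbrev DU (Q : QuasiTriangular C) : Type (u + 1) := RingQuot (DURel Q)

namespace DU

variable (Q : QuasiTriangular C)

/-- The inclusion of `Ã` in `D_U`. -/
def inclA : CoEnd C →ₗ[ℂ] DU Q :=
  (RingQuot.mkAlgHom ℂ (DURel Q)).toLinearMap ∘ₗ TensorAlgebra.ι ℂ ∘ₗ LinearMap.inl ℂ (CoEnd C) U

/-- The inclusion `∂_◁` of `U` in `D_U`. -/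
def partialL : U →ₗ[ℂ] DU Q :=
  (RingQuot.mkAlgHom ℂ (DURel Q)).toLinearMap ∘ₗ TensorAlgebra.ι ℂ ∘ₗ LinearMap.inr ℂ (CoEnd C) U

/-- The left adjoint action `x ▷ y = x₁ y S(x₂)` of `U` on itself. -/
def adj (x y : U) : U :=
  TensorProduct.lift ((LinearMap.mul ℂ U).compl₁₂ (LinearMap.mulRight ℂ y)
    (HopfAlgebra.antipode ℂ)) (Coalgebra.comul x)

/-- `φ` identifies the object `W` of `C` with a finite-dimensional submodule of `U` for the adjoint
action.  The subspace `U' ⊆ U` of locally finite elements is the union of these submodules. -/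
def IsAdSubmodule (W : C.Obj) (φ : W →ₗ[ℂ] U) : Prop :=
  Function.Injective φ ∧ ∀ (x : U) (w : W), φ (W.rep.ρ x w) = adj x (φ w)

/-- `∂_▷(u)` for an element `u = φ(w)` of a submodule `φ : W → U` as above:
`∂_▷(u) = ∑ ((r_j ⊗ 1) ▷ g_i) ∂_◁(S⁻¹(u_i r'_j))`, where `R = ∑ r_j ⊗ r'_j`, and
`ad^*(u) = ∑ u_i ⊗ g_i` is the coaction, `u_i = φ(eᵢ)` and `g_i = [eⁱ ⊠ w]` for a basis `eᵢ` of
`W`, so that `∑ g_i(x) u_i = x ▷ u`. -/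
def partialR (W : C.Obj) (φ : W →ₗ[ℂ] U) (w : W) : DU Q :=
  ∑ i, TensorProduct.lift
    ((LinearMap.mul ℂ (DU Q)).compl₁₂
      (inclA Q ∘ₗ CoEnd.mk W ∘ₗ (TensorProduct.mk ℂ (Module.Dual ℂ W) W).flip w ∘ₗ
        LinearMap.applyₗ ((Module.finBasis ℂ W).coord i))
      (partialL Q ∘ₗ antipodeInv U ∘ₗ LinearMap.mulLeft ℂ (φ (Module.finBasis ℂ W i))))
    (Q.Rhalf W.dual : Module.End ℂ (Module.Dual ℂ W) ⊗[ℂ] U)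

end DU

/-- A non-degenerate `D_U`-module: a `U ⊗ U`-module `M` with a `D_U`-module structure, such that
`∂_◁(U)` and `∂_▷(U')` act through the first and the second copy of `U`, and such that the action
map `A ⊗ M → M` is linear for the second copy of `U` (linearity for the first copy is part of the
relations of `D_U`). -/
structure NonDegDMod (Q : QuasiTriangular C) : Type (max (u + 1) (v + 1)) where
  carrier : Type v
  [acg : AddCommGroup carrier]
  [mod : Module ℂ carrier]
  act : DU Q →ₐ[ℂ] Module.End ℂ carrier
  ρ : U ⊗[ℂ] U →ₐ[ℂ] Module.End ℂ carrier
  act_left : ∀ x : U, act (DU.partialL Q x) = ρ (x ⊗ₜ 1)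
  act_right : ∀ (W : C.Obj) (φ : W →ₗ[ℂ] U), DU.IsAdSubmodule W φ →
    ∀ w : W, act (DU.partialR Q W φ w) = ρ (1 ⊗ₜ φ w)
  act_linear : ∀ (x : U) (a : CoEnd C),
    ρ (1 ⊗ₜ x) * act (DU.inclA Q a) =
      TensorProduct.lift
        ((LinearMap.mul ℂ (Module.End ℂ carrier)).compl₁₂
          (act.toLinearMap ∘ₗ DU.inclA Q ∘ₗ (CoEnd.actRightHom C).flip a)
          (ρ.toLinearMap ∘ₗ TensorProduct.mk ℂ U U 1))
        (Coalgebra.comul x)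

attribute [instance] NonDegDMod.acg NonDegDMod.mod

namespace NonDegDMod

variable {Q : QuasiTriangular C}

instance instCoeSort : CoeSort (NonDegDMod.{u, v} Q) (Type v) := ⟨NonDegDMod.carrier⟩

/-- Morphisms of non-degenerate `D_U`-modules. -/
structure Hom (M N : NonDegDMod.{u, v} Q) where
  toLin : M →ₗ[ℂ] N
  map_act : ∀ (d : DU Q) (m : M), toLin (M.act d m) = N.act d (toLin m)
  map_ρ : ∀ (z : U ⊗[ℂ] U) (m : M), toLin (M.ρ z m) = N.ρ z (toLin m)

/-- The identity morphism. -/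
def Hom.id (M : NonDegDMod.{u, v} Q) : Hom M M := ⟨LinearMap.id, fun _ _ => rfl, fun _ _ => rfl⟩

/-- The composition `k ∘ h`. -/
def Hom.comp {M N P : NonDegDMod.{u, v} Q} (k : Hom N P) (h : Hom M N) : Hom M P :=
  ⟨k.toLin ∘ₗ h.toLin, fun d m => by simp [h.map_act, k.map_act],
    fun z m => by simp [h.map_ρ, k.map_ρ]⟩

/-- `M` as a module over the second copy of `U`. -/
abbrev snd (M : NonDegDMod.{u, v} Q) : URep.{u, v} U where
  carrier := M
  ρ := M.ρ.comp Algebra.TensorProduct.includeRight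

/-- The action map `μ_M : A ⊗ M → M`. -/
def μ (M : NonDegDMod.{u, v} Q) : CoEnd C ⊗[ℂ] M →ₗ[ℂ] M :=
  TensorProduct.lift (M.act.toLinearMap ∘ₗ DU.inclA Q)

end NonDegDMod

end DUSection

/-! ### The operators -/

section Operators

variable {U : Type u} [Ring U] [HopfAlgebra ℂ U] [BijectiveAntipode U] {C : TensorSubcat U}

/-- `X ⊗ V_1 ⊗ ⋯ ⊗ V_n`, all `V_i` equal to `V`, as a `U`-module. -/
def iter (X : URep.{u, max u v} U) (V : C.Obj) : ℕ → URep.{u, max u v} U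
  | 0 => X
  | k + 1 => (iter X V k).tensor V.rep

/-- `h ⊗ id ⊗ ⋯ ⊗ id`. -/
def iterMap {X Y : URep.{u, max u v} U} (V : C.Obj) (h : X →ₗ[ℂ] Y) :
    (n : ℕ) → (iter.{u, v} X V n →ₗ[ℂ] iter.{u, v} Y V n)
  | 0 => h
  | k + 1 => (iterMap V h k).rTensor V

/-- `Y ⊗ id_{V_{n+1}}`. -/
def extendOp {X : URep.{u, max u v} U} {V : C.Obj} {n : ℕ}
    (Y : Module.End ℂ (iter.{u, v} X V n)) : Module.End ℂ (iter.{u, v} X V (n + 1)) :=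
  Y.rTensor V

/-- An operator on `V_n`, acting on `X ⊗ V_1 ⊗ ⋯ ⊗ V_n`. -/
def opLast (X : URep.{u, max u v} U) (V : C.Obj) (J : Module.End ℂ V) :
    (n : ℕ) → Module.End ℂ (iter.{u, v} X V n)
  | 0 => 1
  | k + 1 => (J.lTensor (iter.{u, v} X V k) : Module.End ℂ (iter.{u, v} X V k ⊗[ℂ] V))

/-- An operator on `V_i ⊗ V_{i+1}` (`1 ≤ i < n`), acting on `X ⊗ V_1 ⊗ ⋯ ⊗ V_n`. -/
def opPair (X : URep.{u, max u v} U) (V : C.Obj) (S : Module.End ℂ (V ⊗[ℂ] V)) (i : ℕ) :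
    (n : ℕ) → Module.End ℂ (iter.{u, v} X V n)
  | 0 => 1
  | 1 => 1
  | k + 2 =>
    if i = k + 1 then
      (leg23 (iter.{u, v} X V k) S : Module.End ℂ ((iter.{u, v} X V k ⊗[ℂ] V) ⊗[ℂ] V))
    else extendOp (opPair X V S i (k + 1))

/-- An operator on `X ⊗ V_1`, acting on `X ⊗ V_1 ⊗ ⋯ ⊗ V_n` (`n ≥ 1`). -/
def opFirst (X : URep.{u, max u v} U) (V : C.Obj) (S : Module.End ℂ (X ⊗[ℂ] V)) :
    (n : ℕ) → Module.End ℂ (iter.{u, v} X V n)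
  | 0 => 1
  | 1 => S
  | k + 2 => extendOp (opFirst X V S (k + 1))

variable {Q : QuasiTriangular C}

/-- `T_i` for `1 ≤ i ≤ n`: `σ_{V_i,V_{i+1}}` for `i < n`, and `T_n = J_{V_n}`. -/
def opT (f : Q.Character) (X : URep.{u, max u v} U) (V : C.Obj) (n i : ℕ) :
    Module.End ℂ (iter.{u, v} X V n) :=
  if i = n then opLast X V (f.J V) n else opPair X V (Q.braid V V) i n

/-- `P_1 = T_1 ⋯ T_{n-1} T_n T_{n-1} ⋯ T_1`. -/
def opP (f : Q.Character) (X : URep.{u, max u v} U) (V : C.Obj) (n : ℕ) :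
    Module.End ℂ (iter.{u, v} X V n) :=
  ((List.range (n - 1)).map fun i => opT f X V n (i + 1)).prod * opT f X V n n *
    (((List.range (n - 1)).map fun i => opT f X V n (i + 1)).reverse).prod

/-- The double braiding `σ_{V_1,M} ∘ σ_{M,V_1}`. -/
def opD (Q : QuasiTriangular C) (X : URep.{u, max u v} U) (V : C.Obj) (n : ℕ) :
    Module.End ℂ (iter.{u, v} X V n) :=
  opFirst X V (Q.braidVM V X ∘ₗ Q.braidMV X V) n

/-- `T_0 = P_1⁻¹ (σ_{V_1,M} ∘ σ_{M,V_1})⁻¹`. -/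
def opT₀ (f : Q.Character) (X : URep.{u, max u v} U) (V : C.Obj) (n : ℕ) :
    Module.End ℂ (iter.{u, v} X V n) :=
  Ring.inverse (opP f X V n) * Ring.inverse (opD Q X V n)

/-- All operators `T_0, …, T_n`. -/
def opTAll (f : Q.Character) (X : URep.{u, max u v} U) (V : C.Obj) (n i : ℕ) :
    Module.End ℂ (iter.{u, v} X V n) :=
  if i = 0 then opT₀ f X V n else opT f X V n i

/-- `(J' ⊗ 1) coev_V = ∑ᵢ J' eᵢ ⊗ eⁱ ∈ V ⊗ V^* = (V ⊗ ^*V)^*`. -/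
def coevJ (V : C.Obj) (J' : Module.End ℂ V) : Module.Dual ℂ (V ⊗[ℂ] Module.Dual ℂ V) :=
  ∑ i, TensorProduct.dualDistrib ℂ V (Module.Dual ℂ V)
    ((Module.finBasis ℂ V).coord i ⊗ₜ Module.Dual.eval ℂ V (J' (Module.finBasis ℂ V i)))

/-- `((J' ⊗ 1) coev_V) ⊠ (id ⊗ coev_{^*V}) : V → (V ⊗ V^*) ⊠ (V ⊗ ^*V ⊗ V) → A ⊗ V`, where
`(V ⊗ V^*) ⊠ (V ⊗ ^*V)` is `X^* ⊠ X` for `X = V ⊗ ^*V`. -/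
def coevA (V : C.Obj) (J' : Module.End ℂ V) : V →ₗ[ℂ] CoEnd C ⊗[ℂ] V :=
  ∑ j, (TensorProduct.mk ℂ (CoEnd C) V).flip (Module.finBasis ℂ V j) ∘ₗ
    (CoEnd.mk (V.tensor V.ldual) :
      Module.Dual ℂ (V ⊗[ℂ] Module.Dual ℂ V) ⊗[ℂ] (V ⊗[ℂ] Module.Dual ℂ V) →ₗ[ℂ] CoEnd C) ∘ₗ
    TensorProduct.mk ℂ (Module.Dual ℂ (V ⊗[ℂ] Module.Dual ℂ V)) (V ⊗[ℂ] Module.Dual ℂ V)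
      (coevJ V J') ∘ₗ
    (TensorProduct.mk ℂ V (Module.Dual ℂ V)).flip ((Module.finBasis ℂ V).coord j)

/-- `K_0` on `M ⊗ V_1`:
`μ_M ∘ σ_{1⊠V,M} ∘ (((J' ⊗ 1) coev_V) ⊠ (id ⊗ coev_{^*V})) ∘ σ_{1⊠V_1,M}⁻¹`. -/
def opKFirst (g : Q.Character) (M : NonDegDMod.{u, max u v} Q) (V : C.Obj) :
    Module.End ℂ (M ⊗[ℂ] V) :=
  M.μ.rTensor V ∘ₗ
    (TensorProduct.assoc ℂ (CoEnd C) M V).symm.toLinearMap ∘ₗ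
    (Q.braidVM V M.snd).lTensor (CoEnd C) ∘ₗ
    (TensorProduct.assoc ℂ (CoEnd C) V M).toLinearMap ∘ₗ
    (coevA V (g.J' V)).rTensor M ∘ₗ
    Q.braidVMInv V M.snd

/-- `K_0` on `M ⊗ V_1 ⊗ ⋯ ⊗ V_n`. -/
def opK (g : Q.Character) (M : NonDegDMod.{u, max u v} Q) (V : C.Obj) (n : ℕ) :
    Module.End ℂ (iter.{u, v} M.snd V n) :=
  opFirst M.snd V (opKFirst g M V) n

/-- `Hom_{B}(1_χ, M ⊗ V_1 ⊗ ⋯ ⊗ V_n)`, where `B ⊆ U` acts through the second copy of `U`. -/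
def homB {B : Subalgebra ℂ U} (χ : B →ₐ[ℂ] ℂ) (M : NonDegDMod.{u, max u v} Q) (V : C.Obj)
    (n : ℕ) : Submodule ℂ (ℂ →ₗ[ℂ] iter.{u, v} M.snd V n) where
  carrier := {φ | ∀ (b : B) (z : ℂ), φ (χ b * z) = (iter.{u, v} M.snd V n).ρ b (φ z)}
  add_mem' := by
    intro φ ψ hφ hψ b z
    rw [LinearMap.add_apply, LinearMap.add_apply, hφ b z, hψ b z, map_add]
  zero_mem' := by
    intro b z
    simp
  smul_mem' := by
    intro c φ hφ b z
    rw [LinearMap.smul_apply, LinearMap.smul_apply, hφ b z, map_smul]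

end Operators

end

/-!
The relations of the double affine braid group already hold for the operators on the whole space
`M ⊗ V_1 ⊗ ⋯ ⊗ V_n`; the coideal subalgebra only enters through the fact that it commutes with all
of them.

All computations with the R-matrix are made with matrix coefficients `lm`, `lp`, `rh` in `U`,
indexed by a vector `v ∈ V` and a functional `α` on `V`. The axioms of the R-matrix give their
coproducts, products and commutation relations, first on the objects of `C` and then in `U` and
`U ⊗ U` because the objects of `C` separate the elements (`TensorSubcat.Separating.ext₂`). In this
form they apply to arbitrary modules `M`.

* A character `f` of `F₂(A)` satisfies `R J_{V ⊗ W} = (J_V ⊗ 1) R (1 ⊗ J_W)`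
  (`Character.R_J_tensor`), and as `J` is natural, the reflection equation follows
  (`Character.reflection`). It also shows that `J_V` commutes with the coideal subalgebra
  (`Character.lTensor_J_commute`). Since `J'_V` is the transpose of `J_{^*V}`, the left-handed
  reflection equation is a consequence (`Character.left_reflection`).

* On a non-degenerate module `M`, put `Θ_X(η, x) = ∑ [η ⊠ s x] s'` with `R⁻¹ = ∑ s ⊗ s'`
  (`NonDegDMod.theta`). This family is dinatural and multiplicative, so the operator `N_X` on
  `M ⊗ X` with the coefficients `Θ_X` (`NonDegDMod.gauge`) is invertible and natural in `X`, and
  it turns the diagonal action of `U` into the action on `M`. In these terms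
  `K₀ = N_V⁻¹ (1 ⊗ J'_V) N_V` (`opKFirst_eq`). Hence `K₀` is `U`-linear and invertible, and its
  quadratic relation with `T_1` is the left-handed reflection equation (`opKFirst_quad`).

* With `D` the double braiding of `M` and `V_1`, the operator `T_1 D T_1` is the double braiding
  of `M ⊗ V_1` and `V_2` (`QuasiTriangular.double_tensor_eq`). Thus it commutes with the
  `U`-linear operators `D` and `K₀` (`QuasiTriangular.commute_double`).

The remaining argument takes place in a group (`IsBraidTuple.exists_hom`): `P_1 = T_1 P_2 T_1`,
where `P_2` commutes with `D`, `K₀` and `P_1`, and the relations which involve `T_0 = (D P_1)⁻¹`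
follow from these commutation relations.
-/

noncomputable section

open TensorSubcat (Obj)

/-! ### Contractions and dual bases -/

section Contraction

variable {M N V W X : Type*} [AddCommGroup M] [Module ℂ M] [AddCommGroup N] [Module ℂ N]
  [AddCommGroup V] [Module ℂ V] [AddCommGroup W] [Module ℂ W] [AddCommGroup X] [Module ℂ X]

/-- The contraction `m ⊗ v ↦ α(v) m`. Contractions take the place of coordinates: an element of
`M ⊗ V` is determined by its contractions with all functionals on `V`. -/
def contrR (M : Type*) [AddCommGroup M] [Module ℂ M] (α : Module.Dual ℂ V) :
    M ⊗[ℂ] V →ₗ[ℂ] M :=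
  (TensorProduct.rid ℂ M).toLinearMap ∘ₗ LinearMap.lTensor M α

/-- The contraction `v ⊗ m ↦ α(v) m`. -/
def contrL (M : Type*) [AddCommGroup M] [Module ℂ M] (α : Module.Dual ℂ V) :
    V ⊗[ℂ] M →ₗ[ℂ] M :=
  (TensorProduct.lid ℂ M).toLinearMap ∘ₗ LinearMap.rTensor M α

@[simp] theorem contrR_tmul (α : Module.Dual ℂ V) (m : M) (v : V) :
    contrR M α (m ⊗ₜ v) = α v • m := by
  simp [contrR]

@[simp] theorem contrL_tmul (α : Module.Dual ℂ V) (m : M) (v : V) :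
    contrL M α (v ⊗ₜ m) = α v • m := by
  simp [contrL]

theorem contrR_map (f : M →ₗ[ℂ] N) (φ : V →ₗ[ℂ] W) (α : Module.Dual ℂ W) (z : M ⊗[ℂ] V) :
    contrR N α (TensorProduct.map f φ z) = f (contrR M (α ∘ₗ φ) z) := by
  induction z using TensorProduct.induction_on with
  | zero => simp
  | add s t h1 h2 => simp only [map_add, h1, h2]
  | tmul m v => simp

theorem contrL_map (f : M →ₗ[ℂ] N) (φ : V →ₗ[ℂ] W) (α : Module.Dual ℂ W) (z : V ⊗[ℂ] M) :
    contrL N α (TensorProduct.map φ f z) = f (contrL M (α ∘ₗ φ) z) := by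
  induction z using TensorProduct.induction_on with
  | zero => simp
  | add s t h1 h2 => simp only [map_add, h1, h2]
  | tmul m v => simp

theorem contrR_rTensor (f : M →ₗ[ℂ] N) (α : Module.Dual ℂ V) (z : M ⊗[ℂ] V) :
    contrR N α (f.rTensor V z) = f (contrR M α z) :=
  contrR_map f LinearMap.id α z

theorem contrR_lTensor (φ : V →ₗ[ℂ] W) (α : Module.Dual ℂ W) (z : M ⊗[ℂ] V) :
    contrR M α (φ.lTensor M z) = contrR M (α ∘ₗ φ) z :=
  contrR_map LinearMap.id φ α z

@[simp] theorem contrR_comm (α : Module.Dual ℂ V) (z : V ⊗[ℂ] M) :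
    contrR M α (TensorProduct.comm ℂ V M z) = contrL M α z := by
  induction z using TensorProduct.induction_on with
  | zero => simp
  | add s t h1 h2 => simp only [map_add, h1, h2]
  | tmul m v => simp

@[simp] theorem contrL_comm (α : Module.Dual ℂ V) (z : M ⊗[ℂ] V) :
    contrL M α (TensorProduct.comm ℂ M V z) = contrR M α z := by
  induction z using TensorProduct.induction_on with
  | zero => simp
  | add s t h1 h2 => simp only [map_add, h1, h2]
  | tmul m v => simp

/-- `β ∘ (α ⊗ id) = α ∘ (id ⊗ β)`. -/
theorem contrL_contrR (α : Module.Dual ℂ V) (β : Module.Dual ℂ W) (z : V ⊗[ℂ] W) :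
    β (contrL W α z) = α (contrR V β z) := by
  induction z using TensorProduct.induction_on with
  | zero => simp
  | add s t h1 h2 => simp only [map_add, h1, h2]
  | tmul m v => simp [mul_comm]

theorem dualDistrib_apply_eq (α : Module.Dual ℂ V) (β : Module.Dual ℂ W) (z : V ⊗[ℂ] W) :
    TensorProduct.dualDistrib ℂ V W (α ⊗ₜ β) z = β (contrL W α z) := by
  induction z using TensorProduct.induction_on with
  | zero => simp
  | add s t h1 h2 => simp only [map_add, h1, h2]
  | tmul m v => simp

theorem dualDistrib_eval (z : Module.Dual ℂ V ⊗[ℂ] Module.Dual ℂ W) (v : V) (w : W) :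
    TensorProduct.dualDistrib ℂ _ _ (Module.Dual.eval ℂ V v ⊗ₜ Module.Dual.eval ℂ W w) z =
      TensorProduct.dualDistrib ℂ V W z (v ⊗ₜ w) := by
  induction z using TensorProduct.induction_on with
  | zero => simp
  | add s t h1 h2 => simp only [map_add, LinearMap.add_apply, h1, h2]
  | tmul a b => simp

theorem dualDistrib_comm (α : Module.Dual ℂ V) (β : Module.Dual ℂ W) (t : V ⊗[ℂ] W) :
    TensorProduct.dualDistrib ℂ W V (β ⊗ₜ α) (TensorProduct.comm ℂ V W t) =
      TensorProduct.dualDistrib ℂ V W (α ⊗ₜ β) t := by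
  induction t using TensorProduct.induction_on with
  | zero => simp
  | add s t h1 h2 => simp only [map_add, h1, h2]
  | tmul v w => simp [mul_comm]

variable [FiniteDimensional ℂ V] [FiniteDimensional ℂ W]

theorem sum_coord_smul (v : V) :
    ∑ i, (Module.finBasis ℂ V).coord i v • Module.finBasis ℂ V i = v :=
  (Module.finBasis ℂ V).sum_repr v

theorem sum_smul_coord (α : Module.Dual ℂ V) :
    ∑ i, α (Module.finBasis ℂ V i) • (Module.finBasis ℂ V).coord i = α := by
  refine (Module.finBasis ℂ V).ext fun j => ?_
  simp

theorem sum_contrR_tmul (z : M ⊗[ℂ] V) :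
    ∑ i, contrR M ((Module.finBasis ℂ V).coord i) z ⊗ₜ[ℂ] Module.finBasis ℂ V i = z := by
  induction z using TensorProduct.induction_on with
  | zero => simp
  | add s t h1 h2 =>
    simp only [map_add, TensorProduct.add_tmul, Finset.sum_add_distrib, h1, h2]
  | tmul m v =>
    simp only [contrR_tmul, TensorProduct.smul_tmul]
    rw [← TensorProduct.tmul_sum, sum_coord_smul]

theorem sum_tmul_contrL (z : V ⊗[ℂ] M) :
    ∑ i, Module.finBasis ℂ V i ⊗ₜ[ℂ] contrL M ((Module.finBasis ℂ V).coord i) z = z := by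
  induction z using TensorProduct.induction_on with
  | zero => simp
  | add s t h1 h2 =>
    simp only [map_add, TensorProduct.tmul_add, Finset.sum_add_distrib, h1, h2]
  | tmul m v =>
    simp only [contrL_tmul, ← TensorProduct.smul_tmul]
    rw [← TensorProduct.sum_tmul, sum_coord_smul]

theorem contrR_ext {z z' : M ⊗[ℂ] V} (h : ∀ α : Module.Dual ℂ V, contrR M α z = contrR M α z') :
    z = z' := by
  rw [← sum_contrR_tmul z, ← sum_contrR_tmul z']
  simp only [h]

theorem contrL_ext {z z' : V ⊗[ℂ] M} (h : ∀ α : Module.Dual ℂ V, contrL M α z = contrL M α z') :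
    z = z' := by
  rw [← sum_tmul_contrL z, ← sum_tmul_contrL z']
  simp only [h]

/-- Functionals separate the points of a finite-dimensional space. -/
theorem dual_ext {v v' : V} (h : ∀ α : Module.Dual ℂ V, α v = α v') : v = v' := by
  rw [← sum_coord_smul v, ← sum_coord_smul v']
  simp only [h]

/-- A linear map can be moved from one half of the canonical element `∑ bᵢ ⊗ bⁱ` to the other. -/
theorem sum_basis_comp (φ : V →ₗ[ℂ] W) (F : W →ₗ[ℂ] Module.Dual ℂ V →ₗ[ℂ] X) :
    ∑ i, F (φ (Module.finBasis ℂ V i)) ((Module.finBasis ℂ V).coord i) =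
      ∑ j, F (Module.finBasis ℂ W j) ((Module.finBasis ℂ W).coord j ∘ₗ φ) := by
  have h1 : ∀ i, F (φ (Module.finBasis ℂ V i)) ((Module.finBasis ℂ V).coord i) =
      ∑ j, (Module.finBasis ℂ W).coord j (φ (Module.finBasis ℂ V i)) •
        F (Module.finBasis ℂ W j) ((Module.finBasis ℂ V).coord i) := fun i => by
    conv_lhs => rw [← sum_coord_smul (φ (Module.finBasis ℂ V i))]
    simp only [map_sum, map_smul, LinearMap.sum_apply, LinearMap.smul_apply]
  have h2 : ∀ j, F (Module.finBasis ℂ W j) ((Module.finBasis ℂ W).coord j ∘ₗ φ) =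
      ∑ i, (Module.finBasis ℂ W).coord j (φ (Module.finBasis ℂ V i)) •
        F (Module.finBasis ℂ W j) ((Module.finBasis ℂ V).coord i) := fun j => by
    conv_lhs => rw [← sum_smul_coord ((Module.finBasis ℂ W).coord j ∘ₗ φ)]
    simp only [map_sum, map_smul, LinearMap.comp_apply]
  simp only [h1, h2]
  exact Finset.sum_comm

/-- The canonical element of `V ⊗ W`, in terms of bases of `V` and `W`. -/
theorem sum_basis_tensor (F : V ⊗[ℂ] W →ₗ[ℂ] Module.Dual ℂ (V ⊗[ℂ] W) →ₗ[ℂ] X) :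
    ∑ l, F (Module.finBasis ℂ (V ⊗[ℂ] W) l) ((Module.finBasis ℂ (V ⊗[ℂ] W)).coord l) =
      ∑ i, ∑ j, F (Module.finBasis ℂ V i ⊗ₜ Module.finBasis ℂ W j)
        (TensorProduct.dualDistrib ℂ V W
          ((Module.finBasis ℂ V).coord i ⊗ₜ (Module.finBasis ℂ W).coord j)) := by
  have h : ∀ t : V ⊗[ℂ] W, ∑ i, ∑ j, TensorProduct.dualDistrib ℂ V W
      ((Module.finBasis ℂ V).coord i ⊗ₜ (Module.finBasis ℂ W).coord j) t •
        (Module.finBasis ℂ V i ⊗ₜ[ℂ] Module.finBasis ℂ W j) = t := fun t => by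
    induction t using TensorProduct.induction_on with
    | zero => simp
    | add s t h1 h2 => simp only [map_add, add_smul, Finset.sum_add_distrib, h1, h2]
    | tmul v w =>
      simp only [TensorProduct.dualDistrib_apply, mul_smul, ← TensorProduct.tmul_smul]
      simp only [← TensorProduct.tmul_sum, ← Finset.smul_sum, sum_coord_smul]
      simp only [TensorProduct.tmul_smul, TensorProduct.smul_tmul', ← TensorProduct.sum_tmul,
        sum_coord_smul]
  have h1 : ∀ l, F (Module.finBasis ℂ (V ⊗[ℂ] W) l) ((Module.finBasis ℂ (V ⊗[ℂ] W)).coord l) =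
      ∑ i, ∑ j, TensorProduct.dualDistrib ℂ V W
      ((Module.finBasis ℂ V).coord i ⊗ₜ (Module.finBasis ℂ W).coord j)
        (Module.finBasis ℂ (V ⊗[ℂ] W) l) • F (Module.finBasis ℂ V i ⊗ₜ Module.finBasis ℂ W j)
          ((Module.finBasis ℂ (V ⊗[ℂ] W)).coord l) := fun l => by
    conv_lhs => rw [← h (Module.finBasis ℂ (V ⊗[ℂ] W) l)]
    simp only [map_sum, map_smul, LinearMap.sum_apply, LinearMap.smul_apply]
  simp only [h1]
  rw [Finset.sum_comm]
  refine Finset.sum_congr rfl fun i _ => ?_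
  rw [Finset.sum_comm]
  refine Finset.sum_congr rfl fun j _ => ?_
  conv_rhs => rw [← sum_smul_coord (TensorProduct.dualDistrib ℂ V W
    ((Module.finBasis ℂ V).coord i ⊗ₜ (Module.finBasis ℂ W).coord j))]
  simp only [map_sum, map_smul]

/-- The canonical element of the dual of `V`, in terms of a basis of `V`. -/
theorem sum_basis_dual (F : Module.Dual ℂ V →ₗ[ℂ] Module.Dual ℂ (Module.Dual ℂ V) →ₗ[ℂ] X) :
    ∑ l, F (Module.finBasis ℂ (Module.Dual ℂ V) l)
        ((Module.finBasis ℂ (Module.Dual ℂ V)).coord l) =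
      ∑ j, F ((Module.finBasis ℂ V).coord j) (Module.Dual.eval ℂ V (Module.finBasis ℂ V j)) := by
  have h1 : ∀ l, F (Module.finBasis ℂ (Module.Dual ℂ V) l)
      ((Module.finBasis ℂ (Module.Dual ℂ V)).coord l) =
      ∑ j, Module.finBasis ℂ (Module.Dual ℂ V) l (Module.finBasis ℂ V j) •
        F ((Module.finBasis ℂ V).coord j)
          ((Module.finBasis ℂ (Module.Dual ℂ V)).coord l) := fun l => by
    conv_lhs => rw [← sum_smul_coord (Module.finBasis ℂ (Module.Dual ℂ V) l)]
    simp only [map_sum, map_smul, LinearMap.sum_apply, LinearMap.smul_apply]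
  simp only [h1]
  rw [Finset.sum_comm]
  refine Finset.sum_congr rfl fun j _ => ?_
  conv_rhs => rw [← sum_smul_coord (Module.Dual.eval ℂ V (Module.finBasis ℂ V j))]
  simp only [map_sum, map_smul, Module.Dual.eval_apply]

/-- The operator on `M ⊗ V` with the matrix coefficients `F α v`. -/
def coeffOp (F : Module.Dual ℂ V →ₗ[ℂ] V →ₗ[ℂ] Module.End ℂ M) : Module.End ℂ (M ⊗[ℂ] V) :=
  ∑ i, TensorProduct.lift (LinearMap.compr₂ (LinearMap.flip (F ((Module.finBasis ℂ V).coord i)))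
    ((TensorProduct.mk ℂ M V).flip (Module.finBasis ℂ V i)))

theorem coeffOp_tmul (F : Module.Dual ℂ V →ₗ[ℂ] V →ₗ[ℂ] Module.End ℂ M) (m : M) (v : V) :
    coeffOp F (m ⊗ₜ v) = ∑ i, F ((Module.finBasis ℂ V).coord i) v m ⊗ₜ[ℂ]
      Module.finBasis ℂ V i := by
  simp only [coeffOp, LinearMap.sum_apply, TensorProduct.lift.tmul, LinearMap.compr₂_apply,
    LinearMap.flip_apply, TensorProduct.mk_apply]

theorem contrR_coeffOp (F : Module.Dual ℂ V →ₗ[ℂ] V →ₗ[ℂ] Module.End ℂ M) (α : Module.Dual ℂ V)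
    (m : M) (v : V) : contrR M α (coeffOp F (m ⊗ₜ v)) = F α v m := by
  rw [coeffOp_tmul, map_sum]
  simp only [contrR_tmul]
  conv_rhs => rw [← sum_smul_coord α]
  simp only [map_sum, map_smul, LinearMap.sum_apply, LinearMap.smul_apply]

/-- Operators whose coefficients are mutually inverse as matrices over `End M` are mutually
inverse. -/
theorem coeffOp_mul_eq_one {F G : Module.Dual ℂ V →ₗ[ℂ] V →ₗ[ℂ] Module.End ℂ M}
    (h : ∀ α v, ∑ i, F α (Module.finBasis ℂ V i) * G ((Module.finBasis ℂ V).coord i) v =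
      α v • (1 : Module.End ℂ M)) : coeffOp F * coeffOp G = 1 := by
  refine TensorProduct.ext' fun m v => contrR_ext fun α => ?_
  rw [Module.End.mul_apply, coeffOp_tmul G, map_sum, map_sum, Module.End.one_apply, contrR_tmul]
  simp only [contrR_coeffOp]
  have h1 := LinearMap.congr_fun (h α v) m
  simpa only [LinearMap.sum_apply, Module.End.mul_apply, LinearMap.smul_apply,
    Module.End.one_apply] using h1

end Contraction

/-! ### Matrix coefficients -/

section Coefficients

variable {U : Type u} [Ring U] [HopfAlgebra ℂ U]
variable {V : Type*} [AddCommGroup V] [Module ℂ V]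

/-- The matrix coefficients of `z ∈ End V ⊗ U`: `α(φ v) x ∈ U` for `z = φ ⊗ x`. -/
def leftCoeff (z : Module.End ℂ V ⊗[ℂ] U) : Module.Dual ℂ V →ₗ[ℂ] V →ₗ[ℂ] U :=
  LinearMap.mk₂ ℂ
    (fun α v => TensorProduct.lid ℂ U ((α ∘ₗ LinearMap.applyₗ v).rTensor U z))
    (fun α β v => by simp [LinearMap.add_comp, LinearMap.rTensor_add])
    (fun c α v => by simp [LinearMap.smul_comp, LinearMap.rTensor_smul])
    (fun α v w => by simp [LinearMap.comp_add, LinearMap.rTensor_add])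
    (fun c α v => by simp [LinearMap.comp_smul, LinearMap.rTensor_smul])

/-- The matrix coefficients of `z ∈ U ⊗ End V`: `α(φ v) x ∈ U` for `z = x ⊗ φ`. -/
def rightCoeff (z : U ⊗[ℂ] Module.End ℂ V) : Module.Dual ℂ V →ₗ[ℂ] V →ₗ[ℂ] U :=
  LinearMap.mk₂ ℂ
    (fun α v => TensorProduct.rid ℂ U ((α ∘ₗ LinearMap.applyₗ v).lTensor U z))
    (fun α β v => by simp [LinearMap.add_comp, LinearMap.lTensor_add])
    (fun c α v => by simp [LinearMap.smul_comp, LinearMap.lTensor_smul])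
    (fun α v w => by simp [LinearMap.comp_add, LinearMap.lTensor_add])
    (fun c α v => by simp [LinearMap.comp_smul, LinearMap.lTensor_smul])

theorem leftCoeff_apply (z : Module.End ℂ V ⊗[ℂ] U) (α : Module.Dual ℂ V) (v : V) :
    leftCoeff z α v = TensorProduct.lid ℂ U ((α ∘ₗ LinearMap.applyₗ v).rTensor U z) := rfl

theorem rightCoeff_apply (z : U ⊗[ℂ] Module.End ℂ V) (α : Module.Dual ℂ V) (v : V) :
    rightCoeff z α v = TensorProduct.rid ℂ U ((α ∘ₗ LinearMap.applyₗ v).lTensor U z) := rfl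

theorem leftCoeff_lTensor (f : U →ₗ[ℂ] U) (z : Module.End ℂ V ⊗[ℂ] U) (α : Module.Dual ℂ V)
    (v : V) : leftCoeff (f.lTensor _ z) α v = f (leftCoeff z α v) := by
  simp only [leftCoeff_apply]
  induction z using TensorProduct.induction_on with
  | zero => simp
  | add s t h1 h2 => simp only [map_add, h1, h2]
  | tmul φ x => simp

theorem contrL_leftCoeff (M : URep.{u, w} U) (z : Module.End ℂ V ⊗[ℂ] U) (α : Module.Dual ℂ V)
    (v : V) (m : M) :
    contrL M α (Module.endTensorEndAlgHom (R := ℂ) (S := ℂ) (A := ℂ)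
      (Algebra.TensorProduct.map (AlgHom.id ℂ (Module.End ℂ V)) M.ρ z) (v ⊗ₜ m)) =
      M.ρ (leftCoeff z α v) m := by
  simp only [leftCoeff_apply]
  induction z using TensorProduct.induction_on with
  | zero => simp
  | add s t h1 h2 => simp only [map_add, LinearMap.add_apply, h1, h2]
  | tmul φ x => simp [Module.endTensorEndAlgHom_apply]

theorem contrR_rightCoeff (M : URep.{u, w} U) (z : U ⊗[ℂ] Module.End ℂ V) (α : Module.Dual ℂ V)
    (v : V) (m : M) :
    contrR M α (Module.endTensorEndAlgHom (R := ℂ) (S := ℂ) (A := ℂ)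
      (Algebra.TensorProduct.map M.ρ (AlgHom.id ℂ (Module.End ℂ V)) z) (m ⊗ₜ v)) =
      M.ρ (rightCoeff z α v) m := by
  simp only [rightCoeff_apply]
  induction z using TensorProduct.induction_on with
  | zero => simp
  | add s t h1 h2 => simp only [map_add, LinearMap.add_apply, h1, h2]
  | tmul φ x => simp [Module.endTensorEndAlgHom_apply]

end Coefficients

/-! ### Separation of points -/

namespace TensorSubcat.Separating

variable {U : Type u} [Ring U] [HopfAlgebra ℂ U] [BijectiveAntipode U] {C : TensorSubcat U}

theorem ext (hC : C.Separating) {x y : U} (h : ∀ (W : C.Obj) (w : W), W.rep.ρ x w = W.rep.ρ y w) :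
    x = y := by
  refine sub_eq_zero.1 (hC _ fun W => LinearMap.ext fun w => ?_)
  rw [map_sub, LinearMap.sub_apply, h W w, sub_self, LinearMap.zero_apply]

/-- The modules `W ⊗ W'` separate the elements of `U ⊗ U`: the coefficients of `∑ c_i ⊗ b_i`, for
a basis `b_i` of `U`, are detected by acting on `W` first and then on `W'`. -/
theorem ext₂ (hC : C.Separating) {x y : U ⊗[ℂ] U}
    (h : ∀ (W W' : C.Obj) (w : W) (w' : W'),
      URep.act₂ W.rep W'.rep x (w ⊗ₜ w') = URep.act₂ W.rep W'.rep y (w ⊗ₜ w')) :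
    x = y := by
  rw [← sub_eq_zero]
  have h0 : ∀ (W W' : C.Obj) (w : W) (w' : W'),
      URep.act₂ W.rep W'.rep (x - y) (w ⊗ₜ w') = 0 := fun W W' w w' => by
    rw [map_sub, LinearMap.sub_apply, h, sub_self]
  generalize x - y = z at h0
  let b := Module.Free.chooseBasis ℂ U
  obtain ⟨c, rfl⟩ := TensorProduct.eq_repr_basis_right b z
  have hc : ∀ i, c i = 0 := fun i => by
    refine hC.ext fun W w => dual_ext fun α => ?_
    have hsum : ∑ k ∈ c.support, α (W.rep.ρ (c k) w) • b k = 0 := by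
      refine hC.ext fun W' w' => ?_
      have h1 := congrArg (contrL W' α) (h0 W W' w w')
      rw [Finsupp.sum, map_sum, LinearMap.sum_apply] at h1
      simpa [URep.act₂_tmul, map_sum, LinearMap.sum_apply] using h1
    by_cases hi : i ∈ c.support
    · simpa using linearIndependent_iff'.1 b.linearIndependent _ _ hsum i hi
    · simp [Finsupp.notMem_support_iff.1 hi]
  simp [Finsupp.sum, hc]

end TensorSubcat.Separating

/-! ### Matrix coefficients of the R-matrix -/

section Legs

variable {A B D : Type*} [AddCommGroup A] [Module ℂ A] [AddCommGroup B] [Module ℂ B]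
  [AddCommGroup D] [Module ℂ D]

theorem leg12_mul (X Y : Module.End ℂ (A ⊗[ℂ] B)) : leg12 D X * leg12 D Y = leg12 D (X * Y) :=
  (LinearMap.rTensor_mul D X Y).symm

theorem leg12_one : leg12 D (1 : Module.End ℂ (A ⊗[ℂ] B)) = 1 := LinearMap.rTensor_id _ _

theorem rightComm_rightComm (t : (A ⊗[ℂ] B) ⊗[ℂ] D) :
    TensorProduct.rightComm ℂ A D B (TensorProduct.rightComm ℂ A B D t) = t :=
  (TensorProduct.rightComm ℂ A B D).symm_apply_apply t

theorem leg13_mul (X Y : Module.End ℂ (A ⊗[ℂ] D)) : leg13 B X * leg13 B Y = leg13 B (X * Y) := by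
  refine LinearMap.ext fun t => ?_
  simp [leg13, LinearMap.rTensor_mul, rightComm_rightComm]

theorem leg13_one : leg13 B (1 : Module.End ℂ (A ⊗[ℂ] D)) = 1 := by
  refine LinearMap.ext fun t => ?_
  simp only [leg13, Module.End.one_eq_id, LinearMap.rTensor_id]
  exact rightComm_rightComm t

theorem leg23_mul (X Y : Module.End ℂ (B ⊗[ℂ] D)) : leg23 A X * leg23 A Y = leg23 A (X * Y) := by
  refine LinearMap.ext fun t => ?_
  simp [leg23, LinearMap.lTensor_mul]

theorem leg23_one : leg23 A (1 : Module.End ℂ (B ⊗[ℂ] D)) = 1 := by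
  refine LinearMap.ext fun t => ?_
  simp only [leg23, Module.End.one_eq_id, LinearMap.lTensor_id]
  simp

theorem leg23_tmul (X : Module.End ℂ (B ⊗[ℂ] D)) (a : A) (b : B) (d : D) :
    leg23 A X ((a ⊗ₜ b) ⊗ₜ d) = (TensorProduct.assoc ℂ A B D).symm (a ⊗ₜ X (b ⊗ₜ d)) := rfl

theorem leg13_tmul (X : Module.End ℂ (A ⊗[ℂ] D)) (a : A) (b : B) (d : D) :
    leg13 B X ((a ⊗ₜ b) ⊗ₜ d) = TensorProduct.rightComm ℂ A D B (X (a ⊗ₜ d) ⊗ₜ b) := rfl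

theorem leg12_tmul (X : Module.End ℂ (A ⊗[ℂ] B)) (t : A ⊗[ℂ] B) (d : D) :
    leg12 D X (t ⊗ₜ d) = X t ⊗ₜ d := rfl

theorem contrL_assoc (α : Module.Dual ℂ A) (t : A ⊗[ℂ] B) (d : D) :
    contrL (B ⊗[ℂ] D) α (TensorProduct.assoc ℂ A B D (t ⊗ₜ d)) = contrL B α t ⊗ₜ d := by
  induction t using TensorProduct.induction_on with
  | zero => simp
  | add s t h1 h2 => simp only [map_add, TensorProduct.add_tmul, h1, h2]
  | tmul a b => simp [TensorProduct.smul_tmul']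

theorem contrR_rightComm (α : Module.Dual ℂ D) (t : A ⊗[ℂ] D) (b : B) :
    contrR (A ⊗[ℂ] B) α (TensorProduct.rightComm ℂ A D B (t ⊗ₜ b)) = contrR A α t ⊗ₜ b := by
  induction t using TensorProduct.induction_on with
  | zero => simp
  | add s t h1 h2 => simp only [map_add, TensorProduct.add_tmul, h1, h2]
  | tmul a b => simp [TensorProduct.smul_tmul']

end Legs

namespace QuasiTriangular

variable {U : Type u} [Ring U] [HopfAlgebra ℂ U] [BijectiveAntipode U] {C : TensorSubcat U}
  (Q : QuasiTriangular C)

/-- The matrix coefficients of `L_V⁻ = (ρ_V ⊗ id)(R⁻¹)`, elements of `U`. -/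
def lm (V : C.Obj) : Module.Dual ℂ V →ₗ[ℂ] V →ₗ[ℂ] U := leftCoeff (Q.Lminus V)

/-- The matrix coefficients of `L_V⁺ = (id ⊗ ρ_V)(R)`, elements of `U`. -/
def lp (V : C.Obj) : Module.Dual ℂ V →ₗ[ℂ] V →ₗ[ℂ] U := rightCoeff (Q.Lplus V)

/-- The matrix coefficients of `(ρ_V ⊗ id)(R)`, elements of `U`. -/
def rh (V : C.Obj) : Module.Dual ℂ V →ₗ[ℂ] V →ₗ[ℂ] U := leftCoeff (Q.Rhalf V)

/-- The operator `R⁻¹` on `V ⊗ W`, given by `L_V⁻`. -/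
def Rinv (V W : C.Obj) : Module.End ℂ (V ⊗[ℂ] W) :=
  Module.endTensorEndAlgHom (R := ℂ) (S := ℂ) (A := ℂ)
    (Algebra.TensorProduct.map (AlgHom.id ℂ (Module.End ℂ V)) W.rep.ρ (Q.Lminus V))

theorem Rinv_mul_R (V W : C.Obj) : Q.Rinv V W * Q.R V W = 1 := Q.Lminus_spec V W

theorem R_mul_Rinv (V W : C.Obj) : Q.R V W * Q.Rinv V W = 1 := by
  refine (Q.isUnit_R V W).mul_right_cancel ?_
  rw [mul_assoc, Q.Rinv_mul_R, mul_one, one_mul]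

theorem Rinv_R (V W : C.Obj) (t : V ⊗[ℂ] W) : Q.Rinv V W (Q.R V W t) = t :=
  LinearMap.congr_fun (Q.Rinv_mul_R V W) t

theorem R_Rinv (V W : C.Obj) (t : V ⊗[ℂ] W) : Q.R V W (Q.Rinv V W t) = t :=
  LinearMap.congr_fun (Q.R_mul_Rinv V W) t

theorem rh_eq (V : C.Obj) (α : Module.Dual ℂ V) (v : V) :
    Q.rh V α v = HopfAlgebra.antipode ℂ (Q.lm V α v) :=
  leftCoeff_lTensor _ _ _ _

theorem contrL_Rinv (V W : C.Obj) (α : Module.Dual ℂ V) (v : V) (w : W) :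
    contrL W α (Q.Rinv V W (v ⊗ₜ w)) = W.rep.ρ (Q.lm V α v) w :=
  contrL_leftCoeff W.rep _ α v w

theorem contrR_R (V W : C.Obj) (β : Module.Dual ℂ W) (v : V) (w : W) :
    contrR V β (Q.R V W (v ⊗ₜ w)) = V.rep.ρ (Q.lp W β w) v := by
  rw [← Q.Lplus_spec W V]
  exact contrR_rightCoeff V.rep _ β w v

theorem Rinv_tmul (V W : C.Obj) (v : V) (w : W) :
    Q.Rinv V W (v ⊗ₜ w) = ∑ i, Module.finBasis ℂ V i ⊗ₜ[ℂ]
      W.rep.ρ (Q.lm V ((Module.finBasis ℂ V).coord i) v) w := by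
  simp only [← contrL_Rinv]
  exact (sum_tmul_contrL _).symm

theorem R_tmul (V W : C.Obj) (v : V) (w : W) :
    Q.R V W (v ⊗ₜ w) = ∑ i, V.rep.ρ (Q.lp W ((Module.finBasis ℂ W).coord i) w) v ⊗ₜ[ℂ]
      Module.finBasis ℂ W i := by
  simp only [← contrR_R]
  exact (sum_contrR_tmul _).symm

theorem Rinv_natural {V V' W W' : C.Obj} (φ : V →ₗ[ℂ] V') (ψ : W →ₗ[ℂ] W')
    (hφ : URep.IsHom V.rep V'.rep φ) (hψ : URep.IsHom W.rep W'.rep ψ) (t : V ⊗[ℂ] W) :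
    Q.Rinv V' W' (TensorProduct.map φ ψ t) = TensorProduct.map φ ψ (Q.Rinv V W t) := by
  conv_lhs => rw [← Q.R_Rinv V W t]
  rw [← Q.R_natural φ ψ hφ hψ, Rinv_R]

/-! ### Comultiplication and counit of matrix coefficients -/

theorem Rinv_tensor_right (V W X : C.Obj) :
    (Q.Rinv V (W.tensor X) : Module.End ℂ (V ⊗[ℂ] (W ⊗[ℂ] X))) =
      (TensorProduct.assoc ℂ V W X).toLinearMap ∘ₗ
        (leg12 X (Q.Rinv V W) * leg13 W (Q.Rinv V X)) ∘ₗ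
        (TensorProduct.assoc ℂ V W X).symm.toLinearMap := by
  refine (Q.isUnit_R V (W.tensor X)).mul_right_cancel ?_
  rw [Q.Rinv_mul_R]
  have h := Q.comul_right V W X
  refine LinearMap.ext fun t => ?_
  have h1 := LinearMap.congr_fun h ((TensorProduct.assoc ℂ V W X).symm t)
  simp only [LinearMap.comp_apply, LinearEquiv.coe_coe, LinearEquiv.apply_symm_apply] at h1
  change t = TensorProduct.assoc ℂ V W X ((leg12 X (Q.Rinv V W) * leg13 W (Q.Rinv V X))
    ((TensorProduct.assoc ℂ V W X).symm (Q.R V (W.tensor X) t)))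
  rw [h1, ← Module.End.mul_apply, mul_assoc, ← mul_assoc (leg13 W (Q.Rinv V X)), leg13_mul,
    Rinv_mul_R, leg13_one, one_mul, leg12_mul, Rinv_mul_R, leg12_one, Module.End.one_apply,
    LinearEquiv.apply_symm_apply]

theorem Rinv_tensor_left (V W X : C.Obj) :
    (Q.Rinv (V.tensor W) X : Module.End ℂ ((V ⊗[ℂ] W) ⊗[ℂ] X)) =
      leg23 V (Q.Rinv W X) * leg13 W (Q.Rinv V X) := by
  refine (Q.isUnit_R (V.tensor W) X).mul_right_cancel ?_
  rw [Q.Rinv_mul_R]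
  have h := Q.comul_left V W X
  change (1 : Module.End ℂ ((V ⊗[ℂ] W) ⊗[ℂ] X)) =
    (leg23 V (Q.Rinv W X) * leg13 W (Q.Rinv V X)) * Q.R (V.tensor W) X
  rw [h, mul_assoc, ← mul_assoc (leg13 W (Q.Rinv V X)), leg13_mul,
    Rinv_mul_R, leg13_one, one_mul, leg23_mul, Rinv_mul_R, leg23_one]

variable {Q} in
/-- This is `(id ⊗ Δ)(R⁻¹) = R₁₂⁻¹ R₁₃⁻¹`. -/
theorem comul_lm (hC : C.Separating) (V : C.Obj) (α : Module.Dual ℂ V) (v : V) :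
    Coalgebra.comul (R := ℂ) (Q.lm V α v) = ∑ i, Q.lm V α (Module.finBasis ℂ V i) ⊗ₜ[ℂ]
      Q.lm V ((Module.finBasis ℂ V).coord i) v := by
  refine hC.ext₂ fun W X w x => ?_
  refine (Q.contrL_Rinv V (W.tensor X) α v (w ⊗ₜ x)).symm.trans ?_
  have h := LinearMap.congr_fun (Q.Rinv_tensor_right V W X) (v ⊗ₜ (w ⊗ₜ x))
  refine (congrArg (contrL (W ⊗[ℂ] X) α) h).trans ?_
  simp only [LinearMap.comp_apply, LinearEquiv.coe_coe, TensorProduct.assoc_symm_tmul,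
    Module.End.mul_apply, leg13_tmul]
  rw [Rinv_tmul]
  simp only [TensorProduct.sum_tmul, map_sum, TensorProduct.rightComm_tmul, leg12_tmul,
    contrL_assoc, LinearMap.sum_apply, URep.act₂_tmul, TensorProduct.map_tmul, contrL_Rinv]

variable {Q} in
/-- This is `(Δ ⊗ id)(R) = R₁₃ R₂₃`. -/
theorem comul_lp (hC : C.Separating) (V : C.Obj) (α : Module.Dual ℂ V) (v : V) :
    Coalgebra.comul (R := ℂ) (Q.lp V α v) = ∑ i, Q.lp V α (Module.finBasis ℂ V i) ⊗ₜ[ℂ]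
      Q.lp V ((Module.finBasis ℂ V).coord i) v := by
  refine hC.ext₂ fun W X w x => ?_
  refine (Q.contrR_R (W.tensor X) V α (w ⊗ₜ x) v).symm.trans ?_
  have h := LinearMap.congr_fun (Q.comul_left W X V) ((w ⊗ₜ x) ⊗ₜ v)
  refine (congrArg (contrR (W ⊗[ℂ] X) α) h).trans ?_
  rw [Module.End.mul_apply, leg23_tmul, R_tmul]
  simp only [map_sum, TensorProduct.tmul_sum, TensorProduct.assoc_symm_tmul, leg13_tmul,
    LinearMap.sum_apply, URep.act₂_tmul, TensorProduct.map_tmul]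
  refine Finset.sum_congr rfl fun i _ => ?_
  rw [contrR_rightComm, contrR_R]

end QuasiTriangular

theorem antipodeInv_antipode {U : Type u} [Ring U] [HopfAlgebra ℂ U] [BijectiveAntipode U]
    (x : U) : antipodeInv U (HopfAlgebra.antipode ℂ x) = x :=
  (LinearEquiv.ofBijective (HopfAlgebra.antipode ℂ : U →ₗ[ℂ] U)
    BijectiveAntipode.bij).symm_apply_apply x

namespace QuasiTriangular

variable {U : Type u} [Ring U] [HopfAlgebra ℂ U] [BijectiveAntipode U] {C : TensorSubcat U}
  {Q : QuasiTriangular C}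

theorem counit_lm (hC : C.Separating) (V : C.Obj) (α : Module.Dual ℂ V) (v : V) :
    Coalgebra.counit (R := ℂ) (Q.lm V α v) = α v := by
  -- by the counit axiom, `α` and `ε ∘ lm α` have the same contractions with `R⁻¹ (v ⊗ 1)`; as `R⁻¹`
  -- is invertible on `V ⊗ 𝟙`, the two functionals agree
  have h1 : ∀ v, Q.lm V (Coalgebra.counit (R := ℂ) ∘ₗ Q.lm V α) v = Q.lm V α v := fun v => by
    have h := Coalgebra.rTensor_counit_comul (R := ℂ) (Q.lm V α v)
    rw [comul_lm hC] at h
    have h2 := congrArg (TensorProduct.lid ℂ U) h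
    simp only [map_sum, LinearMap.rTensor_tmul, TensorProduct.lid_tmul, one_smul] at h2
    rw [← h2]
    conv_lhs => rw [← sum_smul_coord (Coalgebra.counit (R := ℂ) ∘ₗ Q.lm V α)]
    simp
  have h3 : ∀ z : V ⊗[ℂ] (Obj.one C), contrL (Obj.one C) (Coalgebra.counit (R := ℂ) ∘ₗ Q.lm V α)
      (Q.Rinv V (Obj.one C) z) = contrL (Obj.one C) α (Q.Rinv V (Obj.one C) z) := fun z => by
    induction z using TensorProduct.induction_on with
    | zero => simp
    | add s t h1 h2 => simp only [map_add, h1, h2]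
    | tmul v w => rw [contrL_Rinv, contrL_Rinv, h1]
  have h4 := h3 (Q.R V (Obj.one C) (v ⊗ₜ ULift.up 1))
  rw [Rinv_R, contrL_tmul, contrL_tmul] at h4
  simpa using congrArg ULift.down h4

theorem counit_lp (hC : C.Separating) (V : C.Obj) (α : Module.Dual ℂ V) (v : V) :
    Coalgebra.counit (R := ℂ) (Q.lp V α v) = α v := by
  have h1 : ∀ v, Q.lp V (Coalgebra.counit (R := ℂ) ∘ₗ Q.lp V α) v = Q.lp V α v := fun v => by
    have h := Coalgebra.rTensor_counit_comul (R := ℂ) (Q.lp V α v)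
    rw [comul_lp hC] at h
    have h2 := congrArg (TensorProduct.lid ℂ U) h
    simp only [map_sum, LinearMap.rTensor_tmul, TensorProduct.lid_tmul, one_smul] at h2
    rw [← h2]
    conv_lhs => rw [← sum_smul_coord (Coalgebra.counit (R := ℂ) ∘ₗ Q.lp V α)]
    simp
  have h3 : ∀ z : (Obj.one C) ⊗[ℂ] V, contrR (Obj.one C) (Coalgebra.counit (R := ℂ) ∘ₗ Q.lp V α)
      (Q.R (Obj.one C) V z) = contrR (Obj.one C) α (Q.R (Obj.one C) V z) := fun z => by
    induction z using TensorProduct.induction_on with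
    | zero => simp
    | add s t h1 h2 => simp only [map_add, h1, h2]
    | tmul v w => rw [contrR_R, contrR_R, h1]
  have h4 := h3 (Q.Rinv (Obj.one C) V (ULift.up 1 ⊗ₜ v))
  rw [R_Rinv, contrR_tmul, contrR_tmul] at h4
  simpa using congrArg ULift.down h4

/-! ### Inverses -/

theorem sum_lm_mul_rh (hC : C.Separating) (V : C.Obj) (α : Module.Dual ℂ V) (v : V) :
    ∑ i, Q.lm V α (Module.finBasis ℂ V i) * Q.rh V ((Module.finBasis ℂ V).coord i) v =
      algebraMap ℂ U (α v) := by
  have h := HopfAlgebra.mul_antipode_lTensor_comul_apply (R := ℂ) (Q.lm V α v)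
  rw [comul_lm hC, counit_lm hC] at h
  simpa [rh_eq] using h

theorem sum_rh_mul_lm (hC : C.Separating) (V : C.Obj) (α : Module.Dual ℂ V) (v : V) :
    ∑ i, Q.rh V α (Module.finBasis ℂ V i) * Q.lm V ((Module.finBasis ℂ V).coord i) v =
      algebraMap ℂ U (α v) := by
  have h := HopfAlgebra.mul_antipode_rTensor_comul_apply (R := ℂ) (Q.lm V α v)
  rw [comul_lm hC, counit_lm hC] at h
  simpa [rh_eq] using h

theorem sum_lp_mul_antipode (hC : C.Separating) (V : C.Obj) (α : Module.Dual ℂ V) (v : V) :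
    ∑ i, Q.lp V α (Module.finBasis ℂ V i) *
      HopfAlgebra.antipode ℂ (Q.lp V ((Module.finBasis ℂ V).coord i) v) =
      algebraMap ℂ U (α v) := by
  have h := HopfAlgebra.mul_antipode_lTensor_comul_apply (R := ℂ) (Q.lp V α v)
  rw [comul_lp hC, counit_lp hC] at h
  simpa using h

theorem sum_antipode_mul_lp (hC : C.Separating) (V : C.Obj) (α : Module.Dual ℂ V) (v : V) :
    ∑ i, HopfAlgebra.antipode ℂ (Q.lp V α (Module.finBasis ℂ V i)) *
      Q.lp V ((Module.finBasis ℂ V).coord i) v =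
      algebraMap ℂ U (α v) := by
  have h := HopfAlgebra.mul_antipode_rTensor_comul_apply (R := ℂ) (Q.lp V α v)
  rw [comul_lp hC, counit_lp hC] at h
  simpa using h

/-- `(ρ_V ⊗ id)(R) = (id ⊗ S)(L_V⁻)` acts on the objects of `C` as the R-matrix. -/
theorem contrL_R (hC : C.Separating) (V W : C.Obj) (α : Module.Dual ℂ V) (v : V) (w : W) :
    contrL W α (Q.R V W (v ⊗ₜ w)) = W.rep.ρ (Q.rh V α v) w := by
  have h : Q.R V W (v ⊗ₜ w) = ∑ i, Module.finBasis ℂ V i ⊗ₜ[ℂ]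
      W.rep.ρ (Q.rh V ((Module.finBasis ℂ V).coord i) v) w := by
    rw [← Q.R_Rinv V W (∑ i, _)]
    refine congrArg _ (contrL_ext fun β => ?_)
    rw [contrL_tmul, map_sum, map_sum]
    simp only [contrL_Rinv]
    have h := congrArg (fun x => W.rep.ρ x w) (sum_lm_mul_rh (Q := Q) hC V β v)
    simp only [map_sum, map_mul, LinearMap.sum_apply, Module.End.mul_apply, AlgHom.commutes,
      Module.algebraMap_end_apply] at h
    exact h.symm
  rw [h, map_sum]
  simp only [contrL_tmul]
  conv_rhs => rw [← sum_smul_coord α]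
  simp only [map_sum, map_smul, LinearMap.sum_apply, LinearMap.smul_apply]

theorem contrR_Rinv (hC : C.Separating) (V W : C.Obj) (β : Module.Dual ℂ W) (v : V) (w : W) :
    contrR V β (Q.Rinv V W (v ⊗ₜ w)) = V.rep.ρ (HopfAlgebra.antipode ℂ (Q.lp W β w)) v := by
  have h : Q.Rinv V W (v ⊗ₜ w) = ∑ i,
      V.rep.ρ (HopfAlgebra.antipode ℂ (Q.lp W ((Module.finBasis ℂ W).coord i) w)) v ⊗ₜ[ℂ]
        Module.finBasis ℂ W i := by
    rw [← Q.Rinv_R V W (∑ i, _)]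
    refine congrArg _ (contrR_ext fun β => ?_)
    rw [contrR_tmul, map_sum, map_sum]
    simp only [contrR_R]
    have h := congrArg (fun x => V.rep.ρ x v) (sum_lp_mul_antipode (Q := Q) hC W β w)
    simp only [map_sum, map_mul, LinearMap.sum_apply, Module.End.mul_apply, AlgHom.commutes,
      Module.algebraMap_end_apply] at h
    exact h.symm
  rw [h, map_sum]
  simp only [contrR_tmul]
  conv_rhs => rw [← sum_smul_coord β]
  simp only [map_sum, map_smul, LinearMap.sum_apply, LinearMap.smul_apply]

theorem comul_rh (hC : C.Separating) (V : C.Obj) (α : Module.Dual ℂ V) (v : V) :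
    Coalgebra.comul (R := ℂ) (Q.rh V α v) = ∑ i, Q.rh V ((Module.finBasis ℂ V).coord i) v ⊗ₜ[ℂ]
      Q.rh V α (Module.finBasis ℂ V i) := by
  refine hC.ext₂ fun W X w x => ?_
  refine (contrL_R hC V (W.tensor X) α v (w ⊗ₜ x)).symm.trans ?_
  have h := LinearMap.congr_fun (Q.comul_right V W X) ((v ⊗ₜ w) ⊗ₜ x)
  have h' := congrArg (TensorProduct.assoc ℂ V W X) h
  simp only [LinearMap.comp_apply, LinearEquiv.coe_coe, LinearEquiv.apply_symm_apply,
    TensorProduct.assoc_tmul] at h'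
  refine (congrArg (contrL (W ⊗[ℂ] X) α) h').trans ?_
  rw [Module.End.mul_apply, leg12_tmul, ← sum_tmul_contrL (Q.R V W (v ⊗ₜ w))]
  simp only [TensorProduct.sum_tmul, map_sum, leg13_tmul, LinearMap.sum_apply, URep.act₂_tmul,
    TensorProduct.map_tmul, contrL_R hC]
  refine Finset.sum_congr rfl fun i _ => ?_
  have h2 : ∀ (t : V ⊗[ℂ] X) (y : W), contrL (W ⊗[ℂ] X) α (TensorProduct.assoc ℂ V W X
      (TensorProduct.rightComm ℂ V X W (t ⊗ₜ y))) = y ⊗ₜ contrL X α t := fun t y => by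
    induction t using TensorProduct.induction_on with
    | zero => simp
    | add s t h1 h2 => simp only [map_add, TensorProduct.add_tmul, TensorProduct.tmul_add, h1, h2]
    | tmul a b => simp
  rw [h2, contrL_R hC]

/-! ### Products, naturality and equivariance -/

/-- This is `(Δ ⊗ id)(R⁻¹) = R₂₃⁻¹ R₁₃⁻¹`. -/
theorem lm_tensor (hC : C.Separating) (V W : C.Obj) (α : Module.Dual ℂ V) (β : Module.Dual ℂ W)
    (v : V) (w : W) :
    Q.lm (V.tensor W) (TensorProduct.dualDistrib ℂ V W (α ⊗ₜ β)) (v ⊗ₜ w) =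
      Q.lm W β w * Q.lm V α v := by
  refine hC.ext fun X x => ?_
  refine (Q.contrL_Rinv (V.tensor W) X _ (v ⊗ₜ w) x).symm.trans ?_
  have h := LinearMap.congr_fun (Q.Rinv_tensor_left V W X) ((v ⊗ₜ w) ⊗ₜ x)
  refine (congrArg (contrL X (TensorProduct.dualDistrib ℂ V W (α ⊗ₜ β))) h).trans ?_
  have h2 : ∀ (a : V) (t : W ⊗[ℂ] X), contrL X (TensorProduct.dualDistrib ℂ V W (α ⊗ₜ β))
      ((TensorProduct.assoc ℂ V W X).symm (a ⊗ₜ t)) = α a • contrL X β t := fun a t => by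
    induction t using TensorProduct.induction_on with
    | zero => simp
    | add s t h1 h2 => simp only [map_add, TensorProduct.tmul_add, smul_add, h1, h2]
    | tmul b d => simp [mul_smul]
  rw [Module.End.mul_apply, leg13_tmul, Rinv_tmul]
  simp only [TensorProduct.sum_tmul, map_sum, TensorProduct.rightComm_tmul, leg23_tmul, h2,
    contrL_Rinv]
  rw [map_mul, Module.End.mul_apply]
  conv_rhs => rw [← sum_smul_coord α]
  simp only [map_sum, map_smul, LinearMap.sum_apply, LinearMap.smul_apply]

theorem lm_natural (hC : C.Separating) {V W : C.Obj} {φ : V →ₗ[ℂ] W}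
    (hφ : URep.IsHom V.rep W.rep φ) (α : Module.Dual ℂ W) (v : V) :
    Q.lm W α (φ v) = Q.lm V (α ∘ₗ φ) v := by
  refine hC.ext fun X x => ?_
  rw [← contrL_Rinv, ← contrL_Rinv]
  have h := Q.Rinv_natural φ LinearMap.id hφ (URep.IsHom.id X.rep) (v ⊗ₜ x)
  rw [TensorProduct.map_tmul, LinearMap.id_apply] at h
  rw [h, contrL_map, LinearMap.id_apply]

/-- Comparison of coefficients in `R⁻¹ Δᶜᵒᵖ(x) = Δ(x) R⁻¹`. -/
theorem lm_hom (hC : C.Separating) (V : C.Obj) {x : U} {ι : Type*} (r : Coalgebra.Repr ℂ x ι)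
    (α : Module.Dual ℂ V) (v : V) :
    ∑ i ∈ r.index, Q.lm V α (V.rep.ρ (r.right i) v) * r.left i =
      ∑ i ∈ r.index, r.right i * Q.lm V (α ∘ₗ V.rep.ρ (r.left i)) v := by
  refine hC.ext fun W w => ?_
  have h : Q.Rinv V W (URep.act₂ V.rep W.rep (TensorProduct.comm ℂ U U (Coalgebra.comul x))
      (v ⊗ₜ w)) = URep.act₂ V.rep W.rep (Coalgebra.comul x) (Q.Rinv V W (v ⊗ₜ w)) := by
    have h := LinearMap.congr_fun (Q.R_comul V W x) (Q.Rinv V W (v ⊗ₜ w))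
    rw [Module.End.mul_apply, Module.End.mul_apply, R_Rinv] at h
    rw [← h, Rinv_R]
  have h' := congrArg (contrL W α) h
  rw [← r.eq] at h'
  simpa only [map_sum, TensorProduct.comm_tmul, URep.act₂_tmul, LinearMap.sum_apply,
    TensorProduct.map_tmul, contrL_map, contrL_Rinv, map_mul, Module.End.mul_apply] using h'

/-- Comparison of coefficients in `R Δ(x) = Δᶜᵒᵖ(x) R`, in the second factor. -/
theorem lp_hom (hC : C.Separating) (V : C.Obj) {x : U} {ι : Type*} (r : Coalgebra.Repr ℂ x ι)
    (α : Module.Dual ℂ V) (v : V) :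
    ∑ i ∈ r.index, Q.lp V α (V.rep.ρ (r.right i) v) * r.left i =
      ∑ i ∈ r.index, r.right i * Q.lp V (α ∘ₗ V.rep.ρ (r.left i)) v := by
  refine hC.ext fun W w => ?_
  have h := LinearMap.congr_fun (Q.R_comul W V x) (w ⊗ₜ v)
  have h' := congrArg (contrR W α) h
  rw [← r.eq] at h'
  simpa only [map_sum, TensorProduct.comm_tmul, URep.act₂_tmul, LinearMap.sum_apply,
    TensorProduct.map_tmul, contrR_map, contrR_R, map_mul, Module.End.mul_apply] using h'

/-- Comparison of coefficients in `R Δ(x) = Δᶜᵒᵖ(x) R`, in the first factor. -/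
theorem rh_hom (hC : C.Separating) (V : C.Obj) {x : U} {ι : Type*} (r : Coalgebra.Repr ℂ x ι)
    (α : Module.Dual ℂ V) (v : V) :
    ∑ i ∈ r.index, Q.rh V α (V.rep.ρ (r.left i) v) * r.right i =
      ∑ i ∈ r.index, r.left i * Q.rh V (α ∘ₗ V.rep.ρ (r.right i)) v := by
  refine hC.ext fun W w => ?_
  have h := LinearMap.congr_fun (Q.R_comul V W x) (v ⊗ₜ w)
  have h' := congrArg (contrL W α) h
  rw [← r.eq] at h'
  simpa only [map_sum, TensorProduct.comm_tmul, URep.act₂_tmul, LinearMap.sum_apply,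
    TensorProduct.map_tmul, contrL_map, contrL_R hC, map_mul, Module.End.mul_apply] using h'

/-! ### The R-matrix on dual modules -/

theorem rh_dual (hC : C.Separating) (V : C.Obj) (α : Module.Dual ℂ V) (v : V) :
    Q.rh V.dual (Module.Dual.eval ℂ V v) α = Q.lm V α v := by
  refine hC.ext fun W w => dual_ext fun β => ?_
  rw [← contrL_R hC, ← contrL_Rinv, contrL_contrR, contrL_contrR, contrR_R, contrR_Rinv hC]
  rfl

theorem lm_ldual (hC : C.Separating) (V : C.Obj) (α : Module.Dual ℂ V) (v : V) :
    Q.lm V.ldual (Module.Dual.eval ℂ V v) α = Q.rh V α v := by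
  refine hC.ext fun W w => dual_ext fun β => ?_
  rw [← contrL_R hC, ← contrL_Rinv, contrL_contrR, contrL_contrR, contrR_R, contrR_Rinv hC]
  change α (V.rep.ρ (antipodeInv U (HopfAlgebra.antipode ℂ (Q.lp W β w))) v) = _
  rw [antipodeInv_antipode]

/-- The R-matrix on `V^* ⊗ W^*` is the transpose of the R-matrix on `V ⊗ W`. -/
theorem R_dual (hC : C.Separating) (V W : C.Obj) (α : Module.Dual ℂ V) (β : Module.Dual ℂ W)
    (v : V) (w : W) :
    TensorProduct.dualDistrib ℂ _ _ (Module.Dual.eval ℂ V v ⊗ₜ Module.Dual.eval ℂ W w)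
      (Q.R V.dual W.dual (α ⊗ₜ β)) = TensorProduct.dualDistrib ℂ V W (α ⊗ₜ β)
        (Q.R V W (v ⊗ₜ w)) := by
  rw [dualDistrib_apply_eq, dualDistrib_apply_eq, contrL_R hC, rh_eq Q V, ← rh_dual hC]
  exact congrArg (Module.Dual.eval ℂ W w)
    (contrL_R hC V.dual W.dual (Module.Dual.eval ℂ V v) α β)

/-- The R-matrix on `^*V ⊗ ^*W` is the transpose of the R-matrix on `V ⊗ W`. -/
theorem R_ldual (hC : C.Separating) (V W : C.Obj) (α : Module.Dual ℂ V) (β : Module.Dual ℂ W)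
    (v : V) (w : W) :
    TensorProduct.dualDistrib ℂ _ _ (Module.Dual.eval ℂ V v ⊗ₜ Module.Dual.eval ℂ W w)
      (Q.R V.ldual W.ldual (α ⊗ₜ β)) = TensorProduct.dualDistrib ℂ V W (α ⊗ₜ β)
        (Q.R V W (v ⊗ₜ w)) := by
  rw [dualDistrib_apply_eq, dualDistrib_apply_eq, contrL_R hC]
  refine (congrArg (Module.Dual.eval ℂ W w)
    (contrL_R hC V.ldual W.ldual (Module.Dual.eval ℂ V v) α β)).trans ?_
  change β (W.rep.ρ (antipodeInv U (Q.rh V.ldual (Module.Dual.eval ℂ V v) α)) w) = _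
  rw [rh_eq, antipodeInv_antipode, lm_ldual hC]

end QuasiTriangular

/-! ### Evaluation and coevaluation -/

section Duality

variable {U : Type u} [Ring U] [HopfAlgebra ℂ U]

theorem sum_antipodeInv_mul [BijectiveAntipode U] {x : U} {ι : Type*} (r : Coalgebra.Repr ℂ x ι) :
    ∑ i ∈ r.index, antipodeInv U (r.right i) * r.left i =
      algebraMap ℂ U (Coalgebra.counit x) := by
  apply (BijectiveAntipode.bij (U := U)).1
  simp only [map_sum, HopfAlgebra.antipode_mul_antidistrib, antipode_antipodeInv]
  rw [HopfAlgebra.sum_antipode_mul_eq_algebraMap_counit r]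
  simp [Algebra.algebraMap_eq_smul_one]

theorem sum_mul_antipodeInv [BijectiveAntipode U] {x : U} {ι : Type*} (r : Coalgebra.Repr ℂ x ι) :
    ∑ i ∈ r.index, r.right i * antipodeInv U (r.left i) =
      algebraMap ℂ U (Coalgebra.counit x) := by
  apply (BijectiveAntipode.bij (U := U)).1
  simp only [map_sum, HopfAlgebra.antipode_mul_antidistrib, antipode_antipodeInv]
  rw [HopfAlgebra.sum_mul_antipode_eq_algebraMap_counit r]
  simp [Algebra.algebraMap_eq_smul_one]

namespace URep

/-- The action on a tensor product in Sweedler notation. -/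
theorem tensor_ρ_tmul (V : URep.{u, v} U) (W : URep.{u, w} U) {x : U} {ι : Type*}
    (r : Coalgebra.Repr ℂ x ι) (a : V) (b : W) :
    (V.tensor W).ρ x (a ⊗ₜ b) = ∑ i ∈ r.index, V.ρ (r.left i) a ⊗ₜ[ℂ] W.ρ (r.right i) b := by
  rw [tensor_apply, ← r.eq, map_sum, LinearMap.sum_apply]
  rfl

theorem unit_ρ_apply (x : U) (z : ULift.{u} ℂ) :
    (URep.unit U).ρ x z = (Coalgebra.counit x : ℂ) • z := rfl

/-- The evaluation `α ⊗ v ↦ α(v)`, with values in the trivial module. -/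
def ev (V : Type*) [AddCommGroup V] [Module ℂ V] : Module.Dual ℂ V ⊗[ℂ] V →ₗ[ℂ] ULift.{u} ℂ :=
  ULift.moduleEquiv.symm.toLinearMap ∘ₗ contractLeft ℂ V

/-- The evaluation `v ⊗ α ↦ α(v)`, with values in the trivial module. -/
def evr (V : Type*) [AddCommGroup V] [Module ℂ V] : V ⊗[ℂ] Module.Dual ℂ V →ₗ[ℂ] ULift.{u} ℂ :=
  ULift.moduleEquiv.symm.toLinearMap ∘ₗ contractRight ℂ V

/-- The coevaluation `1 ↦ ∑ eⁱ ⊗ eᵢ`, defined on the trivial module. -/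
def coev (V : Type*) [AddCommGroup V] [Module ℂ V] [FiniteDimensional ℂ V] :
    ULift.{u} ℂ →ₗ[ℂ] Module.Dual ℂ V ⊗[ℂ] V :=
  (LinearMap.toSpanSingleton ℂ _
    (∑ i, (Module.finBasis ℂ V).coord i ⊗ₜ[ℂ] Module.finBasis ℂ V i)) ∘ₗ
    ULift.moduleEquiv.toLinearMap

theorem ev_tmul {V : Type*} [AddCommGroup V] [Module ℂ V] (α : Module.Dual ℂ V) (v : V) :
    ev.{u} V (α ⊗ₜ v) = ULift.up (α v) := rfl

theorem evr_tmul {V : Type*} [AddCommGroup V] [Module ℂ V] (α : Module.Dual ℂ V) (v : V) :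
    evr.{u} V (v ⊗ₜ α) = ULift.up (α v) := rfl

theorem isHom_ev (V : URep.{u, v} U) : IsHom (V.dual.tensor V) (URep.unit U) (ev V) := by
  intro x t
  induction t using TensorProduct.induction_on with
  | zero => simp
  | add s t h1 h2 => simp only [map_add, h1, h2]
  | tmul α v =>
    let r := Coalgebra.Repr.arbitrary ℂ x
    rw [tensor_ρ_tmul _ _ r, map_sum, unit_ρ_apply]
    have h := congrArg (fun y => α (V.ρ y v)) (HopfAlgebra.sum_antipode_mul_eq_algebraMap_counit r)
    simp only [map_sum, map_mul, LinearMap.sum_apply, Module.End.mul_apply, AlgHom.commutes,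
      Module.algebraMap_end_apply, map_smul] at h
    refine ULift.ext _ _ ?_
    rw [ev_tmul]
    refine Eq.trans ?_ h
    exact map_sum (ULift.moduleEquiv : ULift.{u} ℂ ≃ₗ[ℂ] ℂ) _ _

theorem isHom_evr [BijectiveAntipode U] (V : URep.{u, v} U) :
    IsHom (V.tensor V.ldual) (URep.unit U) (evr V) := by
  intro x t
  induction t using TensorProduct.induction_on with
  | zero => simp
  | add s t h1 h2 => simp only [map_add, h1, h2]
  | tmul v α =>
    let r := Coalgebra.Repr.arbitrary ℂ x
    rw [tensor_ρ_tmul _ _ r, map_sum, unit_ρ_apply]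
    have h := congrArg (fun y => α (V.ρ y v)) (sum_antipodeInv_mul r)
    simp only [map_sum, map_mul, LinearMap.sum_apply, Module.End.mul_apply, AlgHom.commutes,
      Module.algebraMap_end_apply, map_smul] at h
    refine ULift.ext _ _ ?_
    rw [evr_tmul]
    refine Eq.trans ?_ h
    exact map_sum (ULift.moduleEquiv : ULift.{u} ℂ ≃ₗ[ℂ] ℂ) _ _

theorem isHom_coev [BijectiveAntipode U] (V : URep.{u, v} U) [FiniteDimensional ℂ V] :
    IsHom (URep.unit U) (V.ldual.tensor V) (coev V) := by
  intro x z
  let r := Coalgebra.Repr.arbitrary ℂ x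
  have key : (V.ldual.tensor V).ρ x (∑ i, (Module.finBasis ℂ V).coord i ⊗ₜ[ℂ]
      Module.finBasis ℂ V i) = (Coalgebra.counit x : ℂ) • ∑ i, (Module.finBasis ℂ V).coord i ⊗ₜ[ℂ]
      Module.finBasis ℂ V i := by
    simp only [map_sum, tensor_ρ_tmul _ _ r]
    rw [Finset.sum_comm]
    have h1 : ∀ j, ∑ i, V.ldual.ρ (r.left j) ((Module.finBasis ℂ V).coord i) ⊗ₜ[ℂ]
        V.ρ (r.right j) (Module.finBasis ℂ V i) = ∑ i, (Module.finBasis ℂ V).coord i ⊗ₜ[ℂ]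
        V.ρ (r.right j * antipodeInv U (r.left j)) (Module.finBasis ℂ V i) := fun j => by
      have h := sum_basis_comp (V.ρ (antipodeInv U (r.left j)))
        ((TensorProduct.mk ℂ (Module.Dual ℂ V) V).flip ∘ₗ V.ρ (r.right j))
      simp only [LinearMap.comp_apply, LinearMap.flip_apply, TensorProduct.mk_apply] at h
      simp only [map_mul, Module.End.mul_apply]
      exact h.symm
    refine (Finset.sum_congr rfl fun j _ => h1 j).trans ?_
    rw [Finset.sum_comm]
    simp only [← TensorProduct.tmul_sum, ← LinearMap.sum_apply, ← map_sum]
    rw [sum_mul_antipodeInv r]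
    simp [TensorProduct.tmul_smul, Finset.smul_sum]
  rw [unit_ρ_apply, map_smul]
  obtain ⟨z⟩ := z
  change (Coalgebra.counit x : ℂ) • (z • _) = (V.ldual.tensor V).ρ x (z • _)
  rw [map_smul, key, smul_comm]

end URep

end Duality

/-! ### The right-handed reflection equation -/

namespace QuasiTriangular

variable {U : Type u} [Ring U] [HopfAlgebra ℂ U] [BijectiveAntipode U] {C : TensorSubcat U}
  {Q : QuasiTriangular C}

theorem isHom_braid (Q : QuasiTriangular C) (V W : C.Obj) :
    URep.IsHom (V.tensor W).rep (W.tensor V).rep (Q.braid V W) := by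
  intro x t
  have h := LinearMap.congr_fun (Q.R_comul V W x) t
  change TensorProduct.comm ℂ V W (Q.R V W (URep.act₂ V.rep W.rep (Coalgebra.comul x) t)) =
    URep.act₂ W.rep V.rep (Coalgebra.comul x) (TensorProduct.comm ℂ V W (Q.R V W t))
  rw [Module.End.mul_apply] at h
  rw [h, Module.End.mul_apply]
  generalize Q.R V W t = s
  generalize (Coalgebra.comul (R := ℂ) x : U ⊗[ℂ] U) = y
  induction y using TensorProduct.induction_on with
  | zero => simp
  | add a b h1 h2 => simp only [map_add, LinearMap.add_apply, h1, h2]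
  | tmul a b =>
    rw [TensorProduct.comm_tmul, URep.act₂_tmul, URep.act₂_tmul, TensorProduct.map_comm]

theorem dualDistrib_R_dual (hC : C.Separating) (V W : C.Obj) (α : Module.Dual ℂ V)
    (β : Module.Dual ℂ W) (t : V ⊗[ℂ] W) :
    TensorProduct.dualDistrib ℂ V W (Q.R V.dual W.dual (α ⊗ₜ β)) t =
      TensorProduct.dualDistrib ℂ V W (α ⊗ₜ β) (Q.R V W t) := by
  induction t using TensorProduct.induction_on with
  | zero => simp
  | add s t h1 h2 => simp only [map_add, h1, h2]
  | tmul v w => rw [← R_dual hC]; exact (dualDistrib_eval _ v w).symm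

theorem dualDistrib_R_ldual (hC : C.Separating) (V W : C.Obj)
    (z : Module.Dual ℂ V ⊗[ℂ] Module.Dual ℂ W) (t : V ⊗[ℂ] W) :
    TensorProduct.dualDistrib ℂ V W (Q.R V.ldual W.ldual z) t =
      TensorProduct.dualDistrib ℂ V W z (Q.R V W t) := by
  induction z using TensorProduct.induction_on with
  | zero => simp
  | add s t h1 h2 => simp only [map_add, LinearMap.add_apply, h1, h2]
  | tmul α β =>
    induction t using TensorProduct.induction_on with
    | zero => simp
    | add s t h1 h2 => simp only [map_add, h1, h2]
    | tmul v w => rw [← R_ldual hC]; exact (dualDistrib_eval _ v w).symm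

namespace Character

variable (f : Q.Character)

theorem toLin_mk (V : C.Obj) (α : Module.Dual ℂ V) (v : V) :
    f.toLin (CoEnd.mk V (α ⊗ₜ v)) = α (f.J V v) := by
  simp only [J, LinearMap.sum_apply, LinearMap.smulRight_apply, map_sum, map_smul,
    LinearMap.comp_apply, TensorProduct.mk_apply]
  conv_lhs => rw [← sum_smul_coord α]
  simp only [TensorProduct.sum_tmul, ← TensorProduct.smul_tmul', map_sum, map_smul, smul_eq_mul,
    mul_comm]

theorem J_natural {V W : C.Obj} {φ : V →ₗ[ℂ] W} (hφ : URep.IsHom V.rep W.rep φ) (v : V) :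
    f.J W (φ v) = φ (f.J V v) := by
  refine dual_ext fun α => ?_
  rw [← f.toLin_mk, ← CoEnd.mk_dinatural hφ, f.toLin_mk, LinearMap.comp_apply]

theorem J_one : f.J (Obj.one C) = LinearMap.id := by
  refine LinearMap.ext fun z => ?_
  have h : (f.J (Obj.one C) (ULift.up 1)) = ULift.up 1 := by
    have h := f.map_one
    rw [CoEnd.one, f.toLin_mk] at h
    exact ULift.ext _ _ h
  have hz : z = z.down • (ULift.up 1 : ULift.{u} ℂ) := ULift.ext _ _ (by simp)
  rw [hz]
  exact (map_smul (f.J (Obj.one C)) z.down (ULift.up 1)).trans (congrArg _ h)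

/-- The operator `J` of a tensor product: `R J_{V ⊗ W} = (J_V ⊗ 1) R (1 ⊗ J_W)`. This is the
multiplicativity of the character. -/
theorem R_J_tensor (hC : C.Separating) (V W : C.Obj) (t : V ⊗[ℂ] W) :
    Q.R V W (f.J (V.tensor W) t) =
      (f.J V).rTensor W (Q.R V W ((f.J W).lTensor V t)) := by
  induction t using TensorProduct.induction_on with
  | zero => simp
  | add s t h1 h2 => simp only [map_add, h1, h2]
  | tmul v w =>
  refine contrL_ext fun α => dual_ext fun β => ?_
  -- `G (v ⊗ δ)` is the value of `f` on the product of `[α ⊠ v]` and `[δ ⊠ w]` without the braiding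
  -- of the middle factors; the braiding is removed by applying `G` to `R⁻¹ (v ⊗ β)`
  let G : V ⊗[ℂ] Module.Dual ℂ W →ₗ[ℂ] ℂ := f.toLin ∘ₗ CoEnd.genMul Q V W ∘ₗ
    CoEnd.insertMiddle V W α w ∘ₗ (TensorProduct.comm ℂ V (Module.Dual ℂ W)).toLinearMap
  have hG : ∀ (v : V) (δ : Module.Dual ℂ W), G (v ⊗ₜ δ) =
      TensorProduct.dualDistrib ℂ V W (α ⊗ₜ δ) (Q.R V W (f.J (V.tensor W) (v ⊗ₜ w))) :=
    fun v δ => by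
    rw [← dualDistrib_R_dual hC]
    exact f.toLin_mk (V.tensor W) (TensorProduct.dualDistrib ℂ V W (Q.R V.dual W.dual (α ⊗ₜ δ)))
      (v ⊗ₜ w)
  have hGR : ∀ t : V ⊗[ℂ] Module.Dual ℂ W, G (Q.R V W.dual t) =
      Module.Dual.eval ℂ W (f.J W w) (contrL (Module.Dual ℂ W) (α ∘ₗ f.J V) t) := fun t => by
    induction t using TensorProduct.induction_on with
    | zero => simp
    | add s t h1 h2 => simp only [map_add, h1, h2]
    | tmul v δ =>
      have h := f.map_mul (CoEnd.mk V (α ⊗ₜ v)) (CoEnd.mk W (δ ⊗ₜ w))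
      rw [CoEnd.mul₂_mk, CoEnd.middleBraid_tmul, f.toLin_mk, f.toLin_mk] at h
      refine Eq.trans ?_ (h.trans ?_)
      · rfl
      · simp
  have h1 := hGR (Q.Rinv V W.dual (v ⊗ₜ β))
  rw [R_Rinv, hG, dualDistrib_apply_eq] at h1
  rw [h1]
  refine (congrArg (Module.Dual.eval ℂ W (f.J W w))
    (Q.contrL_Rinv V W.dual (α ∘ₗ f.J V) v β)).trans ?_
  change β (W.rep.ρ (HopfAlgebra.antipode ℂ (Q.lm V (α ∘ₗ f.J V) v)) (f.J W w)) = _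
  rw [← rh_eq, ← contrL_R hC, LinearMap.lTensor_tmul]
  exact congrArg β (contrL_map LinearMap.id (f.J V) α (Q.R V W (v ⊗ₜ f.J W w))).symm

/-- The evaluation `V^* ⊗ V → 𝟙` intertwines `J_{V^* ⊗ V}` and `J_𝟙 = 1`, and by multiplicativity
`J_{V^* ⊗ V}` kills `V^* ⊗ ker J_V`. -/
theorem J_injective (hC : C.Separating) (V : C.Obj) : Function.Injective (f.J V) := by
  rw [← LinearMap.ker_eq_bot, LinearMap.ker_eq_bot']
  intro v hv
  refine dual_ext fun α => ?_
  have h1 := f.R_J_tensor hC V.dual V (α ⊗ₜ v)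
  rw [LinearMap.lTensor_tmul, hv, TensorProduct.tmul_zero, map_zero, map_zero] at h1
  have h2 : f.J (V.dual.tensor V) (α ⊗ₜ v) = 0 := by
    have h3 := congrArg (Q.Rinv V.dual V) h1
    rw [map_zero] at h3
    exact (Q.Rinv_R V.dual V _).symm.trans h3
  have h4 := f.J_natural (V := V.dual.tensor V) (W := Obj.one C) (URep.isHom_ev V.rep) (α ⊗ₜ v)
  rw [h2, J_one, map_zero] at h4
  exact (congrArg ULift.down h4).trans (map_zero α).symm

theorem isUnit_J (hC : C.Separating) (V : C.Obj) : IsUnit (f.J V) := by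
  rw [Module.End.isUnit_iff]
  exact ⟨f.J_injective hC V, LinearMap.surjective_of_injective (f.J_injective hC V)⟩

theorem braid_J_tensor (hC : C.Separating) (V W : C.Obj) (t : V ⊗[ℂ] W) :
    Q.braid V W (f.J (V.tensor W) t) =
      (f.J V).lTensor W (Q.braid V W ((f.J W).lTensor V t)) := by
  refine (congrArg (TensorProduct.comm ℂ V W) (f.R_J_tensor hC V W t)).trans ?_
  exact (TensorProduct.map_comm (R := ℂ) (LinearMap.id : W →ₗ[ℂ] W) (f.J V) _).symm

/-- The reflection equation, for two modules: `J_{V ⊗ W}` commutes with the braiding. -/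
theorem reflection (hC : C.Separating) (V W : C.Obj) (t : V ⊗[ℂ] W) :
    Q.braid W V ((f.J V).lTensor W (Q.braid V W ((f.J W).lTensor V t))) =
      (f.J W).lTensor V (Q.braid W V ((f.J V).lTensor W (Q.braid V W t))) := by
  rw [← f.braid_J_tensor hC V W, ← f.braid_J_tensor hC W V]
  exact congrArg _ (f.J_natural (isHom_braid Q V W) t).symm

/-! ### The coideal subalgebra -/

/-- The matrix coefficients of `R (1 ⊗ J_W) R₂₁`, elements of `U`. -/
def cc (f : Q.Character) (W : C.Obj) (α : Module.Dual ℂ W) (w : W) : U :=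
  ∑ k, Q.lp W α (f.J W (Module.finBasis ℂ W k)) * Q.rh W ((Module.finBasis ℂ W).coord k) w

theorem c_eq (W : C.Obj) (i l : Fin (Module.finrank ℂ W)) :
    f.c W i l = f.cc W ((Module.finBasis ℂ W).coord i) (Module.finBasis ℂ W l) := by
  have h1 : ∀ k, Q.lp W ((Module.finBasis ℂ W).coord i) (f.J W (Module.finBasis ℂ W k)) =
      ∑ j, (Module.finBasis ℂ W).coord j (f.J W (Module.finBasis ℂ W k)) •
        Q.lp W ((Module.finBasis ℂ W).coord i) (Module.finBasis ℂ W j) := fun k => by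
    conv_lhs => rw [← sum_coord_smul (f.J W (Module.finBasis ℂ W k))]
    rw [map_sum]
    simp only [map_smul]
  simp only [cc, h1, Finset.sum_mul, c, rh_eq, smul_mul_assoc]
  exact Finset.sum_comm

/-- The elements `c` span a left coideal. -/
theorem comul_cc (hC : C.Separating) (W : C.Obj) (α : Module.Dual ℂ W) (w : W) :
    Coalgebra.comul (R := ℂ) (f.cc W α w) = ∑ a, ∑ b,
      (Q.lp W α (Module.finBasis ℂ W a) * Q.rh W ((Module.finBasis ℂ W).coord b) w) ⊗ₜ[ℂ]
        f.cc W ((Module.finBasis ℂ W).coord a) (Module.finBasis ℂ W b) := by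
  simp only [cc, map_sum, Bialgebra.comul_mul, comul_lp hC, comul_rh hC,
    Finset.sum_mul_sum, Algebra.TensorProduct.tmul_mul_tmul, TensorProduct.tmul_sum]
  rw [Finset.sum_comm]
  exact Finset.sum_congr rfl fun a _ => Finset.sum_comm

theorem ρ_cc_apply (hC : C.Separating) (V W : C.Obj) (α : Module.Dual ℂ W) (w : W) (v : V) :
    V.rep.ρ (f.cc W α w) v =
      contrL V α (Q.braid V W ((f.J W).lTensor V (Q.braid W V (w ⊗ₜ v)))) := by
  have h : Q.braid W V (w ⊗ₜ v) = ∑ k, V.rep.ρ (Q.rh W ((Module.finBasis ℂ W).coord k) w) v ⊗ₜ[ℂ]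
      Module.finBasis ℂ W k := by
    simp only [← contrL_R hC]
    change TensorProduct.comm ℂ W V (Q.R W V (w ⊗ₜ v)) = _
    conv_lhs => rw [← sum_tmul_contrL (Q.R W V (w ⊗ₜ v))]
    rw [map_sum]
    rfl
  rw [h]
  simp only [map_sum, LinearMap.lTensor_tmul, cc, LinearMap.sum_apply, _root_.map_mul,
    Module.End.mul_apply, ← contrR_R]
  refine Finset.sum_congr rfl fun k _ => ?_
  exact (contrL_comm (M := V) α _).symm

/-- This is the reflection equation for `W` and `V`. -/
theorem J_ρ_cc (hC : C.Separating) (V W : C.Obj) (α : Module.Dual ℂ W) (w : W) (v : V) :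
    f.J V (V.rep.ρ (f.cc W α w) v) = V.rep.ρ (f.cc W α w) (f.J V v) := by
  rw [f.ρ_cc_apply hC, f.ρ_cc_apply hC]
  have h := f.reflection hC W V (w ⊗ₜ v)
  rw [LinearMap.lTensor_tmul] at h
  rw [h]
  exact (contrL_map (f.J V) LinearMap.id α _).symm

/-- The operator `1 ⊗ J_V` on `Y ⊗ V` commutes with the coideal subalgebra, since the right-hand
tensor factors of `Δ(c)` are again generators and commute with `J_V`. -/
theorem lTensor_J_commute (hC : C.Separating) (𝒲 : Set C.Obj) (Y : URep.{u, w} U) (V : C.Obj)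
    {b : U} (hb : b ∈ f.noumi 𝒲) :
    Commute ((f.J V).lTensor Y : Module.End ℂ (Y ⊗[ℂ] V)) ((Y.tensor V.rep).ρ b) := by
  induction hb using Algebra.adjoin_induction with
  | mem c hc =>
    obtain ⟨W, -, i, l, rfl⟩ := hc
    rw [f.c_eq]
    refine TensorProduct.ext' fun y v => ?_
    rw [URep.tensor_apply, f.comul_cc hC]
    simp only [Module.End.mul_apply, map_sum, LinearMap.sum_apply, URep.act₂_tmul,
      TensorProduct.map_tmul, LinearMap.lTensor_tmul, f.J_ρ_cc hC]
  | algebraMap z =>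
    rw [AlgHom.commutes]
    exact Algebra.commutes' _ _ |>.symm
  | add x y _ _ hx hy =>
    rw [map_add]
    exact hx.add_right hy
  | mul x y _ _ hx hy =>
    rw [_root_.map_mul]
    exact hx.mul_right hy

end Character

end QuasiTriangular

/-! ### The left-handed reflection equation -/

namespace QuasiTriangular

variable {U : Type u} [Ring U] [HopfAlgebra ℂ U] [BijectiveAntipode U] {C : TensorSubcat U}
  {Q : QuasiTriangular C}

namespace Character

variable (g : Q.Character)

theorem toLin_mk_ldual (V : C.Obj) (α : Module.Dual ℂ V) (v : V) :
    g.toLin (CoEnd.mk V.ldual (Module.Dual.eval ℂ V v ⊗ₜ α)) = α (g.J' V v) := by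
  simp only [J', LinearMap.sum_apply, LinearMap.smulRight_apply, map_sum, map_smul,
    LinearMap.comp_apply, TensorProduct.mk_apply, LinearMap.flip_apply]
  conv_lhs => rw [← sum_smul_coord α]
  simp only [TensorProduct.tmul_sum, TensorProduct.tmul_smul, map_sum, map_smul, smul_eq_mul,
    mul_comm]

/-- `J'_V` is the transpose of the operator `J` of `^*V`, so that the left-handed reflection
equation for `V` is the transpose of the right-handed one for `^*V`. -/
theorem J_ldual (V : C.Obj) (α : Module.Dual ℂ V) : g.J V.ldual α = α ∘ₗ g.J' V := by
  refine LinearMap.ext fun v => ?_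
  rw [LinearMap.comp_apply, ← toLin_mk_ldual]
  exact (g.toLin_mk V.ldual (Module.Dual.eval ℂ V v) α).symm

theorem isUnit_J' (hC : C.Separating) (V : C.Obj) : IsUnit (g.J' V) := by
  have hinj : Function.Injective (g.J' V) := by
    rw [← LinearMap.ker_eq_bot, LinearMap.ker_eq_bot']
    intro v hv
    refine dual_ext fun β => ?_
    obtain ⟨α, hα⟩ := LinearMap.surjective_of_injective (g.J_injective hC V.ldual) β
    rw [← hα, J_ldual, LinearMap.comp_apply, hv, map_zero, map_zero]
  rw [Module.End.isUnit_iff]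
  exact ⟨hinj, LinearMap.surjective_of_injective hinj⟩

theorem dualDistrib_lTensor_J_ldual (V : C.Obj) (z : Module.Dual ℂ V ⊗[ℂ] Module.Dual ℂ V)
    (t : V ⊗[ℂ] V) :
    TensorProduct.dualDistrib ℂ V V ((g.J V.ldual).lTensor (Module.Dual ℂ V) z) t =
      TensorProduct.dualDistrib ℂ V V z ((g.J' V).lTensor V t) := by
  induction z using TensorProduct.induction_on with
  | zero => simp
  | add s t h1 h2 => simp only [map_add, LinearMap.add_apply, h1, h2]
  | tmul α β =>
    induction t using TensorProduct.induction_on with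
    | zero => simp
    | add s t h1 h2 => simp only [map_add, h1, h2]
    | tmul v w => rw [LinearMap.lTensor_tmul, J_ldual]; rfl

theorem dualDistrib_braid_ldual (hC : C.Separating) (V : C.Obj)
    (z : Module.Dual ℂ V ⊗[ℂ] Module.Dual ℂ V) (t : V ⊗[ℂ] V) :
    TensorProduct.dualDistrib ℂ V V (Q.braid V.ldual V.ldual z) t =
      TensorProduct.dualDistrib ℂ V V z
        (TensorProduct.comm ℂ V V (Q.braid V V (TensorProduct.comm ℂ V V t))) := by
  have h : ∀ (z : Module.Dual ℂ V ⊗[ℂ] Module.Dual ℂ V) (t : V ⊗[ℂ] V),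
      TensorProduct.dualDistrib ℂ V V (TensorProduct.comm ℂ _ _ z) t =
      TensorProduct.dualDistrib ℂ V V z (TensorProduct.comm ℂ V V t) := fun z t => by
    induction z using TensorProduct.induction_on with
    | zero => simp
    | add s t h1 h2 => simp only [map_add, LinearMap.add_apply, h1, h2]
    | tmul α β =>
      rw [TensorProduct.comm_tmul, ← dualDistrib_comm]
  refine (h (Q.R V.ldual V.ldual z) t).trans ?_
  rw [dualDistrib_R_ldual hC]
  change _ = TensorProduct.dualDistrib ℂ V V z (TensorProduct.comm ℂ V V
    (TensorProduct.comm ℂ V V (Q.R V V _)))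
  rw [TensorProduct.comm_comm]

/-- The left-handed reflection equation. -/
theorem left_reflection (hC : C.Separating) (V : C.Obj) :
    (Q.braid V V : Module.End ℂ (V ⊗[ℂ] V)) * (g.J' V).rTensor V * Q.braid V V *
        (g.J' V).rTensor V =
      (g.J' V).rTensor V * (Q.braid V V : Module.End ℂ (V ⊗[ℂ] V)) * (g.J' V).rTensor V *
        Q.braid V V := by
  have hs : ∀ t : V ⊗[ℂ] V, (g.J' V).lTensor V (TensorProduct.comm ℂ V V t) =
      TensorProduct.comm ℂ V V ((g.J' V).rTensor V t) := fun t =>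
    TensorProduct.map_comm (LinearMap.id : V →ₗ[ℂ] V) (g.J' V) t
  refine LinearMap.ext fun t => contrL_ext fun α => dual_ext fun β => ?_
  have h := congrArg (fun z => TensorProduct.dualDistrib ℂ V V z (TensorProduct.comm ℂ V V t))
    (g.reflection hC V.ldual V.ldual (β ⊗ₜ α))
  simp only at h
  repeat first
    | rw [dualDistrib_lTensor_J_ldual] at h
    | rw [dualDistrib_braid_ldual hC] at h
  simp only [hs, TensorProduct.comm_comm] at h
  rw [dualDistrib_comm, dualDistrib_comm, dualDistrib_apply_eq, dualDistrib_apply_eq] at h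
  exact h.symm

end Character

end QuasiTriangular

/-! ### The module structure of a non-degenerate `D_U`-module -/

namespace NonDegDMod

variable {U : Type u} [Ring U] [HopfAlgebra ℂ U] [BijectiveAntipode U] {C : TensorSubcat U}
  {Q : QuasiTriangular C} (M : NonDegDMod.{u, v} Q)

/-- The action of `A` on `M`. -/
def actA : CoEnd C →ₗ[ℂ] Module.End ℂ M := M.act.toLinearMap ∘ₗ DU.inclA Q

theorem actA_mul (a b : CoEnd C) : M.actA (CoEnd.mul Q a b) = M.actA a * M.actA b := by
  change M.act (DU.inclA Q (CoEnd.mul Q a b)) = M.act (DU.inclA Q a) * M.act (DU.inclA Q b)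
  rw [← map_mul]
  refine congrArg M.act ?_
  have h := RingQuot.mkAlgHom_rel ℂ (DURel.mulA (Q := Q) a b)
  rw [map_mul] at h
  exact h.symm

theorem actA_one : M.actA (CoEnd.one C) = 1 := by
  change M.act (DU.inclA Q (CoEnd.one C)) = 1
  have h := RingQuot.mkAlgHom_rel ℂ (DURel.oneA (Q := Q))
  rw [map_one] at h
  rw [← map_one M.act]
  exact congrArg M.act h

theorem ρ_mul_actA {x : U} {ι : Type*} (r : Coalgebra.Repr ℂ x ι) (a : CoEnd C) :
    M.snd.ρ x * M.actA a =
      ∑ i ∈ r.index, M.actA (CoEnd.actRight (r.left i) a) * M.snd.ρ (r.right i) := by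
  refine (M.act_linear x a).trans ?_
  rw [← r.eq, map_sum]
  rfl

/-- The elements `∑ [η ⊠ s x] s'` for `R⁻¹ = ∑ s ⊗ s'`, acting on `M`. They are the matrix
coefficients, in `x ∈ X` and `η ∈ X^*`, of an operator on `M ⊗ X`. -/
def theta (X : C.Obj) : Module.Dual ℂ X →ₗ[ℂ] X →ₗ[ℂ] Module.End ℂ M :=
  ∑ i, LinearMap.compl₁₂ (LinearMap.mul ℂ (Module.End ℂ M))
    (M.actA ∘ₗ CoEnd.mk X ∘ₗ
      (TensorProduct.mk ℂ (Module.Dual ℂ X) X).flip (Module.finBasis ℂ X i))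
    (M.snd.ρ.toLinearMap ∘ₗ Q.lm X ((Module.finBasis ℂ X).coord i))

theorem theta_apply (X : C.Obj) (η : Module.Dual ℂ X) (x : X) :
    M.theta X η x = ∑ i, M.actA (CoEnd.mk X (η ⊗ₜ Module.finBasis ℂ X i)) *
      M.snd.ρ (Q.lm X ((Module.finBasis ℂ X).coord i) x) := by
  simp only [theta, LinearMap.sum_apply, LinearMap.compl₁₂_apply]
  rfl

variable {M}

/-- The family `theta` is dinatural. -/
theorem theta_natural (hC : C.Separating) {X Y : C.Obj} {φ : X →ₗ[ℂ] Y}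
    (hφ : URep.IsHom X.rep Y.rep φ) (η : Module.Dual ℂ Y) (x : X) :
    M.theta Y η (φ x) = M.theta X (η ∘ₗ φ) x := by
  rw [theta_apply, theta_apply]
  simp only [QuasiTriangular.lm_natural hC hφ, CoEnd.mk_dinatural hφ]
  have h := sum_basis_comp φ (LinearMap.compl₁₂ (LinearMap.mul ℂ (Module.End ℂ M))
    (M.actA ∘ₗ CoEnd.mk Y ∘ₗ TensorProduct.mk ℂ (Module.Dual ℂ Y) Y η)
    (M.snd.ρ.toLinearMap ∘ₗ (Q.lm X).flip x))
  exact h.symm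

theorem mul_mk_mk (hC : C.Separating) (X Y : C.Obj) (η : Module.Dual ℂ X) (ζ : Module.Dual ℂ Y)
    (x : X) (y : Y) :
    CoEnd.mul Q (CoEnd.mk X (η ⊗ₜ x)) (CoEnd.mk Y (ζ ⊗ₜ y)) =
      CoEnd.mk (Y.tensor X) (TensorProduct.dualDistrib ℂ Y X (ζ ⊗ₜ η) ⊗ₜ
        Q.braid X Y (x ⊗ₜ y)) := by
  rw [CoEnd.mul_mk]
  have h : TensorProduct.dualDistrib ℂ X Y (Q.R X.dual Y.dual (η ⊗ₜ ζ)) =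
      TensorProduct.dualDistrib ℂ Y X (ζ ⊗ₜ η) ∘ₗ Q.braid X Y := by
    refine LinearMap.ext fun t => ?_
    rw [QuasiTriangular.dualDistrib_R_dual hC]
    exact (dualDistrib_comm η ζ (Q.R X Y t)).symm
  change CoEnd.mk (X.tensor Y) (TensorProduct.dualDistrib ℂ X Y (Q.R X.dual Y.dual (η ⊗ₜ ζ)) ⊗ₜ
    (x ⊗ₜ y)) = _
  rw [h]
  exact CoEnd.mk_dinatural (V := X.tensor Y) (W := Y.tensor X) (Q.isHom_braid X Y) _ _

/-- `theta` is multiplicative: moving `s'` past `[ζ ⊠ y]` produces the inverse of the braiding which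
enters the product of `Ã`. -/
theorem theta_mul (hC : C.Separating) (X Y : C.Obj) (η : Module.Dual ℂ X) (ζ : Module.Dual ℂ Y)
    (x : X) (y : Y) :
    M.theta X η x * M.theta Y ζ y =
      M.theta (Y.tensor X) (TensorProduct.dualDistrib ℂ Y X (ζ ⊗ₜ η)) (y ⊗ₜ x) := by
  have h1 : ∀ i j, M.actA (CoEnd.mk X (η ⊗ₜ Module.finBasis ℂ X i)) *
      M.snd.ρ (Q.lm X ((Module.finBasis ℂ X).coord i) x) *
        (M.actA (CoEnd.mk Y (ζ ⊗ₜ Module.finBasis ℂ Y j)) *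
          M.snd.ρ (Q.lm Y ((Module.finBasis ℂ Y).coord j) y)) =
      ∑ k, M.actA (CoEnd.mk (Y.tensor X) (TensorProduct.dualDistrib ℂ Y X (ζ ⊗ₜ η) ⊗ₜ
        Q.braid X Y (Module.finBasis ℂ X i ⊗ₜ Y.rep.ρ (Q.lm X ((Module.finBasis ℂ X).coord i)
          (Module.finBasis ℂ X k)) (Module.finBasis ℂ Y j)))) *
        M.snd.ρ (Q.lm X ((Module.finBasis ℂ X).coord k) x *
          Q.lm Y ((Module.finBasis ℂ Y).coord j) y) := fun i j => by
    rw [mul_assoc, ← mul_assoc (M.snd.ρ _),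
      M.ρ_mul_actA ⟨Finset.univ, _, _, (QuasiTriangular.comul_lm hC X _ x).symm⟩,
      Finset.sum_mul, Finset.mul_sum]
    refine Finset.sum_congr rfl fun k _ => ?_
    rw [CoEnd.actRight_mk, map_mul, ← mul_mk_mk hC, actA_mul]
    simp only [mul_assoc]
  have h2 : ∀ j k, ∑ i, Q.braid X Y (Module.finBasis ℂ X i ⊗ₜ
      Y.rep.ρ (Q.lm X ((Module.finBasis ℂ X).coord i) (Module.finBasis ℂ X k))
        (Module.finBasis ℂ Y j)) = Module.finBasis ℂ Y j ⊗ₜ[ℂ] Module.finBasis ℂ X k :=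
    fun j k => by
    rw [← map_sum, ← Q.Rinv_tmul]
    change TensorProduct.comm ℂ X Y (Q.R X Y (Q.Rinv X Y _)) = _
    rw [Q.R_Rinv, TensorProduct.comm_tmul]
  rw [theta_apply, theta_apply, Finset.sum_mul_sum]
  simp only [h1]
  have h3 := sum_basis_tensor (V := Y) (W := X)
    ((LinearMap.compl₁₂ (LinearMap.mul ℂ (Module.End ℂ M))
      (M.actA ∘ₗ CoEnd.mk (Y.tensor X) ∘ₗ TensorProduct.mk ℂ (Module.Dual ℂ (Y ⊗[ℂ] X)) (Y ⊗[ℂ] X)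
        (TensorProduct.dualDistrib ℂ Y X (ζ ⊗ₜ η)))
      (M.snd.ρ.toLinearMap ∘ₗ (Q.lm (Y.tensor X)).flip (y ⊗ₜ x))))
  refine Eq.trans ?_ (h3.symm.trans (M.theta_apply (Y.tensor X) _ _).symm)
  rw [Finset.sum_comm]
  refine Finset.sum_congr rfl fun j _ => ?_
  rw [Finset.sum_comm]
  refine Finset.sum_congr rfl fun k _ => ?_
  rw [← Finset.sum_mul, ← map_sum, ← map_sum, ← TensorProduct.tmul_sum, h2]
  simp only [LinearMap.compl₁₂_apply, LinearMap.comp_apply, LinearMap.flip_apply,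
    AlgHom.toLinearMap_apply]
  rw [QuasiTriangular.lm_tensor hC]
  rfl

end NonDegDMod

/-! ### The trivial module -/

section UnitObject

variable {U : Type u} [Ring U] [HopfAlgebra ℂ U] [BijectiveAntipode U] {C : TensorSubcat U}
  {Q : QuasiTriangular C}

theorem down_comp_evr (V : Type u) [AddCommGroup V] [Module ℂ V] [FiniteDimensional ℂ V] :
    (ULift.moduleEquiv.toLinearMap : ULift.{u} ℂ →ₗ[ℂ] ℂ) ∘ₗ URep.evr.{u} V =
      ∑ i, TensorProduct.dualDistrib ℂ V (Module.Dual ℂ V) ((Module.finBasis ℂ V).coord i ⊗ₜ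
        Module.Dual.eval ℂ V (Module.finBasis ℂ V i)) := by
  refine TensorProduct.ext' fun v α => ?_
  rw [LinearMap.comp_apply, URep.evr_tmul, LinearMap.sum_apply]
  change α v = _
  conv_lhs => rw [← sum_coord_smul v]
  simp only [map_sum, map_smul, smul_eq_mul, TensorProduct.dualDistrib_apply,
    Module.Dual.eval_apply]

theorem ulift_eq_smul (z : ULift.{u} ℂ) : z = z.down • (ULift.up 1 : ULift.{u} ℂ) :=
  ULift.ext _ _ (by simp)

theorem dual_ulift_eq_smul (η : Module.Dual ℂ (ULift.{u} ℂ)) :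
    η = η (ULift.up 1) • (ULift.moduleEquiv.toLinearMap : ULift.{u} ℂ →ₗ[ℂ] ℂ) := by
  refine LinearMap.ext fun z => ?_
  conv_lhs => rw [ulift_eq_smul z]
  rw [map_smul, LinearMap.smul_apply, smul_eq_mul, smul_eq_mul, mul_comm]
  rfl

/-- The R-matrix is trivial on `𝟙`. This follows from naturality with respect to the evaluation
`𝟙 ⊗ ^*𝟙 → 𝟙`. -/
theorem QuasiTriangular.lm_one (hC : C.Separating) (η : Module.Dual ℂ (Obj.one C))
    (z : Obj.one C) : Q.lm (Obj.one C) η z = algebraMap ℂ U (η z) := by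
  have h1 : Q.lm (Obj.one C) (ULift.moduleEquiv.toLinearMap : ULift.{u} ℂ →ₗ[ℂ] ℂ) (ULift.up 1) =
      1 := by
    have h := lm_natural (Q := Q) hC (V := (Obj.one C).tensor (Obj.one C).ldual) (W := Obj.one C)
      (URep.isHom_evr (Obj.one C).rep) (ULift.moduleEquiv.toLinearMap : ULift.{u} ℂ →ₗ[ℂ] ℂ)
      ((ULift.up 1 : ULift.{u} ℂ) ⊗ₜ (ULift.moduleEquiv.toLinearMap : ULift.{u} ℂ →ₗ[ℂ] ℂ))
    refine h.trans ?_
    rw [down_comp_evr, map_sum, LinearMap.sum_apply]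
    have h2 := sum_rh_mul_lm (Q := Q) hC (Obj.one C)
      (ULift.moduleEquiv.toLinearMap : ULift.{u} ℂ →ₗ[ℂ] ℂ) (ULift.up 1)
    refine Eq.trans (Finset.sum_congr rfl fun i _ => ?_) (h2.trans (map_one _))
    rw [← lm_ldual hC]
    exact lm_tensor hC (Obj.one C) (Obj.one C).ldual _ _ _ _
  rw [dual_ulift_eq_smul η, ulift_eq_smul z]
  simp only [map_smul, LinearMap.smul_apply, h1]
  rw [Algebra.algebraMap_eq_smul_one, smul_smul, smul_smul]
  simp [mul_comm]

end UnitObject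

/-! ### The gauge transformation -/

namespace NonDegDMod

variable {U : Type u} [Ring U] [HopfAlgebra ℂ U] [BijectiveAntipode U] {C : TensorSubcat U}
  {Q : QuasiTriangular C} {M : NonDegDMod.{u, v} Q}

theorem theta_one (hC : C.Separating) (η : Module.Dual ℂ (Obj.one C)) (z : Obj.one C) :
    M.theta (Obj.one C) η z = η z • (1 : Module.End ℂ M) := by
  rw [theta_apply]
  simp only [QuasiTriangular.lm_one hC, AlgHom.commutes]
  have h : ∀ i, M.actA (CoEnd.mk (Obj.one C) (η ⊗ₜ Module.finBasis ℂ (Obj.one C) i)) *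
      algebraMap ℂ (Module.End ℂ M) ((Module.finBasis ℂ (Obj.one C)).coord i z) =
      M.actA (CoEnd.mk (Obj.one C) (η ⊗ₜ ((Module.finBasis ℂ (Obj.one C)).coord i z •
        Module.finBasis ℂ (Obj.one C) i))) := fun i => by
    rw [Algebra.algebraMap_eq_smul_one, mul_smul_comm, mul_one, TensorProduct.tmul_smul,
      map_smul, map_smul]
  simp only [h]
  rw [← map_sum, ← map_sum, ← TensorProduct.tmul_sum, sum_coord_smul, ← M.actA_one]
  conv_lhs => rw [dual_ulift_eq_smul η, ulift_eq_smul z]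
  rw [← TensorProduct.smul_tmul', TensorProduct.tmul_smul, map_smul, map_smul, map_smul, map_smul,
    smul_smul]
  congr 1
  conv_rhs => rw [ulift_eq_smul z, map_smul, smul_eq_mul, mul_comm]

/-- The matrix coefficients of the inverse of the matrix `theta X`; they are coefficients of
`theta` for the dual `^*X`, since `theta` is multiplicative and dinatural. -/
def thetaInv (M : NonDegDMod.{u, v} Q) (X : C.Obj) :
    Module.Dual ℂ X →ₗ[ℂ] X →ₗ[ℂ] Module.End ℂ M :=
  LinearMap.flip (M.theta X.ldual ∘ₗ Module.Dual.eval ℂ X)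

theorem thetaInv_apply (X : C.Obj) (α : Module.Dual ℂ X) (x : X) :
    M.thetaInv X α x = M.theta X.ldual (Module.Dual.eval ℂ X x) α := rfl

theorem sum_thetaInv_mul_theta (hC : C.Separating) (X : C.Obj) (α : Module.Dual ℂ X) (x : X) :
    ∑ i, M.thetaInv X α (Module.finBasis ℂ X i) * M.theta X ((Module.finBasis ℂ X).coord i) x =
      α x • (1 : Module.End ℂ M) := by
  have h := theta_natural (M := M) hC (X := X.tensor X.ldual) (Y := Obj.one C)
    (URep.isHom_evr X.rep) (ULift.moduleEquiv.toLinearMap : ULift.{u} ℂ →ₗ[ℂ] ℂ) (x ⊗ₜ α)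
  rw [theta_one hC, down_comp_evr, map_sum, LinearMap.sum_apply] at h
  refine Eq.trans (Finset.sum_congr rfl fun i _ => ?_) h.symm
  rw [thetaInv_apply, theta_mul hC]

theorem sum_theta_mul_thetaInv (hC : C.Separating) (X : C.Obj) (α : Module.Dual ℂ X) (x : X) :
    ∑ i, M.theta X α (Module.finBasis ℂ X i) * M.thetaInv X ((Module.finBasis ℂ X).coord i) x =
      α x • (1 : Module.End ℂ M) := by
  have h := theta_natural (M := M) hC (X := Obj.one C) (Y := X.ldual.tensor X)
    (URep.isHom_coev X.rep) (TensorProduct.dualDistrib ℂ (Module.Dual ℂ X) X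
      (Module.Dual.eval ℂ X x ⊗ₜ α)) (ULift.up 1)
  have hc : URep.coev X (ULift.up.{u} 1) =
      ∑ i, (Module.finBasis ℂ X).coord i ⊗ₜ[ℂ] Module.finBasis ℂ X i :=
    one_smul ℂ _
  rw [theta_one hC, LinearMap.comp_apply, hc, map_sum, map_sum] at h
  have h2 : ∑ i, TensorProduct.dualDistrib ℂ (Module.Dual ℂ X) X (Module.Dual.eval ℂ X x ⊗ₜ α)
      ((Module.finBasis ℂ X).coord i ⊗ₜ[ℂ] Module.finBasis ℂ X i) = α x := by
    conv_rhs => rw [← sum_coord_smul x]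
    simp only [map_sum, map_smul, smul_eq_mul, TensorProduct.dualDistrib_apply,
      Module.Dual.eval_apply]
  rw [h2] at h
  refine Eq.trans (Finset.sum_congr rfl fun i _ => ?_) h
  rw [thetaInv_apply, theta_mul hC]

variable (M) in
/-- The operator on `M ⊗ X` with the matrix coefficients `theta X`. -/
def gauge (X : C.Obj) : Module.End ℂ (M ⊗[ℂ] X) := coeffOp (M.theta X)

variable (M) in
/-- The operator on `M ⊗ X` inverse to `gauge`. -/
def gaugeInv (X : C.Obj) : Module.End ℂ (M ⊗[ℂ] X) := coeffOp (M.thetaInv X)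

theorem gaugeInv_mul_gauge (hC : C.Separating) (X : C.Obj) : M.gaugeInv X * M.gauge X = 1 :=
  coeffOp_mul_eq_one (sum_thetaInv_mul_theta hC X)

theorem gauge_mul_gaugeInv (hC : C.Separating) (X : C.Obj) : M.gauge X * M.gaugeInv X = 1 :=
  coeffOp_mul_eq_one (sum_theta_mul_thetaInv hC X)

theorem isUnit_gauge (hC : C.Separating) (X : C.Obj) : IsUnit (M.gauge X) :=
  ⟨⟨_, _, gauge_mul_gaugeInv hC X, gaugeInv_mul_gauge hC X⟩, rfl⟩

theorem gauge_natural (hC : C.Separating) {X Y : C.Obj} {φ : X →ₗ[ℂ] Y}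
    (hφ : URep.IsHom X.rep Y.rep φ) (t : M ⊗[ℂ] X) :
    M.gauge Y (φ.lTensor M t) = φ.lTensor M (M.gauge X t) := by
  induction t using TensorProduct.induction_on with
  | zero => simp
  | add s t h1 h2 => simp only [map_add, h1, h2]
  | tmul m x =>
    refine contrR_ext fun α => ?_
    rw [LinearMap.lTensor_tmul, contrR_lTensor]
    exact (contrR_coeffOp _ _ _ _).trans ((LinearMap.congr_fun (theta_natural hC hφ α x) m).trans
      (contrR_coeffOp _ _ _ _).symm)

/-- The operators of the second copy of `U` can be moved through `theta`: this combines the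
linearity of the action map of `A` with the intertwining property of `R⁻¹`. -/
theorem sum_theta_mul_ρ (hC : C.Separating) (X : C.Obj) {x : U} {ι : Type*}
    (r : Coalgebra.Repr ℂ x ι) (α : Module.Dual ℂ X) (v : X) :
    ∑ i ∈ r.index, M.theta X α (X.rep.ρ (r.right i) v) * M.snd.ρ (r.left i) =
      M.snd.ρ x * M.theta X α v := by
  simp only [theta_apply, Finset.mul_sum, Finset.sum_mul]
  rw [Finset.sum_comm]
  have h1 : ∀ k, ∑ i ∈ r.index, M.actA (CoEnd.mk X (α ⊗ₜ Module.finBasis ℂ X k)) *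
      M.snd.ρ (Q.lm X ((Module.finBasis ℂ X).coord k) (X.rep.ρ (r.right i) v)) *
        M.snd.ρ (r.left i) = ∑ i ∈ r.index, M.actA (CoEnd.mk X (α ⊗ₜ Module.finBasis ℂ X k)) *
      M.snd.ρ (r.right i * Q.lm X ((Module.finBasis ℂ X).coord k ∘ₗ X.rep.ρ (r.left i)) v) :=
    fun k => by
    rw [← Finset.mul_sum, ← map_sum, ← QuasiTriangular.lm_hom hC, map_sum, Finset.mul_sum]
    exact Finset.sum_congr rfl fun i _ => by rw [map_mul, mul_assoc]
  simp only [h1]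
  rw [Finset.sum_comm]
  have h2 : ∀ i, ∑ k, M.actA (CoEnd.mk X (α ⊗ₜ Module.finBasis ℂ X k)) *
      M.snd.ρ (r.right i * Q.lm X ((Module.finBasis ℂ X).coord k ∘ₗ X.rep.ρ (r.left i)) v) =
      ∑ k, M.actA (CoEnd.mk X (α ⊗ₜ X.rep.ρ (r.left i) (Module.finBasis ℂ X k))) *
      M.snd.ρ (r.right i * Q.lm X ((Module.finBasis ℂ X).coord k) v) := fun i =>
    (sum_basis_comp (X.rep.ρ (r.left i)) (LinearMap.compl₁₂ (LinearMap.mul ℂ (Module.End ℂ M))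
      (M.actA ∘ₗ CoEnd.mk X ∘ₗ TensorProduct.mk ℂ (Module.Dual ℂ X) X α)
      (M.snd.ρ.toLinearMap ∘ₗ LinearMap.mulLeft ℂ (r.right i) ∘ₗ (Q.lm X).flip v))).symm
  simp only [h2]
  rw [Finset.sum_comm]
  refine Finset.sum_congr rfl fun k _ => ?_
  rw [← mul_assoc, M.ρ_mul_actA r, Finset.sum_mul]
  exact Finset.sum_congr rfl fun i _ => by rw [CoEnd.actRight_mk, map_mul, mul_assoc]

/-- The gauge transformation turns the diagonal action into the action on `M` alone. -/
theorem gauge_ρ (hC : C.Separating) (X : C.Obj) (x : U) (t : M ⊗[ℂ] X) :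
    M.gauge X ((M.snd.tensor X.rep).ρ x t) = (M.snd.ρ x).rTensor X (M.gauge X t) := by
  induction t using TensorProduct.induction_on with
  | zero => simp
  | add s t h1 h2 => simp only [map_add, h1, h2]
  | tmul m v =>
    refine contrR_ext fun α => ?_
    let r := Coalgebra.Repr.arbitrary ℂ x
    rw [URep.tensor_ρ_tmul _ _ r, map_sum, map_sum, contrR_rTensor]
    have h := LinearMap.congr_fun (sum_theta_mul_ρ (M := M) hC X r α v) m
    rw [LinearMap.sum_apply] at h
    simp only [gauge, contrR_coeffOp]
    exact h

end NonDegDMod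

/-! ### The braidings with an arbitrary module -/

namespace QuasiTriangular

variable {U : Type u} [Ring U] [HopfAlgebra ℂ U] [BijectiveAntipode U] {C : TensorSubcat U}
  (Q : QuasiTriangular C)

theorem braidVMInv_tmul (V : C.Obj) (M : URep.{u, w} U) (m : M) (v : V) :
    Q.braidVMInv V M (m ⊗ₜ v) = ∑ i, Module.finBasis ℂ V i ⊗ₜ[ℂ]
      M.ρ (Q.lm V ((Module.finBasis ℂ V).coord i) v) m := by
  conv_lhs => rw [← sum_tmul_contrL (Q.braidVMInv V M (m ⊗ₜ v))]
  exact Finset.sum_congr rfl fun i _ => congrArg _ (contrL_leftCoeff M _ _ v m)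

theorem contrR_braidVM (V : C.Obj) (M : URep.{u, w} U) (α : Module.Dual ℂ V) (m : M) (v : V) :
    contrR M α (Q.braidVM V M (v ⊗ₜ m)) = M.ρ (Q.rh V α v) m :=
  (contrR_comm _ _).trans (contrL_leftCoeff M _ α v m)

theorem braidMV_tmul (V : C.Obj) (M : URep.{u, w} U) (m : M) (v : V) :
    Q.braidMV M V (m ⊗ₜ v) = ∑ i, Module.finBasis ℂ V i ⊗ₜ[ℂ]
      M.ρ (Q.lp V ((Module.finBasis ℂ V).coord i) v) m := by
  conv_lhs => rw [← sum_tmul_contrL (Q.braidMV M V (m ⊗ₜ v))]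
  exact Finset.sum_congr rfl fun i _ => congrArg _
    ((contrL_comm _ _).trans (contrR_rightCoeff M _ _ v m))

/-- The double braiding `R₂₁ R` on `M ⊗ V`. -/
def double (V : C.Obj) (M : URep.{u, w} U) : Module.End ℂ (M ⊗[ℂ] V) :=
  Q.braidVM V M ∘ₗ Q.braidMV M V

/-- The matrix coefficients of the double braiding, elements of `U`. -/
def dd (V : C.Obj) (α : Module.Dual ℂ V) (v : V) : U :=
  ∑ i, Q.rh V α (Module.finBasis ℂ V i) * Q.lp V ((Module.finBasis ℂ V).coord i) v

theorem contrR_double (V : C.Obj) (M : URep.{u, w} U) (α : Module.Dual ℂ V) (m : M) (v : V) :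
    contrR M α (Q.double V M (m ⊗ₜ v)) = M.ρ (Q.dd V α v) m := by
  rw [double, LinearMap.comp_apply, braidMV_tmul, map_sum, map_sum]
  simp only [contrR_braidVM, dd, map_sum, map_mul, LinearMap.sum_apply, Module.End.mul_apply]

theorem double_tmul (V : C.Obj) (M : URep.{u, w} U) (m : M) (v : V) :
    Q.double V M (m ⊗ₜ v) = ∑ i, M.ρ (Q.dd V ((Module.finBasis ℂ V).coord i) v) m ⊗ₜ[ℂ]
      Module.finBasis ℂ V i := by
  simp only [← contrR_double]
  exact (sum_contrR_tmul _).symm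

variable {Q}

theorem isUnit_double (hC : C.Separating) (V : C.Obj) (M : URep.{u, w} U) :
    IsUnit (Q.double V M) := by
  -- `R` and `R₂₁` are invertible, as matrices over `U`
  have h1 : Q.braidVM V M ∘ₗ Q.braidVMInv V M = LinearMap.id := by
    refine TensorProduct.ext' fun m v => contrR_ext fun α => ?_
    rw [LinearMap.comp_apply, braidVMInv_tmul, map_sum, map_sum, LinearMap.id_apply, contrR_tmul]
    simp only [contrR_braidVM]
    have h := congrArg (fun x => M.ρ x m) (sum_rh_mul_lm (Q := Q) hC V α v)
    simpa only [map_sum, map_mul, LinearMap.sum_apply, Module.End.mul_apply, AlgHom.commutes,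
      Module.algebraMap_end_apply] using h
  have h2 : Q.braidVMInv V M ∘ₗ Q.braidVM V M = LinearMap.id := by
    refine TensorProduct.ext' fun v m => contrL_ext fun α => ?_
    rw [LinearMap.comp_apply, ← sum_contrR_tmul (Q.braidVM V M (v ⊗ₜ m)), map_sum, map_sum,
      LinearMap.id_apply, contrL_tmul]
    simp only [contrR_braidVM]
    have h := congrArg (fun x => M.ρ x m) (sum_lm_mul_rh (Q := Q) hC V α v)
    simp only [map_sum, map_mul, LinearMap.sum_apply, Module.End.mul_apply, AlgHom.commutes,
      Module.algebraMap_end_apply] at h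
    rw [← h]
    exact Finset.sum_congr rfl fun i _ => contrL_leftCoeff M _ α _ _
  let F : Module.Dual ℂ V →ₗ[ℂ] V →ₗ[ℂ] Module.End ℂ M := (Q.lp V).compr₂ M.ρ.toLinearMap
  let G : Module.Dual ℂ V →ₗ[ℂ] V →ₗ[ℂ] Module.End ℂ M :=
    (Q.lp V).compr₂ (M.ρ.toLinearMap ∘ₗ HopfAlgebra.antipode ℂ)
  have h3 : coeffOp F * coeffOp G = 1 := coeffOp_mul_eq_one fun α v => by
    have h := congrArg M.ρ (sum_lp_mul_antipode (Q := Q) hC V α v)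
    rw [AlgHom.commutes, Algebra.algebraMap_eq_smul_one, map_sum] at h
    simp only [map_mul] at h
    exact h
  have h4 : coeffOp G * coeffOp F = 1 := coeffOp_mul_eq_one fun α v => by
    have h := congrArg M.ρ (sum_antipode_mul_lp (Q := Q) hC V α v)
    rw [AlgHom.commutes, Algebra.algebraMap_eq_smul_one, map_sum] at h
    simp only [map_mul] at h
    exact h
  have h5 : Q.braidMV M V = (TensorProduct.comm ℂ M V).toLinearMap ∘ₗ coeffOp F := by
    refine TensorProduct.ext' fun m v => ?_
    rw [braidMV_tmul, LinearMap.comp_apply, coeffOp_tmul, map_sum]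
    rfl
  have e1 : ∀ t, Q.braidVM V M (Q.braidVMInv V M t) = t := LinearMap.congr_fun h1
  have e2 : ∀ t, Q.braidVMInv V M (Q.braidVM V M t) = t := LinearMap.congr_fun h2
  have e3 : ∀ t, coeffOp F (coeffOp G t) = t := LinearMap.congr_fun h3
  have e4 : ∀ t, coeffOp G (coeffOp F t) = t := LinearMap.congr_fun h4
  refine ⟨⟨Q.double V M, coeffOp G ∘ₗ (TensorProduct.comm ℂ V M).toLinearMap ∘ₗ Q.braidVMInv V M,
    LinearMap.ext fun t => ?_, LinearMap.ext fun t => ?_⟩, rfl⟩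
  · simp [double, h5, e1, e3]
  · simp [double, h5, e2, e4]

/-- The double braiding is a homomorphism of `U`-modules. The coefficients `lp` and `rh` take `Δ(x)`
to `Δᶜᵒᵖ(x)` and back. -/
theorem double_ρ (hC : C.Separating) (V : C.Obj) (M : URep.{u, w} U) (x : U) :
    Commute (Q.double V M) ((M.tensor V.rep).ρ x) := by
  let r := Coalgebra.Repr.arbitrary ℂ x
  have h : ∀ (α : Module.Dual ℂ V) (v : V),
      ∑ i ∈ r.index, Q.dd V α (V.rep.ρ (r.right i) v) * r.left i =
        ∑ i ∈ r.index, r.left i * Q.dd V (α ∘ₗ V.rep.ρ (r.right i)) v := fun α v => by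
    simp only [dd, Finset.sum_mul, Finset.mul_sum]
    rw [Finset.sum_comm]
    have h1 : ∀ k, ∑ i ∈ r.index, Q.rh V α (Module.finBasis ℂ V k) *
        Q.lp V ((Module.finBasis ℂ V).coord k) (V.rep.ρ (r.right i) v) * r.left i =
        ∑ i ∈ r.index, Q.rh V α (Module.finBasis ℂ V k) *
          (r.right i * Q.lp V ((Module.finBasis ℂ V).coord k ∘ₗ V.rep.ρ (r.left i)) v) :=
      fun k => by
        simp only [mul_assoc]
        rw [← Finset.mul_sum, lp_hom hC, Finset.mul_sum]
    simp only [h1]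
    rw [Finset.sum_comm]
    have h2 : ∀ i, ∑ k, Q.rh V α (Module.finBasis ℂ V k) *
          (r.right i * Q.lp V ((Module.finBasis ℂ V).coord k ∘ₗ V.rep.ρ (r.left i)) v) =
        ∑ k, Q.rh V α (V.rep.ρ (r.left i) (Module.finBasis ℂ V k)) *
          (r.right i * Q.lp V ((Module.finBasis ℂ V).coord k) v) := fun i =>
      (sum_basis_comp (V.rep.ρ (r.left i)) (LinearMap.compl₁₂ (LinearMap.mul ℂ U) (Q.rh V α)
        (LinearMap.mulLeft ℂ (r.right i) ∘ₗ (Q.lp V).flip v))).symm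
    simp only [h2]
    rw [Finset.sum_comm]
    have h3 : ∀ k, ∑ i ∈ r.index, Q.rh V α (V.rep.ρ (r.left i) (Module.finBasis ℂ V k)) *
          (r.right i * Q.lp V ((Module.finBasis ℂ V).coord k) v) =
        ∑ i ∈ r.index, r.left i * Q.rh V (α ∘ₗ V.rep.ρ (r.right i)) (Module.finBasis ℂ V k) *
          Q.lp V ((Module.finBasis ℂ V).coord k) v := fun k => by
      simp only [← mul_assoc]
      rw [← Finset.sum_mul, rh_hom hC, Finset.sum_mul]
    simp only [h3]
    rw [Finset.sum_comm]
    simp only [mul_assoc]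
  refine TensorProduct.ext' fun m v => contrR_ext fun α => ?_
  rw [Module.End.mul_apply, Module.End.mul_apply, URep.tensor_ρ_tmul _ _ r, map_sum, map_sum,
    URep.tensor_apply, ← r.eq, map_sum, LinearMap.sum_apply, map_sum]
  simp only [URep.act₂_tmul, contrR_map, contrR_double]
  have h' := congrArg (fun y => M.ρ y m) (h α v)
  simpa only [map_sum, map_mul, LinearMap.sum_apply, Module.End.mul_apply] using h'

/-- The double braiding commutes with homomorphisms of `M`. -/
theorem double_natural (V : C.Obj) {M N : URep.{u, w} U} {φ : M →ₗ[ℂ] N}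
    (hφ : URep.IsHom M N φ) (t : M ⊗[ℂ] V) :
    Q.double V N (φ.rTensor V t) = φ.rTensor V (Q.double V M t) := by
  induction t using TensorProduct.induction_on with
  | zero => simp
  | add s t h1 h2 => simp only [map_add, h1, h2]
  | tmul m v =>
    refine contrR_ext fun α => ?_
    rw [LinearMap.rTensor_tmul, contrR_double, contrR_rTensor, contrR_double, hφ]

theorem braid_tmul (V W : C.Obj) (x : W) (v : V) :
    Q.braid W V (x ⊗ₜ v) = ∑ l, Module.finBasis ℂ V l ⊗ₜ[ℂ]
      W.rep.ρ (Q.lp V ((Module.finBasis ℂ V).coord l) v) x := by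
  change TensorProduct.comm ℂ W V (Q.R W V (x ⊗ₜ v)) = _
  rw [R_tmul, map_sum]
  rfl

theorem comul_dd (hC : C.Separating) (V : C.Obj) (α : Module.Dual ℂ V) (v : V) :
    Coalgebra.comul (R := ℂ) (Q.dd V α v) = ∑ k, ∑ l,
      Q.dd V ((Module.finBasis ℂ V).coord k) (Module.finBasis ℂ V l) ⊗ₜ[ℂ]
        (Q.rh V α (Module.finBasis ℂ V k) * Q.lp V ((Module.finBasis ℂ V).coord l) v) := by
  simp only [dd, map_sum, Bialgebra.comul_mul, comul_lp hC, comul_rh hC,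
    Finset.sum_mul_sum, Algebra.TensorProduct.tmul_mul_tmul, TensorProduct.sum_tmul]
  rw [Finset.sum_comm]
  exact Finset.sum_congr rfl fun a _ => Finset.sum_comm

/-- The hexagon axiom for the double braiding of `M ⊗ W` and `V`. -/
theorem double_tensor (hC : C.Separating) (V W : C.Obj) (M : URep.{u, w} U) (m : M) (x : W)
    (v : V) :
    Q.double V (M.tensor W.rep) ((m ⊗ₜ x) ⊗ₜ v) =
      (TensorProduct.assoc ℂ M W V).symm ((Q.braid V W).lTensor M
        (TensorProduct.assoc ℂ M V W ((Q.double V M).rTensor W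
          ((TensorProduct.assoc ℂ M V W).symm (m ⊗ₜ Q.braid W V (x ⊗ₜ v)))))) := by
  have hc : ∀ (m : M) (t : W ⊗[ℂ] V) (α : Module.Dual ℂ V), contrR (M ⊗[ℂ] W) α
      ((TensorProduct.assoc ℂ M W V).symm (m ⊗ₜ t)) = m ⊗ₜ contrR W α t := fun m t α => by
    induction t using TensorProduct.induction_on with
    | zero => simp
    | add s t h1 h2 => simp only [map_add, TensorProduct.tmul_add, h1, h2]
    | tmul w v => simp
  have hd : ∀ (α : Module.Dual ℂ V) (v : V) (y : W), contrR W α (Q.braid V W (v ⊗ₜ y)) =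
      W.rep.ρ (Q.rh V α v) y := fun α v y => (contrR_comm _ _).trans (contrL_R hC V W α v y)
  refine contrR_ext fun α => ?_
  refine (Q.contrR_double V (M.tensor W.rep) α (m ⊗ₜ x) v).trans ?_
  rw [braid_tmul V W, URep.tensor_apply, comul_dd hC]
  simp only [TensorProduct.tmul_sum, map_sum, TensorProduct.assoc_symm_tmul,
    LinearMap.rTensor_tmul, double_tmul, TensorProduct.sum_tmul, TensorProduct.assoc_tmul,
    LinearMap.lTensor_tmul, hc, hd, LinearMap.sum_apply, URep.act₂_tmul, TensorProduct.map_tmul,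
    map_mul, Module.End.mul_apply]
  exact Finset.sum_comm

end QuasiTriangular

/-! ### The operator `K₀` -/

section OperatorK

variable {U : Type u} [Ring U] [HopfAlgebra ℂ U] [BijectiveAntipode U] {C : TensorSubcat U}
  {Q : QuasiTriangular C}

/-- The coefficients of `K₀` are values of `theta` for the module `V ⊗ ^*V`: the coefficients of
`σ_{V,M}` are coefficients of `R⁻¹` on `^*V`, and together with those of `σ_{V,M}⁻¹` they form the
coefficients of `R⁻¹` on `V ⊗ ^*V`. -/
theorem contrR_opKFirst (hC : C.Separating) (g : Q.Character) (M : NonDegDMod.{u, max u v} Q)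
    (V : C.Obj) (α : Module.Dual ℂ V) (m : M) (v : V) :
    contrR M α (opKFirst.{u, v} g M V (m ⊗ₜ v)) =
      M.theta (V.tensor V.ldual) (coevJ V (g.J' V)) (v ⊗ₜ α) m := by
  have h1 : ∀ (a : CoEnd C) (z : M ⊗[ℂ] V), contrR M α (M.μ.rTensor V
      ((TensorProduct.assoc ℂ (CoEnd C) M V).symm (a ⊗ₜ z))) = M.actA a (contrR M α z) :=
    fun a z => by
    induction z using TensorProduct.induction_on with
    | zero => simp
    | add s t h1 h2 => simp only [map_add, TensorProduct.tmul_add, h1, h2]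
    | tmul m v =>
      rw [TensorProduct.assoc_symm_tmul, LinearMap.rTensor_tmul, contrR_tmul, contrR_tmul,
        map_smul]
      rfl
  have h2 : ∀ x : V, coevA V (g.J' V) x = ∑ j, CoEnd.mk (V.tensor V.ldual)
      (coevJ V (g.J' V) ⊗ₜ (x ⊗ₜ (Module.finBasis ℂ V).coord j)) ⊗ₜ[ℂ] Module.finBasis ℂ V j :=
    fun x => by
    rw [coevA, LinearMap.sum_apply]
    rfl
  have h3 : ∀ (x : V) (m : M), contrR M α (M.μ.rTensor V ((TensorProduct.assoc ℂ (CoEnd C) M V).symm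
      ((Q.braidVM V M.snd).lTensor (CoEnd C) (TensorProduct.assoc ℂ (CoEnd C) V M
        ((coevA V (g.J' V)).rTensor M (x ⊗ₜ m)))))) =
      ∑ j, M.actA (CoEnd.mk (V.tensor V.ldual) (coevJ V (g.J' V) ⊗ₜ
        (x ⊗ₜ (Module.finBasis ℂ V).coord j))) (M.snd.ρ (Q.rh V α (Module.finBasis ℂ V j)) m) :=
    fun x m => by
    rw [LinearMap.rTensor_tmul, h2, TensorProduct.sum_tmul]
    simp only [map_sum, TensorProduct.assoc_tmul, LinearMap.lTensor_tmul, h1]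
    exact Finset.sum_congr rfl fun j _ => congrArg _ (Q.contrR_braidVM V M.snd α m _)
  have h0 := Q.braidVMInv_tmul V M.snd m v
  refine (congrArg (fun z => contrR M α (M.μ.rTensor V ((TensorProduct.assoc ℂ (CoEnd C) M V).symm
      ((Q.braidVM V M.snd).lTensor (CoEnd C) (TensorProduct.assoc ℂ (CoEnd C) V M
        ((coevA V (g.J' V)).rTensor M z)))))) h0).trans ?_
  simp only [map_sum]
  simp only [h3]
  have h4 := sum_basis_tensor (V := V) (W := Module.Dual ℂ V)
    ((LinearMap.compl₁₂ (LinearMap.mul ℂ (Module.End ℂ M))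
      (M.actA ∘ₗ CoEnd.mk (V.tensor V.ldual) ∘ₗ TensorProduct.mk ℂ
        (Module.Dual ℂ (V ⊗[ℂ] Module.Dual ℂ V)) (V ⊗[ℂ] Module.Dual ℂ V) (coevJ V (g.J' V)))
      (M.snd.ρ.toLinearMap ∘ₗ (Q.lm (V.tensor V.ldual)).flip (v ⊗ₜ α))))
  have h5 := (M.theta_apply (V.tensor V.ldual) (coevJ V (g.J' V)) (v ⊗ₜ α)).trans h4
  rw [h5, LinearMap.sum_apply]
  refine Finset.sum_congr rfl fun i _ => ?_
  have h6 := sum_basis_dual (V := V) ((LinearMap.compl₁₂ (LinearMap.mul ℂ (Module.End ℂ M))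
      (M.actA ∘ₗ CoEnd.mk (V.tensor V.ldual) ∘ₗ TensorProduct.mk ℂ
        (Module.Dual ℂ (V ⊗[ℂ] Module.Dual ℂ V)) (V ⊗[ℂ] Module.Dual ℂ V) (coevJ V (g.J' V)) ∘ₗ
        TensorProduct.mk ℂ V (Module.Dual ℂ V) (Module.finBasis ℂ V i))
      (M.snd.ρ.toLinearMap ∘ₗ (Q.lm (V.tensor V.ldual)).flip (v ⊗ₜ α) ∘ₗ
        TensorProduct.dualDistrib ℂ V (Module.Dual ℂ V) ∘ₗ
        TensorProduct.mk ℂ (Module.Dual ℂ V) (Module.Dual ℂ (Module.Dual ℂ V))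
          ((Module.finBasis ℂ V).coord i))))
  refine Eq.trans ?_ (LinearMap.congr_fun h6.symm m)
  rw [LinearMap.sum_apply]
  refine Finset.sum_congr rfl fun j _ => ?_
  have h7 : Q.lm (V.tensor V.ldual) (TensorProduct.dualDistrib ℂ V (Module.Dual ℂ V)
      ((Module.finBasis ℂ V).coord i ⊗ₜ Module.Dual.eval ℂ V (Module.finBasis ℂ V j))) (v ⊗ₜ α) =
      Q.rh V α (Module.finBasis ℂ V j) * Q.lm V ((Module.finBasis ℂ V).coord i) v := by
    rw [← QuasiTriangular.lm_ldual hC]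
    exact QuasiTriangular.lm_tensor hC V V.ldual _ _ _ _
  have h8 : M.snd.ρ (Q.lm (V.tensor V.ldual) (TensorProduct.dualDistrib ℂ V (Module.Dual ℂ V)
      ((Module.finBasis ℂ V).coord i ⊗ₜ Module.Dual.eval ℂ V (Module.finBasis ℂ V j))) (v ⊗ₜ α)) m =
      M.snd.ρ (Q.rh V α (Module.finBasis ℂ V j)) (M.snd.ρ (Q.lm V ((Module.finBasis ℂ V).coord i) v)
        m) := by
    rw [h7, map_mul, Module.End.mul_apply]
  exact (congrArg (M.actA _) h8).symm

theorem theta_coevJ (hC : C.Separating) (M : NonDegDMod.{u, w} Q) (V : C.Obj)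
    (F : Module.End ℂ V) (v : V) (α : Module.Dual ℂ V) :
    M.theta (V.tensor V.ldual) (coevJ V F) (v ⊗ₜ α) =
      ∑ i, M.thetaInv V α (F (Module.finBasis ℂ V i)) *
        M.theta V ((Module.finBasis ℂ V).coord i) v := by
  rw [coevJ, map_sum, LinearMap.sum_apply]
  refine Finset.sum_congr rfl fun i _ => ?_
  rw [NonDegDMod.thetaInv_apply, NonDegDMod.theta_mul hC]

/-- `K₀` is conjugate to `1 ⊗ J'` under the gauge transformation. -/
theorem opKFirst_eq (hC : C.Separating) (g : Q.Character) (M : NonDegDMod.{u, max u v} Q)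
    (V : C.Obj) :
    opKFirst.{u, v} g M V = M.gaugeInv V * (g.J' V).lTensor M * M.gauge V := by
  refine TensorProduct.ext' fun m v => contrR_ext fun α => ?_
  rw [contrR_opKFirst hC, theta_coevJ hC, LinearMap.sum_apply, Module.End.mul_apply,
    Module.End.mul_apply, NonDegDMod.gauge, coeffOp_tmul, map_sum, map_sum, map_sum]
  simp only [LinearMap.lTensor_tmul, NonDegDMod.gaugeInv, contrR_coeffOp, Module.End.mul_apply]

theorem gauge_mul_opKFirst (hC : C.Separating) (g : Q.Character) (M : NonDegDMod.{u, max u v} Q)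
    (V : C.Obj) :
    M.gauge V * opKFirst.{u, v} g M V = (g.J' V).lTensor M * M.gauge V := by
  rw [opKFirst_eq hC, ← mul_assoc, ← mul_assoc, NonDegDMod.gauge_mul_gaugeInv hC, one_mul]

theorem isUnit_opKFirst (hC : C.Separating) (g : Q.Character) (M : NonDegDMod.{u, max u v} Q)
    (V : C.Obj) : IsUnit (opKFirst.{u, v} g M V) := by
  rw [opKFirst_eq hC]
  refine IsUnit.mul (IsUnit.mul ?_ ?_) (NonDegDMod.isUnit_gauge hC V)
  · exact ⟨⟨_, _, NonDegDMod.gaugeInv_mul_gauge hC V, NonDegDMod.gauge_mul_gaugeInv hC V⟩, rfl⟩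
  · obtain ⟨y, hy⟩ := g.isUnit_J' hC V
    rw [← hy]
    exact (y.map (Module.End.lTensorAlgHom ℂ V M :
      Module.End ℂ V →* Module.End ℂ (M ⊗[ℂ] V))).isUnit

/-- `K₀` is a homomorphism of modules over the second copy of `U`. -/
theorem opKFirst_ρ (hC : C.Separating) (g : Q.Character) (M : NonDegDMod.{u, max u v} Q)
    (V : C.Obj) (x : U) : Commute (opKFirst.{u, v} g M V) ((M.snd.tensor V.rep).ρ x) := by
  have h1 : M.gauge V * (M.snd.tensor V.rep).ρ x = (M.snd.ρ x).rTensor V * M.gauge V :=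
    LinearMap.ext (NonDegDMod.gauge_ρ hC V x)
  have h2 := gauge_mul_opKFirst hC g M V
  have h3 : Commute ((g.J' V).lTensor M) ((M.snd.ρ x).rTensor V) :=
    (LinearMap.lTensor_comp_rTensor _ _ _).trans (LinearMap.rTensor_comp_lTensor _ _ _).symm
  refine (NonDegDMod.isUnit_gauge (M := M) hC V).mul_left_cancel ?_
  rw [← mul_assoc, h2, mul_assoc, h1, ← mul_assoc, h3.eq, mul_assoc, ← h2, ← mul_assoc, ← h1,
    mul_assoc]

theorem opKFirst_natural (hC : C.Separating) (g : Q.Character)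
    {M N : NonDegDMod.{u, max u v} Q} (h : NonDegDMod.Hom M N) (V : C.Obj) :
    h.toLin.rTensor V ∘ₗ opKFirst.{u, v} g M V = opKFirst.{u, v} g N V ∘ₗ h.toLin.rTensor V := by
  refine TensorProduct.ext' fun m v => contrR_ext fun α => ?_
  rw [LinearMap.comp_apply, LinearMap.comp_apply, contrR_rTensor, LinearMap.rTensor_tmul,
    contrR_opKFirst hC, contrR_opKFirst hC, NonDegDMod.theta_apply, NonDegDMod.theta_apply,
    LinearMap.sum_apply, LinearMap.sum_apply, map_sum]
  refine Finset.sum_congr rfl fun i _ => ?_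
  exact (h.map_act _ _).trans (congrArg _ (h.map_ρ _ _))

end OperatorK

/-! ### The quadratic relation for `K₀` -/

section TwoStrands

variable {U : Type u} [Ring U] [HopfAlgebra ℂ U] [BijectiveAntipode U] {C : TensorSubcat U}
  {Q : QuasiTriangular C}

/-- The gauge transformation of `M ⊗ (V ⊗ W)`, as an operator on `(M ⊗ V) ⊗ W`. -/
def gauge₂ (M : NonDegDMod.{u, w} Q) (V W : C.Obj) : Module.End ℂ ((M ⊗[ℂ] V) ⊗[ℂ] W) :=
  (TensorProduct.assoc ℂ M V W).symm.toLinearMap ∘ₗ M.gauge (V.tensor W) ∘ₗ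
    (TensorProduct.assoc ℂ M V W).toLinearMap

section Leg

variable {A B D : Type*} [AddCommGroup A] [Module ℂ A] [AddCommGroup B] [Module ℂ B]
  [AddCommGroup D] [Module ℂ D]

theorem leg23_rTensor (J : Module.End ℂ B) :
    leg23 A (J.rTensor D : Module.End ℂ (B ⊗[ℂ] D)) = (J.lTensor A).rTensor D := by
  refine LinearMap.ext fun t => ?_
  induction t using TensorProduct.induction_on with
  | zero => simp
  | add s t h1 h2 => simp only [map_add, h1, h2]
  | tmul z d =>
    induction z using TensorProduct.induction_on with
    | zero => simp
    | add s t h1 h2 => simp only [map_add, TensorProduct.add_tmul, h1, h2]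
    | tmul a b => simp [leg23]

end Leg

theorem contrR_assoc_symm {A : Type*} [AddCommGroup A] [Module ℂ A] {V W : Type*} [AddCommGroup V]
    [Module ℂ V] [AddCommGroup W] [Module ℂ W] (α : Module.Dual ℂ V) (β : Module.Dual ℂ W)
    (t : A ⊗[ℂ] (V ⊗[ℂ] W)) :
    contrR A α (contrR (A ⊗[ℂ] V) β ((TensorProduct.assoc ℂ A V W).symm t)) =
      contrR A (TensorProduct.dualDistrib ℂ V W (α ⊗ₜ β)) t := by
  induction t using TensorProduct.induction_on with
  | zero => simp
  | add s t h1 h2 => simp only [map_add, h1, h2]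
  | tmul a t =>
    induction t using TensorProduct.induction_on with
    | zero => simp
    | add s t h1 h2 => simp only [TensorProduct.tmul_add, map_add, h1, h2]
    | tmul v w => simp [smul_smul, mul_comm]

theorem contrR_gauge₂ (hC : C.Separating) (M : NonDegDMod.{u, w} Q) (V W : C.Obj)
    (α : Module.Dual ℂ V) (β : Module.Dual ℂ W) (z : M ⊗[ℂ] V) (x : W) :
    contrR M α (contrR (M ⊗[ℂ] V) β (gauge₂ M V W (z ⊗ₜ x))) =
      M.theta W β x (contrR M α (M.gauge V z)) := by
  induction z using TensorProduct.induction_on with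
  | zero => simp
  | add s t h1 h2 => simp only [TensorProduct.add_tmul, map_add, h1, h2]
  | tmul m v =>
    refine (contrR_assoc_symm α β _).trans ((contrR_coeffOp (M.theta (V.tensor W)) _ m
      (v ⊗ₜ x)).trans ?_)
    rw [NonDegDMod.gauge, contrR_coeffOp, ← NonDegDMod.theta_mul hC, Module.End.mul_apply]

theorem gauge₂_leg12_opKFirst (hC : C.Separating) (g : Q.Character)
    (M : NonDegDMod.{u, max u v} Q) (V W : C.Obj) :
    gauge₂ M V W * leg12 W (opKFirst.{u, v} g M V) =
      leg23 M ((g.J' V).rTensor W) * gauge₂ M V W := by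
  refine TensorProduct.ext' fun z x => contrR_ext fun β => contrR_ext fun α => ?_
  have h := LinearMap.congr_fun (gauge_mul_opKFirst hC g M V) z
  rw [Module.End.mul_apply, Module.End.mul_apply, leg12_tmul, contrR_gauge₂ hC, leg23_rTensor,
    contrR_rTensor, contrR_lTensor, contrR_gauge₂ hC, ← contrR_lTensor]
  exact congrArg (fun y => M.theta W β x (contrR M α y)) h

theorem gauge₂_leg23 (hC : C.Separating) (M : NonDegDMod.{u, w} Q) (V : C.Obj) :
    gauge₂ M V V * leg23 M (Q.braid V V) = leg23 M (Q.braid V V) * gauge₂ M V V := by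
  refine LinearMap.ext fun t => ?_
  simp only [gauge₂, leg23, Module.End.mul_apply, LinearMap.comp_apply, LinearEquiv.coe_coe,
    LinearEquiv.apply_symm_apply]
  exact congrArg _ (NonDegDMod.gauge_natural hC (Q.isHom_braid V V) _)

theorem isUnit_gauge₂ (hC : C.Separating) (M : NonDegDMod.{u, w} Q) (V W : C.Obj) :
    IsUnit (gauge₂ M V W) := by
  refine ⟨⟨gauge₂ M V W, (TensorProduct.assoc ℂ M V W).symm.toLinearMap ∘ₗ
    M.gaugeInv (V.tensor W) ∘ₗ (TensorProduct.assoc ℂ M V W).toLinearMap,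
    LinearMap.ext fun t => ?_, LinearMap.ext fun t => ?_⟩, rfl⟩
  · have h := LinearMap.congr_fun (NonDegDMod.gauge_mul_gaugeInv (M := M) hC (V.tensor W))
    simp only [Module.End.mul_apply, Module.End.one_apply] at h
    simp [gauge₂, h]
  · have h := LinearMap.congr_fun (NonDegDMod.gaugeInv_mul_gauge (M := M) hC (V.tensor W))
    simp only [Module.End.mul_apply, Module.End.one_apply] at h
    simp [gauge₂, h]

/-- The gauge transformation of `M ⊗ V ⊗ V` commutes with `σ₂₃` and turns `K₀` into `J'` acting on
the first factor `V`, and the relation becomes the left-handed reflection equation. -/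
theorem opKFirst_quad (hC : C.Separating) (g : Q.Character)
    (M : NonDegDMod.{u, max u v} Q) (V : C.Obj) :
    leg23 M (Q.braid V V) * leg12 V (opKFirst.{u, v} g M V) * leg23 M (Q.braid V V) *
        leg12 V (opKFirst.{u, v} g M V) =
      leg12 V (opKFirst.{u, v} g M V) * leg23 M (Q.braid V V) *
        leg12 V (opKFirst.{u, v} g M V) * leg23 M (Q.braid V V) := by
  have h1 : SemiconjBy (gauge₂ M V V) _ _ := gauge₂_leg12_opKFirst hC g M V V
  have h2 : SemiconjBy (gauge₂ M V V) _ _ := gauge₂_leg23 hC M V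
  have h3 := congrArg (leg23 M) (g.left_reflection hC V)
  simp only [← leg23_mul] at h3
  refine (isUnit_gauge₂ hC M V V).mul_left_cancel ?_
  rw [(((h2.mul_right h1).mul_right h2).mul_right h1).eq, h3,
    (((h1.mul_right h2).mul_right h1).mul_right h2).eq]

end TwoStrands

/-! ### Operators on two and three strands -/

section Strands

variable {U : Type u} [Ring U] [HopfAlgebra ℂ U] [BijectiveAntipode U] {C : TensorSubcat U}
  {Q : QuasiTriangular C}

namespace URep

/-- The associator is a homomorphism, by coassociativity. -/
theorem assoc_tensor_ρ (Y : URep.{u, w} U) (V W : C.Obj) (x : U) (t : (Y ⊗[ℂ] V) ⊗[ℂ] W) :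
    TensorProduct.assoc ℂ Y V W (((Y.tensor V.rep).tensor W.rep).ρ x t) =
      (Y.tensor (V.tensor W).rep).ρ x (TensorProduct.assoc ℂ Y V W t) := by
  induction t using TensorProduct.induction_on with
  | zero => simp only [map_zero]
  | add s t h1 h2 => simp only [map_add, h1, h2]
  | tmul z c =>
    induction z using TensorProduct.induction_on with
    | zero => simp only [map_zero, TensorProduct.zero_tmul]
    | add s t h1 h2 => simp only [map_add, TensorProduct.add_tmul, h1, h2]
    | tmul a b =>
      let r := Coalgebra.Repr.arbitrary ℂ x
      let r₁ := fun i => Coalgebra.Repr.arbitrary ℂ (r.left i)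
      let r₂ := fun i => Coalgebra.Repr.arbitrary ℂ (r.right i)
      rw [TensorProduct.assoc_tmul, tensor_ρ_tmul _ _ r, tensor_ρ_tmul _ _ r, map_sum]
      have h1 : ∀ i, TensorProduct.assoc ℂ Y V W ((Y.tensor V.rep).ρ (r.left i) (a ⊗ₜ b) ⊗ₜ
          W.rep.ρ (r.right i) c) = ∑ j ∈ (r₁ i).index, Y.ρ ((r₁ i).left j) a ⊗ₜ
            (V.rep.ρ ((r₁ i).right j) b ⊗ₜ W.rep.ρ (r.right i) c) := fun i => by
        rw [tensor_ρ_tmul _ _ (r₁ i), TensorProduct.sum_tmul, map_sum]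
        rfl
      have h2 : ∀ i, Y.ρ (r.left i) a ⊗ₜ[ℂ] (V.tensor W).rep.ρ (r.right i) (b ⊗ₜ c) =
          ∑ j ∈ (r₂ i).index, Y.ρ (r.left i) a ⊗ₜ
            (V.rep.ρ ((r₂ i).left j) b ⊗ₜ W.rep.ρ ((r₂ i).right j) c) := fun i => by
        rw [← TensorProduct.tmul_sum]
        exact congrArg _ (tensor_ρ_tmul _ _ (r₂ i) b c)
      simp only [h1, h2]
      have h := congrArg (TensorProduct.map (Y.ρ.toLinearMap.flip a)
        (TensorProduct.map (V.rep.ρ.toLinearMap.flip b) (W.rep.ρ.toLinearMap.flip c)))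
        (Coalgebra.sum_tmul_tmul_eq r r₁ r₂)
      simp only [map_sum] at h
      exact h

theorem leg23_commute_ρ (Y : URep.{u, w} U) (V W : C.Obj) {S : Module.End ℂ (V ⊗[ℂ] W)}
    (hS : IsHom (V.tensor W).rep (V.tensor W).rep S) (x : U) :
    Commute (leg23 Y S) (((Y.tensor V.rep).tensor W.rep).ρ x) := by
  refine LinearMap.ext fun t => (TensorProduct.assoc ℂ Y V W).injective ?_
  rw [Module.End.mul_apply, Module.End.mul_apply, assoc_tensor_ρ]
  simp only [leg23, LinearMap.comp_apply, LinearEquiv.coe_coe, LinearEquiv.apply_symm_apply]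
  have h := IsHom.tensor (IsHom.id Y) hS x (TensorProduct.assoc ℂ Y V W t)
  refine Eq.trans ?_ h
  exact congrArg _ (assoc_tensor_ρ Y V W x t)

theorem rTensor_commute_ρ (Y : URep.{u, w} U) (V : C.Obj) {Z : Module.End ℂ Y}
    (hZ : ∀ x, Commute Z (Y.ρ x)) (x : U) :
    Commute (Z.rTensor V : Module.End ℂ (Y ⊗[ℂ] V)) ((Y.tensor V.rep).ρ x) :=
  LinearMap.ext (IsHom.tensor (V := Y) (V' := Y) (fun x => LinearMap.congr_fun (hZ x))
    (IsHom.id V.rep) x)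

end URep

section Leg

variable {A B D E : Type*} [AddCommGroup A] [Module ℂ A] [AddCommGroup B] [Module ℂ B]
  [AddCommGroup D] [Module ℂ D] [AddCommGroup E] [Module ℂ E]

theorem assoc_leg23 (X : Module.End ℂ (B ⊗[ℂ] D)) (t : (A ⊗[ℂ] B) ⊗[ℂ] D) :
    TensorProduct.assoc ℂ A B D (leg23 A X t) = X.lTensor A (TensorProduct.assoc ℂ A B D t) := by
  simp [leg23]

theorem leg23_lTensor (J : Module.End ℂ D) :
    leg23 A (J.lTensor B : Module.End ℂ (B ⊗[ℂ] D)) = J.lTensor (A ⊗[ℂ] B) := by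
  refine LinearMap.ext fun t => ?_
  induction t using TensorProduct.induction_on with
  | zero => simp
  | add s t h1 h2 => simp only [map_add, h1, h2]
  | tmul z d =>
    induction z using TensorProduct.induction_on with
    | zero => simp
    | add s t h1 h2 => simp only [map_add, TensorProduct.add_tmul, h1, h2]
    | tmul a b => simp [leg23]

theorem leg23_commute_rTensor (Z : Module.End ℂ A) (X : Module.End ℂ (B ⊗[ℂ] D)) :
    Commute (leg23 A X) ((Z.rTensor B).rTensor D) := by
  refine LinearMap.ext fun t => (TensorProduct.assoc ℂ A B D).injective ?_
  have h : ∀ t, TensorProduct.assoc ℂ A B D ((Z.rTensor B).rTensor D t) =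
      Z.rTensor (B ⊗[ℂ] D) (TensorProduct.assoc ℂ A B D t) := fun t =>
    (LinearMap.congr_fun (TensorProduct.map_map_comp_assoc_eq Z (LinearMap.id : B →ₗ[ℂ] B)
      (LinearMap.id : D →ₗ[ℂ] D)) t).symm.trans (by
        simp only [TensorProduct.map_id]; rfl)
  rw [Module.End.mul_apply, Module.End.mul_apply, assoc_leg23, h, h, assoc_leg23]
  exact LinearMap.congr_fun ((LinearMap.lTensor_comp_rTensor _ _ _).trans
    (LinearMap.rTensor_comp_lTensor _ _ _).symm) _

/-- The reassociation of four factors which isolates the first one. -/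
def assoc₃ (A B D E : Type*) [AddCommGroup A] [Module ℂ A] [AddCommGroup B] [Module ℂ B]
    [AddCommGroup D] [Module ℂ D] [AddCommGroup E] [Module ℂ E] :
    ((A ⊗[ℂ] B) ⊗[ℂ] D) ⊗[ℂ] E ≃ₗ[ℂ] A ⊗[ℂ] ((B ⊗[ℂ] D) ⊗[ℂ] E) :=
  (TensorProduct.congr (TensorProduct.assoc ℂ A B D) (LinearEquiv.refl ℂ E)).trans
    (TensorProduct.assoc ℂ A (B ⊗[ℂ] D) E)

theorem assoc₃_rTensor (X : Module.End ℂ (B ⊗[ℂ] D)) (t : ((A ⊗[ℂ] B) ⊗[ℂ] D) ⊗[ℂ] E) :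
    assoc₃ A B D E ((leg23 A X).rTensor E t) = (X.rTensor E).lTensor A (assoc₃ A B D E t) := by
  induction t using TensorProduct.induction_on with
  | zero => simp
  | add s t h1 h2 => simp only [map_add, h1, h2]
  | tmul z e =>
    have h : ∀ s : A ⊗[ℂ] (B ⊗[ℂ] D), TensorProduct.assoc ℂ A (B ⊗[ℂ] D) E (X.lTensor A s ⊗ₜ e) =
        (X.rTensor E).lTensor A (TensorProduct.assoc ℂ A (B ⊗[ℂ] D) E (s ⊗ₜ e)) := fun s => by
      induction s using TensorProduct.induction_on with
      | zero => simp
      | add s t h1 h2 => simp only [map_add, TensorProduct.add_tmul, h1, h2]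
      | tmul a b => simp
    refine Eq.trans ?_ (h (TensorProduct.assoc ℂ A B D z))
    rw [← assoc_leg23]
    rfl

theorem assoc₃_leg23 (X : Module.End ℂ (D ⊗[ℂ] E)) (t : ((A ⊗[ℂ] B) ⊗[ℂ] D) ⊗[ℂ] E) :
    assoc₃ A B D E (leg23 (A ⊗[ℂ] B) X t) = (leg23 B X).lTensor A (assoc₃ A B D E t) := by
  have h : ∀ (a : A) (b : B) (s : D ⊗[ℂ] E),
      assoc₃ A B D E ((TensorProduct.assoc ℂ (A ⊗[ℂ] B) D E).symm ((a ⊗ₜ b) ⊗ₜ s)) =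
        a ⊗ₜ (TensorProduct.assoc ℂ B D E).symm (b ⊗ₜ s) := fun a b s => by
    induction s using TensorProduct.induction_on with
    | zero => simp
    | add s t h1 h2 => simp only [map_add, TensorProduct.tmul_add, h1, h2]
    | tmul d e => rfl
  induction t using TensorProduct.induction_on with
  | zero => simp
  | add s t h1 h2 => simp only [map_add, h1, h2]
  | tmul z e =>
    induction z using TensorProduct.induction_on with
    | zero => simp
    | add s t h1 h2 => simp only [map_add, TensorProduct.add_tmul, h1, h2]
    | tmul z d =>
      induction z using TensorProduct.induction_on with
      | zero => simp
      | add s t h1 h2 => simp only [map_add, TensorProduct.add_tmul, h1, h2]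
      | tmul a b => exact h a b (X (d ⊗ₜ e))

theorem isUnit_leg23 {X : Module.End ℂ (B ⊗[ℂ] D)} (hX : IsUnit X) : IsUnit (leg23 A X) := by
  obtain ⟨y, rfl⟩ := hX
  refine ⟨⟨leg23 A y.val, leg23 A y.inv, ?_, ?_⟩, rfl⟩
  · rw [leg23_mul, y.val_inv, leg23_one]
  · rw [leg23_mul, y.inv_val, leg23_one]

theorem isUnit_rTensor {Z : Module.End ℂ A} (hZ : IsUnit Z) :
    IsUnit (Z.rTensor B : Module.End ℂ (A ⊗[ℂ] B)) :=
  hZ.map (Module.End.rTensorAlgHom ℂ A B : Module.End ℂ A →* Module.End ℂ (A ⊗[ℂ] B))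

theorem isUnit_lTensor {Z : Module.End ℂ B} (hZ : IsUnit Z) :
    IsUnit (Z.lTensor A : Module.End ℂ (A ⊗[ℂ] B)) :=
  hZ.map (Module.End.lTensorAlgHom ℂ B A : Module.End ℂ B →* Module.End ℂ (A ⊗[ℂ] B))

end Leg

namespace QuasiTriangular

/-- The hexagon axiom: `σ_{V ⊗ V, V} = σ₁₂ σ₂₃`. -/
theorem braid_tensor_left (hC : C.Separating) (V : C.Obj) (t : (V ⊗[ℂ] V) ⊗[ℂ] V) :
    (TensorProduct.assoc ℂ V V V).symm (Q.braid (V.tensor V) V t) =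
      (Q.braid V V).rTensor V (leg23 V (Q.braid V V) t) := by
  induction t using TensorProduct.induction_on with
  | zero => simp only [map_zero]
  | add s t h1 h2 => simp only [map_add, h1, h2]
  | tmul z c =>
    induction z using TensorProduct.induction_on with
    | zero => simp only [map_zero, TensorProduct.zero_tmul]
    | add s t h1 h2 => simp only [map_add, TensorProduct.add_tmul, h1, h2]
    | tmul a b =>
      have h0 := braid_tmul (Q := Q) V (V.tensor V) (a ⊗ₜ b) c
      have h1 : ∀ l, (V.tensor V).rep.ρ (Q.lp V ((Module.finBasis ℂ V).coord l) c) (a ⊗ₜ b) =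
          ∑ k, V.rep.ρ (Q.lp V ((Module.finBasis ℂ V).coord l) (Module.finBasis ℂ V k)) a ⊗ₜ[ℂ]
            V.rep.ρ (Q.lp V ((Module.finBasis ℂ V).coord k) c) b := fun l =>
        URep.tensor_ρ_tmul V.rep V.rep ⟨Finset.univ, _, _, (comul_lp hC V _ c).symm⟩ a b
      refine (congrArg _ h0).trans ?_
      simp only [h1, leg23_tmul, braid_tmul V V b c, TensorProduct.tmul_sum, map_sum,
        TensorProduct.assoc_symm_tmul, LinearMap.rTensor_tmul, braid_tmul V V a,
        TensorProduct.sum_tmul]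
      exact Finset.sum_comm

/-- The braid relation on `V ⊗ V ⊗ V`: the braiding `σ_{V ⊗ V, V}` is natural with respect to
`σ_{V,V}` on its first argument. -/
theorem braid_relation (hC : C.Separating) (V : C.Obj) :
    (Q.braid V V).rTensor V * leg23 V (Q.braid V V) * (Q.braid V V).rTensor V =
      leg23 V (Q.braid V V) * (Q.braid V V).rTensor V * leg23 V (Q.braid V V) := by
  refine LinearMap.ext fun t => ?_
  simp only [Module.End.mul_apply]
  rw [← braid_tensor_left hC, ← braid_tensor_left hC]
  have h : Q.braid (V.tensor V) V ((Q.braid V V).rTensor V t) =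
      (Q.braid V V).lTensor V (Q.braid (V.tensor V) V t) := by
    have h := Q.R_natural (V := V.tensor V) (V' := V.tensor V) (W := V) (W' := V) (Q.braid V V)
      LinearMap.id (Q.isHom_braid V V) (URep.IsHom.id _) t
    refine (congrArg (TensorProduct.comm ℂ (V ⊗[ℂ] V) V) h).trans ?_
    exact (TensorProduct.map_comm LinearMap.id (Q.braid V V) (Q.R (V.tensor V) V t)).symm
  rw [h]
  simp [leg23]

/-- The braid relation on the last three factors of `Y ⊗ V ⊗ V ⊗ V`. -/
theorem braid_relation_leg23 (hC : C.Separating) (Y : URep.{u, w} U) (V : C.Obj) :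
    (leg23 Y (Q.braid V V)).rTensor V * leg23 (Y ⊗[ℂ] V) (Q.braid V V) *
        (leg23 Y (Q.braid V V)).rTensor V =
      leg23 (Y ⊗[ℂ] V) (Q.braid V V) * (leg23 Y (Q.braid V V)).rTensor V *
        leg23 (Y ⊗[ℂ] V) (Q.braid V V) := by
  refine LinearMap.ext fun t => (assoc₃ Y V V V).injective ?_
  simp only [Module.End.mul_apply, assoc₃_rTensor, assoc₃_leg23]
  have h := congrArg (fun Z => Z.lTensor Y (assoc₃ Y V V V t)) (braid_relation (Q := Q) hC V)
  simpa only [LinearMap.lTensor_mul, Module.End.mul_apply] using h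

theorem isUnit_braid (V : C.Obj) : IsUnit (Q.braid V V : Module.End ℂ (V ⊗[ℂ] V)) := by
  have h : IsUnit ((TensorProduct.comm ℂ V V).toLinearMap : Module.End ℂ (V ⊗[ℂ] V)) :=
    ⟨LinearMap.GeneralLinearGroup.ofLinearEquiv (TensorProduct.comm ℂ V V), rfl⟩
  exact h.mul (Q.isUnit_R V V)

/-- The double braiding of `Y ⊗ V` and `V` is `σ₂₃ D₁₂ σ₂₃`. -/
theorem double_tensor_eq (hC : C.Separating) (Y : URep.{u, w} U) (V : C.Obj) :
    Q.double V (Y.tensor V.rep) =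
      leg23 Y (Q.braid V V) * leg12 V (Q.double V Y) * leg23 Y (Q.braid V V) := by
  refine TensorProduct.ext_threefold fun m x v => ?_
  refine (double_tensor hC V V Y m x v).trans ?_
  simp [leg23, leg12]

/-- Module endomorphisms of `Y ⊗ V` commute with `σ₂₃ D₁₂ σ₂₃`, which is a double braiding of
`Y ⊗ V`. -/
theorem commute_double (hC : C.Separating) (Y : URep.{u, w} U) (V : C.Obj)
    {Z : Module.End ℂ (Y ⊗[ℂ] V)} (hZ : ∀ x, Commute Z ((Y.tensor V.rep).ρ x)) :
    Commute (leg12 V Z)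
      (leg23 Y (Q.braid V V) * leg12 V (Q.double V Y) * leg23 Y (Q.braid V V)) := by
  rw [← double_tensor_eq hC]
  exact (LinearMap.ext fun t => Q.double_natural V (M := Y.tensor V.rep) (N := Y.tensor V.rep)
    (fun x => LinearMap.congr_fun (hZ x)) t).symm

theorem Character.reflection_leg23 (hC : C.Separating) (f : Q.Character) (Y : URep.{u, w} U)
    (V : C.Obj) :
    leg23 Y (Q.braid V V) * (f.J V).lTensor (Y ⊗[ℂ] V) * leg23 Y (Q.braid V V) *
        (f.J V).lTensor (Y ⊗[ℂ] V) =
      (f.J V).lTensor (Y ⊗[ℂ] V) * leg23 Y (Q.braid V V) * (f.J V).lTensor (Y ⊗[ℂ] V) *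
        leg23 Y (Q.braid V V) := by
  rw [← leg23_lTensor]
  simp only [leg23_mul]
  exact congrArg _ (LinearMap.ext (f.reflection hC V V))

end QuasiTriangular

end Strands

/-! ### Homomorphisms from the double affine braid group -/

/-- The products `t_k t_{k+1} ⋯ t_{k+m} ⋯ t_{k+1} t_k`. -/
def nestedProd {G : Type*} [Monoid G] (t : ℕ → G) : ℕ → ℕ → G
  | k, 0 => t k
  | k, m + 1 => t k * nestedProd t (k + 1) m * t k

theorem nestedProd_eq_prod {G : Type*} [Monoid G] (t : ℕ → G) (k m : ℕ) :
    nestedProd t k m = ((List.range m).map fun i => t (i + k)).prod * t (m + k) *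
      ((List.range m).map fun i => t (i + k)).reverse.prod := by
  induction m generalizing k with
  | zero => simp [nestedProd]
  | succ m ih =>
    rw [nestedProd, ih, List.range_succ_eq_map]
    simp only [List.map_cons, List.map_map, List.reverse_cons, List.prod_append, List.prod_cons,
      List.prod_nil, zero_add, mul_one, mul_assoc, Function.comp_def, Nat.succ_eq_add_one,
      Nat.add_right_comm _ 1 k, Nat.add_assoc _ k 1]

theorem map_nestedProd {G H : Type*} [Monoid G] [Monoid H] (φ : G →* H) (t : ℕ → G) (k m : ℕ) :
    φ (nestedProd t k m) = nestedProd (fun i => φ (t i)) k m := by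
  induction m generalizing k with
  | zero => rfl
  | succ m ih => rw [nestedProd, nestedProd, map_mul, map_mul, ih]

theorem Commute.nestedProd_right {G : Type*} [Monoid G] {t : ℕ → G} {z : G} {k m : ℕ}
    (h : ∀ i, k ≤ i → i ≤ k + m → Commute z (t i)) : Commute z (nestedProd t k m) := by
  induction m generalizing k with
  | zero => exact h k le_rfl le_rfl
  | succ m ih =>
    have hk := h k le_rfl (by omega)
    exact (hk.mul_right (ih fun i h1 h2 => h i (by omega) (by omega))).mul_right hk

/-- Elements `t₁, …, t_n`, `d`, `k` of a monoid with the relations which hold for the operators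
`T_1, …, T_n`, the double braiding of `M` and `V_1`, and `K_0`: `t₁, …, t_n` satisfy the braid
relations of type `B`, while `d` and `k` commute with `t₂, …, t_n` and with `t₁ d t₁`, and `k`
satisfies the quadratic relation with `t₁`. -/
structure IsBraidTuple {G : Type*} [Monoid G] (n : ℕ) (t : ℕ → G) (d k : G) : Prop where
  comm : ∀ i j, 1 ≤ i → i + 1 < j → j ≤ n → Commute (t i) (t j)
  braid : ∀ i, 1 ≤ i → i + 1 < n → t i * t (i + 1) * t i = t (i + 1) * t i * t (i + 1)
  quad : ∀ i, 1 ≤ i → i + 1 = n → t i * t n * t i * t n = t n * t i * t n * t i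
  d_comm : ∀ i, 2 ≤ i → i ≤ n → Commute d (t i)
  k_comm : ∀ i, 2 ≤ i → i ≤ n → Commute k (t i)
  d_quad : 2 ≤ n → Commute d (t 1 * d * t 1)
  k_quad : 2 ≤ n → t 1 * k * t 1 * k = k * t 1 * k * t 1
  k_d : 2 ≤ n → Commute k (t 1 * d * t 1)

namespace IsBraidTuple

theorem of_injective {G H : Type*} [Monoid G] [Monoid H] {φ : G →* H}
    (hφ : Function.Injective φ) {n : ℕ} {t : ℕ → G} {d k : G}
    (h : IsBraidTuple n (fun i => φ (t i)) (φ d) (φ k)) : IsBraidTuple n t d k where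
  comm i j h1 h2 h3 := hφ (by simpa only [map_mul] using (h.comm i j h1 h2 h3).eq)
  braid i h1 h2 := hφ (by simpa only [map_mul] using h.braid i h1 h2)
  quad i h1 h2 := hφ (by simpa only [map_mul] using h.quad i h1 h2)
  d_comm i h1 h2 := hφ (by simpa only [map_mul] using (h.d_comm i h1 h2).eq)
  k_comm i h1 h2 := hφ (by simpa only [map_mul] using (h.k_comm i h1 h2).eq)
  d_quad h1 := hφ (by simpa only [map_mul] using (h.d_quad h1).eq)
  k_quad h1 := hφ (by simpa only [map_mul] using h.k_quad h1)
  k_d h1 := hφ (by simpa only [map_mul] using (h.k_d h1).eq)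

section Monoid

variable {G : Type*} [Monoid G] {n : ℕ} {t : ℕ → G} {d k : G}

/-- The Jucys–Murphy elements `t_i ⋯ t_n ⋯ t_i` of the braid group of type `B` commute with
`t_{i+1}, …, t_n`. -/
theorem commute_nestedProd (h : IsBraidTuple n t d k) {i m : ℕ} (hi : 1 ≤ i) (hm : i + m = n)
    {j : ℕ} (hij : i < j) (hj : j ≤ n) : Commute (t j) (nestedProd t i m) := by
  induction m generalizing i j with
  | zero => omega
  | succ m ih =>
    rcases Nat.lt_or_ge (i + 1) j with hij' | hij'
    · have h1 := (h.comm i j hi hij' hj).symm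
      exact (h1.mul_right (ih (by omega) (by omega) hij' hj)).mul_right h1
    · obtain rfl : j = i + 1 := by omega
      cases m with
      | zero =>
        obtain rfl : i + 1 = n := by omega
        simpa only [nestedProd, commute_iff_eq, mul_assoc] using (h.quad i hi rfl).symm
      | succ m =>
        have hb := h.braid i hi (by omega)
        have hc : Commute (t i) (nestedProd t (i + 1 + 1) m) :=
          Commute.nestedProd_right fun l h1 h2 => h.comm i l hi (by omega) (by omega)
        simp only [nestedProd, commute_iff_eq]
        generalize nestedProd t (i + 1 + 1) m = p at hc ⊢
        calc t (i + 1) * (t i * (t (i + 1) * p * t (i + 1)) * t i)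
            = (t (i + 1) * t i * t (i + 1)) * p * t (i + 1) * t i := by simp only [mul_assoc]
          _ = t i * t (i + 1) * (t i * p) * t (i + 1) * t i := by rw [← hb]; simp only [mul_assoc]
          _ = t i * t (i + 1) * p * (t i * t (i + 1) * t i) := by
            rw [hc.eq]; simp only [mul_assoc]
          _ = t i * (t (i + 1) * p * t (i + 1)) * t i * t (i + 1) := by
            rw [hb]; simp only [mul_assoc]

end Monoid

section Group

variable {G : Type*} [Group G] {n : ℕ} {t : ℕ → G} {d k : G}

/-- The double affine braid group acts with `T_0 = (d p)⁻¹` for `p = t₁ ⋯ t_n ⋯ t₁`. The relations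
between `T_0` and `T_1` or `K_0` are statements that two elements commute, and are checked after
replacing `T_0` by its inverse. -/
theorem exists_hom (h : IsBraidTuple n t d k) (hn : 1 ≤ n) :
    ∃ ψ : DoubleAffineBraidGroup n →* G,
      (∀ i : Fin (n + 1), ψ (DoubleAffineBraidGroup.T i) =
        if (i : ℕ) = 0 then (d * nestedProd t 1 (n - 1))⁻¹ else t i) ∧
      ψ (DoubleAffineBraidGroup.K n) = k := by
  let p := nestedProd t 1 (n - 1)
  let F : DABGen n → G
    | .T i => if (i : ℕ) = 0 then (d * p)⁻¹ else t i
    | .K => k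
  have h0 : FreeGroup.lift F (DABGen.t n 0) = (d * p)⁻¹ := by
    simp [DABGen.t, F]
  have ht : ∀ i, 1 ≤ i → i ≤ n → FreeGroup.lift F (DABGen.t n i) = t i := fun i h1 h2 => by
    have hv : i % (n + 1) = i := Nat.mod_eq_of_lt (by omega)
    simp only [DABGen.t, FreeGroup.lift_apply_of, F, Fin.val_ofNat, hv]
    rw [if_neg (by omega)]
  have hk : FreeGroup.lift F (DABGen.k n) = k := by simp [DABGen.k, F]
  have hp : ∀ j, 2 ≤ j → j ≤ n → Commute (t j) p := fun j h1 h2 =>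
    h.commute_nestedProd le_rfl (by omega) (by omega) h2
  -- for `n ≥ 2`, `p = t₁ q t₁` where `q` only involves `t₂, …, t_n`
  have hq : 2 ≤ n → ∃ q, p = t 1 * q * t 1 ∧ Commute d q ∧ Commute k q ∧ Commute p q := fun h2 => by
    obtain ⟨m, rfl⟩ : ∃ m, n = m + 2 := ⟨n - 2, by omega⟩
    exact ⟨nestedProd t 2 m, rfl,
      Commute.nestedProd_right fun i h1 h2 => h.d_comm i h1 (by omega),
      Commute.nestedProd_right fun i h1 h2 => h.k_comm i h1 (by omega),
      Commute.nestedProd_right fun i h1 h2 => (hp i h1 (by omega)).symm⟩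
  have hrel : ∀ a b, DABRel n a b → FreeGroup.lift F a = FreeGroup.lift F b := by
    intro a b hab
    cases hab with
    | comm i j hij hj =>
      rw [map_mul, map_mul, ht j (by omega) hj]
      rcases Nat.eq_zero_or_pos i with rfl | hi
      · rw [h0]
        exact ((h.d_comm j (by omega) hj).mul_left (hp j (by omega) hj).symm).inv_left
      · rw [ht i hi (by omega)]
        exact h.comm i j hi hij hj
    | braid i hi hin =>
      simp only [map_mul, ht i hi (by omega), ht (i + 1) (by omega) (by omega)]
      exact h.braid i hi hin
    | quad_zero hn2 =>
      obtain ⟨q, hpq, hdq, -, hc⟩ := hq hn2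
      have hd := (h.d_quad hn2).eq
      simp only [map_mul, h0, ht 1 le_rfl hn]
      have hc' := hc.eq
      have key : Commute (d * p) ((t 1)⁻¹ * (d * p) * (t 1)⁻¹) := by
        rw [commute_iff_eq, hpq]
        rw [hpq] at hc'
        have e1 : (t 1)⁻¹ * (d * (t 1 * q * t 1)) * (t 1)⁻¹ = (t 1)⁻¹ * (d * t 1) * q := by group
        rw [e1]
        refine mul_left_cancel (a := t 1) ?_
        calc t 1 * (d * (t 1 * q * t 1) * ((t 1)⁻¹ * (d * t 1) * q))
            = t 1 * d * t 1 * (q * d) * t 1 * q := by group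
          _ = (t 1 * d * t 1 * d) * q * t 1 * q := by rw [← hdq.eq]; group
          _ = d * (t 1 * d) * (t 1 * q * t 1 * q) := by
            rw [← hd]; group
          _ = d * t 1 * (d * q) * t 1 * q * t 1 := by rw [hc']; group
          _ = t 1 * ((t 1)⁻¹ * (d * t 1) * q * (d * (t 1 * q * t 1))) := by rw [hdq.eq]; group
      have key2 := key.inv_inv.eq
      have e2 : ((t 1)⁻¹ * (d * p) * (t 1)⁻¹)⁻¹ = t 1 * (d * p)⁻¹ * t 1 := by group
      rw [e2] at key2
      simpa only [mul_assoc] using key2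
    | quad_last hn2 =>
      obtain ⟨m, rfl⟩ : ∃ m, n = m + 1 := ⟨n - 1, by omega⟩
      simp only [map_mul, Nat.add_sub_cancel, ht m (by omega) (by omega), ht (m + 1) hn le_rfl]
      exact h.quad m (by omega) rfl
    | K_comm i hi hin =>
      simp only [map_mul, hk, ht i (by omega) hin]
      exact h.k_comm i hi hin
    | K_quad hn2 =>
      simp only [map_mul, hk, ht 1 le_rfl hn]
      exact h.k_quad hn2
    | K_cross hn2 =>
      obtain ⟨q, hpq, -, hkq, -⟩ := hq hn2
      have hd := (h.k_d hn2).eq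
      simp only [map_mul, map_inv, h0, hk, ht 1 le_rfl hn]
      have key : Commute (d * p) ((t 1)⁻¹ * k * t 1) := by
        rw [commute_iff_eq, hpq]
        calc d * (t 1 * q * t 1) * ((t 1)⁻¹ * k * t 1) = d * t 1 * (q * k) * t 1 := by group
          _ = (t 1)⁻¹ * (t 1 * d * t 1 * k) * q * t 1 := by rw [← hkq.eq]; group
          _ = (t 1)⁻¹ * k * t 1 * (d * (t 1 * q * t 1)) := by rw [← hd]; group
      simpa only [mul_assoc] using key.inv_left.eq
  refine ⟨PresentedGroup.toGroup (f := F) ?_, fun i => ?_, ?_⟩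
  · rintro r ⟨a, b, hab, rfl⟩
    rw [map_mul, map_inv, hrel a b hab, mul_inv_cancel]
  · exact PresentedGroup.toGroup.of _
  · exact PresentedGroup.toGroup.of _

end Group

end IsBraidTuple

/-! ### Operators on `X ⊗ V_1 ⊗ ⋯ ⊗ V_n` -/

section Tower

variable {U : Type u} [Ring U] [HopfAlgebra ℂ U] [BijectiveAntipode U] {C : TensorSubcat U}
  {Q : QuasiTriangular C} {X : URep.{u, max u v} U} {V : C.Obj}

theorem extendOp_mul {n : ℕ} (A B : Module.End ℂ (iter.{u, v} X V n)) :
    extendOp (A * B) = extendOp A * extendOp B := LinearMap.rTensor_mul _ _ _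

theorem extendOp_one {n : ℕ} : extendOp (1 : Module.End ℂ (iter.{u, v} X V n)) = 1 :=
  LinearMap.rTensor_id _ _

theorem extendOp_commute {n : ℕ} {A B : Module.End ℂ (iter.{u, v} X V n)} (h : Commute A B) :
    Commute (extendOp A) (extendOp B) := by
  rw [commute_iff_eq, ← extendOp_mul, h.eq, extendOp_mul]

theorem opPair_succ (S : Module.End ℂ (V ⊗[ℂ] V)) {i n : ℕ} (h : i ≠ n) :
    opPair.{u, v} X V S i (n + 1) = extendOp (opPair X V S i n) := by
  cases n with
  | zero => exact extendOp_one.symm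
  | succ n => exact if_neg h

theorem opPair_self (S : Module.End ℂ (V ⊗[ℂ] V)) (n : ℕ) :
    opPair.{u, v} X V S (n + 1) (n + 2) = leg23 (iter.{u, v} X V n) S := if_pos rfl

theorem opFirst_succ (Z : Module.End ℂ (X ⊗[ℂ] V)) {n : ℕ} (h : 1 ≤ n) :
    opFirst.{u, v} X V Z (n + 1) = extendOp (opFirst X V Z n) := by
  cases n with
  | zero => omega
  | succ n => rfl

theorem opLast_commute_extendOp (J : Module.End ℂ V) {n : ℕ}
    (A : Module.End ℂ (iter.{u, v} X V n)) : Commute (opLast X V J (n + 1)) (extendOp A) :=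
  (LinearMap.lTensor_comp_rTensor _ _ _).trans (LinearMap.rTensor_comp_lTensor _ _ _).symm

theorem opPair_self_commute_extendOp (S : Module.End ℂ (V ⊗[ℂ] V)) {n : ℕ}
    (A : Module.End ℂ (iter.{u, v} X V n)) :
    Commute (opPair X V S (n + 1) (n + 2)) (extendOp (extendOp A)) := by
  rw [opPair_self]
  exact leg23_commute_rTensor A S

theorem opPair_commute (S : Module.End ℂ (V ⊗[ℂ] V)) {i j n : ℕ} (hij : i + 1 < j) (hj : j < n) :
    Commute (opPair.{u, v} X V S i n) (opPair X V S j n) := by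
  induction n with
  | zero => omega
  | succ n ih =>
    rcases Nat.lt_or_ge j n with h | h
    · rw [opPair_succ S (by omega), opPair_succ S (by omega)]
      exact extendOp_commute (ih h)
    · obtain rfl : j = n := by omega
      obtain ⟨k, rfl⟩ : ∃ k, j = k + 1 := ⟨j - 1, by omega⟩
      rw [opPair_succ S (by omega : i ≠ k + 1), opPair_succ S (by omega : i ≠ k)]
      exact (opPair_self_commute_extendOp S _).symm

theorem opFirst_commute_opPair (Z : Module.End ℂ (X ⊗[ℂ] V)) (S : Module.End ℂ (V ⊗[ℂ] V))
    {i n : ℕ} (hi : 2 ≤ i) (hin : i < n) :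
    Commute (opFirst.{u, v} X V Z n) (opPair X V S i n) := by
  induction n with
  | zero => omega
  | succ n ih =>
    rcases Nat.lt_or_ge i n with h | h
    · rw [opPair_succ S (by omega), opFirst_succ Z (by omega)]
      exact extendOp_commute (ih h)
    · obtain rfl : i = n := by omega
      obtain ⟨k, rfl⟩ : ∃ k, i = k + 1 := ⟨i - 1, by omega⟩
      rw [opFirst_succ Z (by omega), opFirst_succ Z (by omega)]
      exact (opPair_self_commute_extendOp S _).symm

theorem opPair_braid (hC : C.Separating) {i n : ℕ} (hi : 1 ≤ i) (hin : i + 1 < n) :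
    opPair.{u, v} X V (Q.braid V V) i n * opPair X V (Q.braid V V) (i + 1) n *
        opPair X V (Q.braid V V) i n =
      opPair.{u, v} X V (Q.braid V V) (i + 1) n * opPair X V (Q.braid V V) i n *
        opPair X V (Q.braid V V) (i + 1) n := by
  induction n with
  | zero => omega
  | succ n ih =>
    rcases Nat.lt_or_ge (i + 1) n with h | h
    · rw [opPair_succ _ (by omega), opPair_succ _ (by omega)]
      simp only [← extendOp_mul, ih h]
    · obtain ⟨k, rfl⟩ : ∃ k, i = k + 1 := ⟨i - 1, by omega⟩
      obtain rfl : n = k + 2 := by omega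
      rw [opPair_succ _ (by omega : k + 1 ≠ k + 2), opPair_self, opPair_self _ (k + 1)]
      exact QuasiTriangular.braid_relation_leg23 hC (iter.{u, v} X V k) V

/-- Relations between operators on the first three factors can be checked on `X ⊗ V ⊗ V`. -/
theorem exists_extend {n : ℕ} (hn : 2 ≤ n) :
    ∃ E : Module.End ℂ ((X ⊗[ℂ] V) ⊗[ℂ] V) →* Module.End ℂ (iter.{u, v} X V n),
      (∀ S, E (leg23 X S) = opPair X V S 1 n) ∧ ∀ Z, E (leg12 V Z) = opFirst X V Z n := by
  induction n, hn using Nat.le_induction with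
  | base => exact ⟨MonoidHom.id _, fun _ => rfl, fun _ => rfl⟩
  | succ n hn ih =>
    obtain ⟨E, h1, h2⟩ := ih
    refine ⟨⟨⟨fun Z => extendOp (E Z), ?_⟩, fun A B => ?_⟩, fun S => ?_, fun Z => ?_⟩
    · rw [map_one, extendOp_one]
    · exact (congrArg extendOp (map_mul E A B)).trans (extendOp_mul _ _)
    · rw [opPair_succ _ (by omega), ← h1]
      rfl
    · rw [opFirst_succ _ (by omega), ← h2]
      rfl

theorem isUnit_extendOp {n : ℕ} {A : Module.End ℂ (iter.{u, v} X V n)} (h : IsUnit A) :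
    IsUnit (extendOp A) := isUnit_rTensor h

theorem isUnit_opPair {S : Module.End ℂ (V ⊗[ℂ] V)} (hS : IsUnit S) (i n : ℕ) :
    IsUnit (opPair.{u, v} X V S i n) := by
  induction n with
  | zero => exact isUnit_one
  | succ n ih =>
    by_cases h : i = n
    · cases n with
      | zero => exact isUnit_one
      | succ n =>
        rw [h, opPair_self]
        exact isUnit_leg23 hS
    · rw [opPair_succ _ h]
      exact isUnit_extendOp ih

theorem isUnit_opFirst {Z : Module.End ℂ (X ⊗[ℂ] V)} (hZ : IsUnit Z) (n : ℕ) :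
    IsUnit (opFirst.{u, v} X V Z n) := by
  induction n with
  | zero => exact isUnit_one
  | succ n ih =>
    cases n with
    | zero => exact hZ
    | succ n => exact isUnit_extendOp ih

theorem isUnit_opLast {J : Module.End ℂ V} (hJ : IsUnit J) (n : ℕ) :
    IsUnit (opLast.{u, v} X V J n) := by
  cases n with
  | zero => exact isUnit_one
  | succ n => exact isUnit_lTensor hJ

theorem opPair_commute_ρ {S : Module.End ℂ (V ⊗[ℂ] V)}
    (hS : URep.IsHom (V.tensor V).rep (V.tensor V).rep S) (i n : ℕ) (x : U) :
    Commute (opPair.{u, v} X V S i n) ((iter.{u, v} X V n).ρ x) := by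
  induction n generalizing x with
  | zero => exact Commute.one_left _
  | succ n ih =>
    by_cases h : i = n
    · cases n with
      | zero => exact Commute.one_left _
      | succ n =>
        rw [h, opPair_self]
        exact URep.leg23_commute_ρ (iter.{u, v} X V n) V V hS x
    · rw [opPair_succ _ h]
      exact URep.rTensor_commute_ρ _ V ih x

theorem opFirst_commute_ρ {Z : Module.End ℂ (X ⊗[ℂ] V)}
    (hZ : ∀ x, Commute Z ((X.tensor V.rep).ρ x)) (n : ℕ) (x : U) :
    Commute (opFirst.{u, v} X V Z n) ((iter.{u, v} X V n).ρ x) := by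
  induction n generalizing x with
  | zero => exact Commute.one_left _
  | succ n ih =>
    cases n with
    | zero => exact hZ x
    | succ n => exact URep.rTensor_commute_ρ _ V ih x

/-! ### The braid operators -/

variable (f : Q.Character)

theorem opT_self (n : ℕ) : opT.{u, v} f X V n n = opLast X V (f.J V) n := if_pos rfl

theorem opT_of_lt {i n : ℕ} (h : i < n) :
    opT.{u, v} f X V n i = opPair X V (Q.braid V V) i n := if_neg h.ne

theorem isUnit_opT (hC : C.Separating) (i n : ℕ) : IsUnit (opT.{u, v} f X V n i) := by
  rw [opT]
  split_ifs
  · exact isUnit_opLast (f.isUnit_J hC V) n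
  · exact isUnit_opPair (QuasiTriangular.isUnit_braid V) i n

theorem isUnit_opD (hC : C.Separating) (n : ℕ) : IsUnit (opD.{u, v} Q X V n) :=
  isUnit_opFirst (QuasiTriangular.isUnit_double hC V X) n

theorem opP_eq_nestedProd {n : ℕ} (hn : 1 ≤ n) :
    opP.{u, v} f X V n = nestedProd (opT f X V n) 1 (n - 1) := by
  rw [nestedProd_eq_prod, Nat.sub_add_cancel hn]
  rfl

theorem isUnit_opP (hC : C.Separating) (n : ℕ) : IsUnit (opP.{u, v} f X V n) := by
  have h : ∀ l : List ℕ, IsUnit ((l.map fun i => opT.{u, v} f X V n (i + 1)).prod) ∧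
      IsUnit ((l.map fun i => opT.{u, v} f X V n (i + 1)).reverse.prod) := fun l => by
    induction l with
    | nil => simp
    | cons a l ih =>
      simp only [List.map_cons, List.prod_cons, List.reverse_cons, List.prod_append,
        List.prod_nil, mul_one]
      exact ⟨(isUnit_opT f hC _ n).mul ih.1, ih.2.mul (isUnit_opT f hC _ n)⟩
  exact ((h _).1.mul (isUnit_opT f hC n n)).mul (h _).2

theorem opT_commute_ρ (hC : C.Separating) {𝒲 : Set C.Obj} (i n : ℕ) {b : U}
    (hb : b ∈ f.noumi 𝒲) : Commute (opT.{u, v} f X V n i) ((iter.{u, v} X V n).ρ b) := by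
  rw [opT]
  split_ifs
  · cases n with
    | zero => exact Commute.one_left _
    | succ n => exact f.lTensor_J_commute hC 𝒲 (iter.{u, v} X V n) V hb
  · exact opPair_commute_ρ (Q.isHom_braid V V) i n b

/-- The operators `T_1, …, T_n`, the double braiding and `K` satisfy the relations, for every
endomorphism `K` of the module `X ⊗ V` which satisfies the quadratic relation. -/
theorem isBraidTuple_op (hC : C.Separating) (n : ℕ) {Z : Module.End ℂ (X ⊗[ℂ] V)}
    (hZ : ∀ x, Commute Z ((X.tensor V.rep).ρ x))
    (hZ2 : leg23 X (Q.braid V V) * leg12 V Z * leg23 X (Q.braid V V) * leg12 V Z =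
      leg12 V Z * leg23 X (Q.braid V V) * leg12 V Z * leg23 X (Q.braid V V)) :
    IsBraidTuple n (opT.{u, v} f X V n) (opD Q X V n) (opFirst X V Z n) := by
  have hlast : ∀ {m : ℕ} (A : Module.End ℂ (iter.{u, v} X V m)),
      Commute (extendOp A) (opT f X V (m + 1) (m + 1)) := fun A => by
    rw [opT_self]
    exact (opLast_commute_extendOp (f.J V) A).symm
  have hfirst : ∀ (Z : Module.End ℂ (X ⊗[ℂ] V)) (i : ℕ), 2 ≤ i → i ≤ n →
      Commute (opFirst X V Z n) (opT.{u, v} f X V n i) := fun Z i h1 h2 => by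
    rcases Nat.lt_or_ge i n with h | h
    · rw [opT_of_lt f h]
      exact opFirst_commute_opPair Z _ h1 h
    · obtain rfl : i = n := by omega
      obtain ⟨m, rfl⟩ : ∃ m, i = m + 1 := ⟨i - 1, by omega⟩
      rw [opFirst_succ Z (by omega)]
      exact hlast _
  have htwo : 2 ≤ n → ∃ E : Module.End ℂ ((X ⊗[ℂ] V) ⊗[ℂ] V) →* Module.End ℂ (iter.{u, v} X V n),
      E (leg23 X (Q.braid V V)) = opT f X V n 1 ∧ ∀ Z, E (leg12 V Z) = opFirst X V Z n :=
    fun h => by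
    obtain ⟨E, h1, h2⟩ := exists_extend (X := X) (V := V) h
    exact ⟨E, by rw [h1, opT_of_lt f (by omega)], h2⟩
  have hdouble : ∀ Z : Module.End ℂ (X ⊗[ℂ] V), (∀ x, Commute Z ((X.tensor V.rep).ρ x)) → 2 ≤ n →
      Commute (opFirst X V Z n) (opT f X V n 1 * opD.{u, v} Q X V n * opT f X V n 1) :=
    fun Z hZ h => by
    obtain ⟨E, h1, h2⟩ := htwo h
    have h3 := (QuasiTriangular.commute_double (Q := Q) hC X V hZ).map E
    rw [map_mul, map_mul, h1, h2, h2] at h3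
    exact h3
  refine ⟨fun i j h1 h2 h3 => ?_, fun i h1 h2 => ?_, fun i h1 h2 => ?_, hfirst _, hfirst Z,
    hdouble _ (QuasiTriangular.double_ρ hC V X), fun h => ?_, hdouble Z hZ⟩
  · rw [opT_of_lt f (by omega : i < n)]
    rcases Nat.lt_or_ge j n with h | h
    · rw [opT_of_lt f h]
      exact opPair_commute _ h2 h
    · obtain rfl : j = n := by omega
      obtain ⟨m, rfl⟩ : ∃ m, j = m + 1 := ⟨j - 1, by omega⟩
      rw [opPair_succ _ (by omega)]
      exact hlast _
  · rw [opT_of_lt f h2, opT_of_lt f (by omega : i < n)]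
    exact opPair_braid hC h1 h2
  · obtain ⟨m, rfl⟩ : ∃ m, i = m + 1 := ⟨i - 1, by omega⟩
    subst h2
    rw [opT_of_lt f (by omega), opT_self, opPair_self]
    exact f.reflection_leg23 hC (iter.{u, v} X V m) V
  · obtain ⟨E, h1, h2⟩ := htwo h
    have h3 := congrArg E hZ2
    simpa only [map_mul, h1, h2] using h3

end Tower

/-! ### Functoriality -/

section Naturality

variable {U : Type u} [Ring U] [HopfAlgebra ℂ U] [BijectiveAntipode U] {C : TensorSubcat U}
  {Q : QuasiTriangular C} {X Y : URep.{u, max u v} U} {V : C.Obj} {h : X →ₗ[ℂ] Y}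

theorem iterMap_ρ (hh : URep.IsHom X Y h) (n : ℕ) :
    URep.IsHom (iter.{u, v} X V n) (iter.{u, v} Y V n) (iterMap V h n) := by
  induction n with
  | zero => exact hh
  | succ n ih => exact URep.IsHom.tensor ih (URep.IsHom.id V.rep)

theorem iterMap_extendOp {n : ℕ} {A : Module.End ℂ (iter.{u, v} X V n)}
    {B : Module.End ℂ (iter.{u, v} Y V n)} (hAB : iterMap V h n ∘ₗ A = B ∘ₗ iterMap V h n) :
    iterMap V h (n + 1) ∘ₗ extendOp A = extendOp B ∘ₗ iterMap V h (n + 1) := by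
  change (iterMap V h n).rTensor V ∘ₗ A.rTensor V = B.rTensor V ∘ₗ (iterMap V h n).rTensor V
  rw [← LinearMap.rTensor_comp, hAB, LinearMap.rTensor_comp]

theorem iterMap_opPair (h : X →ₗ[ℂ] Y) (S : Module.End ℂ (V ⊗[ℂ] V)) (i n : ℕ) :
    iterMap V h n ∘ₗ opPair.{u, v} X V S i n = opPair.{u, v} Y V S i n ∘ₗ iterMap V h n := by
  induction n with
  | zero => rfl
  | succ n ih =>
    by_cases hi : i = n
    · cases n with
      | zero => rfl
      | succ n =>
        rw [hi, opPair_self, opPair_self]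
        refine TensorProduct.ext_threefold fun a b c => ?_
        have hs : ∀ s : V ⊗[ℂ] V, ((iterMap V h n).rTensor V).rTensor V
            ((TensorProduct.assoc ℂ (iter.{u, v} X V n) V V).symm (a ⊗ₜ s)) =
            (TensorProduct.assoc ℂ (iter.{u, v} Y V n) V V).symm (iterMap V h n a ⊗ₜ s) :=
          fun s => by
          induction s using TensorProduct.induction_on with
          | zero => simp
          | add s t h1 h2 => simp only [map_add, TensorProduct.tmul_add, h1, h2]
          | tmul b c => rfl
        exact hs (S (b ⊗ₜ c))
    · rw [opPair_succ _ hi, opPair_succ _ hi]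
      exact iterMap_extendOp ih

theorem iterMap_opLast (h : X →ₗ[ℂ] Y) (J : Module.End ℂ V) (n : ℕ) :
    iterMap V h n ∘ₗ opLast.{u, v} X V J n = opLast.{u, v} Y V J n ∘ₗ iterMap V h n := by
  cases n with
  | zero => rfl
  | succ n =>
    exact (LinearMap.rTensor_comp_lTensor _ _ _).trans (LinearMap.lTensor_comp_rTensor _ _ _).symm

theorem iterMap_opT (h : X →ₗ[ℂ] Y) (f : Q.Character) (i n : ℕ) :
    iterMap V h n ∘ₗ opT.{u, v} f X V n i = opT.{u, v} f Y V n i ∘ₗ iterMap V h n := by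
  rw [opT, opT]
  split_ifs
  · exact iterMap_opLast h _ n
  · exact iterMap_opPair h _ i n

theorem iterMap_opFirst {A : Module.End ℂ (X ⊗[ℂ] V)} {B : Module.End ℂ (Y ⊗[ℂ] V)}
    (hAB : h.rTensor V ∘ₗ A = B ∘ₗ h.rTensor V) {n : ℕ} (hn : 1 ≤ n) :
    iterMap V h n ∘ₗ opFirst.{u, v} X V A n = opFirst.{u, v} Y V B n ∘ₗ iterMap V h n := by
  induction n, hn using Nat.le_induction with
  | base => exact hAB
  | succ n hn ih =>
    rw [opFirst_succ _ hn, opFirst_succ _ hn]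
    exact iterMap_extendOp ih

theorem comp_nestedProd {A B : Type*} [AddCommGroup A] [Module ℂ A] [AddCommGroup B] [Module ℂ B]
    {L : A →ₗ[ℂ] B} {s : ℕ → Module.End ℂ A} {t : ℕ → Module.End ℂ B}
    (hst : ∀ i, L ∘ₗ s i = t i ∘ₗ L) (k m : ℕ) :
    L ∘ₗ nestedProd s k m = nestedProd t k m ∘ₗ L := by
  induction m generalizing k with
  | zero => exact hst k
  | succ m ih =>
    refine LinearMap.ext fun x => ?_
    have h1 := LinearMap.congr_fun (hst k)
    have h2 := LinearMap.congr_fun (ih (k + 1))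
    simp only [LinearMap.comp_apply] at h1 h2
    simp only [nestedProd, LinearMap.comp_apply, Module.End.mul_apply, h1, h2]

theorem iterMap_id (n : ℕ) : iterMap.{u, v} (X := X) (Y := X) V LinearMap.id n = LinearMap.id := by
  induction n with
  | zero => rfl
  | succ n ih =>
    rw [iterMap, ih]
    exact LinearMap.rTensor_id _ _

theorem iterMap_comp {Z : URep.{u, max u v} U} (k : Y →ₗ[ℂ] Z) (h : X →ₗ[ℂ] Y) (n : ℕ) :
    iterMap.{u, v} V (k ∘ₗ h) n = iterMap V k n ∘ₗ iterMap V h n := by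
  induction n with
  | zero => rfl
  | succ n ih =>
    rw [iterMap, ih]
    exact LinearMap.rTensor_comp _ _ _

end Naturality

/-! ### The action on `Hom_B(1_χ, M ⊗ V_1 ⊗ ⋯ ⊗ V_n)` -/

/-- For invertible operators the homomorphism takes values in the units of the monoid, and
`Ring.inverse` is an honest inverse. -/
theorem IsBraidTuple.exists_hom_units {G : Type*} [MonoidWithZero G] {n : ℕ} {t : ℕ → G} {d k : G}
    (h : IsBraidTuple n t d k) (hn : 1 ≤ n) (ht : ∀ i, IsUnit (t i)) (hd : IsUnit d)
    (hk : IsUnit k) :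
    ∃ ψ : DoubleAffineBraidGroup n →* Gˣ,
      (∀ i : Fin (n + 1), (ψ (DoubleAffineBraidGroup.T i) : G) =
        if (i : ℕ) = 0 then Ring.inverse (nestedProd t 1 (n - 1)) * Ring.inverse d else t i) ∧
      (ψ (DoubleAffineBraidGroup.K n) : G) = k := by
  choose t ht using ht
  obtain ⟨d, rfl⟩ := hd
  obtain ⟨k, rfl⟩ := hk
  obtain rfl := funext ht
  obtain ⟨ψ, h1, h2⟩ := (IsBraidTuple.of_injective (φ := Units.coeHom G) (t := t) (d := d) (k := k)
    Units.val_injective h).exists_hom hn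
  refine ⟨ψ, fun i => ?_, by rw [h2]⟩
  rw [h1]
  split_ifs
  · have hp : nestedProd (fun i => (t i : G)) 1 (n - 1) = (nestedProd t 1 (n - 1) : Gˣ) :=
      (map_nestedProd (Units.coeHom G) t 1 (n - 1)).symm
    rw [hp, Ring.inverse_unit, Ring.inverse_unit, mul_inv_rev, Units.val_mul]
  · rfl

theorem LinearMap.comp_ringInverse {A B : Type*} [AddCommGroup A] [Module ℂ A] [AddCommGroup B]
    [Module ℂ B] {L : A →ₗ[ℂ] B} {S : Module.End ℂ A} {T : Module.End ℂ B} (hS : IsUnit S)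
    (hT : IsUnit T) (h : L ∘ₗ S = T ∘ₗ L) : L ∘ₗ Ring.inverse S = Ring.inverse T ∘ₗ L := by
  obtain ⟨S, rfl⟩ := hS
  obtain ⟨T, rfl⟩ := hT
  rw [Ring.inverse_unit, Ring.inverse_unit]
  refine LinearMap.ext fun x => ?_
  have h1 := LinearMap.congr_fun h ((S⁻¹ : (Module.End ℂ A)ˣ).val x)
  have h2 := LinearMap.congr_fun S.mul_inv x
  have h3 := LinearMap.congr_fun T.inv_mul
  simp only [LinearMap.comp_apply, Module.End.mul_apply, Module.End.one_apply] at h1 h2 h3 ⊢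
  rw [h2] at h1
  rw [h1, h3]

/-- A linear map which intertwines the generators intertwines two actions of the double affine
braid group. -/
theorem DoubleAffineBraidGroup.comp_eq {A B : Type*} [AddCommGroup A] [Module ℂ A]
    [AddCommGroup B] [Module ℂ B] {n : ℕ} (ψ : DoubleAffineBraidGroup n →* (Module.End ℂ A)ˣ)
    (ψ' : DoubleAffineBraidGroup n →* (Module.End ℂ B)ˣ) (L : A →ₗ[ℂ] B)
    (hT : ∀ i, L ∘ₗ (ψ (DoubleAffineBraidGroup.T i)).val =
      (ψ' (DoubleAffineBraidGroup.T i)).val ∘ₗ L)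
    (hK : L ∘ₗ (ψ (DoubleAffineBraidGroup.K n)).val =
      (ψ' (DoubleAffineBraidGroup.K n)).val ∘ₗ L) (b : DoubleAffineBraidGroup n) :
    L ∘ₗ (ψ b).val = (ψ' b).val ∘ₗ L := by
  have hb : b ∈ Subgroup.closure (Set.range (PresentedGroup.of
      (rels := {r : FreeGroup (DABGen n) | ∃ a b, DABRel n a b ∧ r = a * b⁻¹}))) := by
    rw [PresentedGroup.closure_range_of]
    exact Subgroup.mem_top b
  induction hb using Subgroup.closure_induction with
  | mem x hx =>
    obtain ⟨i | _, rfl⟩ := hx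
    · exact hT i
    · exact hK
  | one => rw [map_one, map_one]; rfl
  | mul x y _ _ hx hy =>
    rw [map_mul, map_mul]
    change L ∘ₗ ((ψ x).val ∘ₗ (ψ y).val) = ((ψ' x).val ∘ₗ (ψ' y).val) ∘ₗ L
    rw [← LinearMap.comp_assoc, hx, LinearMap.comp_assoc, hy, LinearMap.comp_assoc]
  | inv x _ hx =>
    rw [map_inv, map_inv, ← Ring.inverse_unit, ← Ring.inverse_unit]
    exact LinearMap.comp_ringInverse (ψ x).isUnit (ψ' x).isUnit hx

section Hom

variable {U : Type u} [Ring U] [HopfAlgebra ℂ U] [BijectiveAntipode U] {C : TensorSubcat U}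
  {Q : QuasiTriangular C} {B : Subalgebra ℂ U} (χ : B →ₐ[ℂ] ℂ) {M N P : NonDegDMod.{u, max u v} Q}
  {V : C.Obj} {n : ℕ}

/-- Composition with a `B`-linear map. -/
def homB.map (L : iter.{u, v} M.snd V n →ₗ[ℂ] iter.{u, v} N.snd V n)
    (hL : ∀ b ∈ B, L ∘ₗ (iter.{u, v} M.snd V n).ρ b = (iter.{u, v} N.snd V n).ρ b ∘ₗ L) :
    homB.{u, v} χ M V n →ₗ[ℂ] homB.{u, v} χ N V n :=
  (LinearMap.llcomp ℂ ℂ _ _ L).restrict fun φ hφ b z =>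
    (congrArg L (hφ b z)).trans (LinearMap.congr_fun (hL b b.2) (φ z))

/-- A group which acts by `B`-linear operators acts on the space of homomorphisms by composition. -/
def homB.rep {G : Type*} [Group G] (ψ : G →* (Module.End ℂ (iter.{u, v} M.snd V n))ˣ)
    (hψ : ∀ g, ∀ b ∈ B, (ψ g).val ∘ₗ (iter.{u, v} M.snd V n).ρ b =
      (iter.{u, v} M.snd V n).ρ b ∘ₗ (ψ g).val) :
    Representation ℂ G (homB.{u, v} χ M V n) where
  toFun g := homB.map χ (ψ g).val (hψ g)
  map_one' := LinearMap.ext fun φ => Subtype.ext (LinearMap.ext fun z =>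
    LinearMap.congr_fun (congrArg Units.val (map_one ψ)) (φ.1 z))
  map_mul' g h := LinearMap.ext fun φ => Subtype.ext (LinearMap.ext fun z =>
    LinearMap.congr_fun (congrArg Units.val (map_mul ψ g h)) (φ.1 z))

end Hom

section Main

variable {U : Type u} [Ring U] [HopfAlgebra ℂ U] [BijectiveAntipode U] {C : TensorSubcat U}
  {Q : QuasiTriangular C}

theorem opTAll_eq {f : Q.Character} {X : URep.{u, max u v} U} {V : C.Obj} {n : ℕ} (hn : 1 ≤ n)
    (i : ℕ) : opTAll.{u, v} f X V n i = if i = 0 then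
      Ring.inverse (nestedProd (opT f X V n) 1 (n - 1)) * Ring.inverse (opD Q X V n)
      else opT f X V n i := by
  rw [opTAll, opT₀, opP_eq_nestedProd f hn]

/-- The operators `T_0, …, T_n` intertwine every linear map which intertwines `T_1, …, T_n` and
the double braiding. -/
theorem comp_opTAll (hC : C.Separating) {f : Q.Character} {X Y : URep.{u, max u v} U} {V : C.Obj}
    {n : ℕ} (hn : 1 ≤ n) {L : iter.{u, v} X V n →ₗ[ℂ] iter.{u, v} Y V n}
    (hT : ∀ i, L ∘ₗ opT f X V n i = opT f Y V n i ∘ₗ L)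
    (hD : L ∘ₗ opD Q X V n = opD Q Y V n ∘ₗ L) (i : ℕ) :
    L ∘ₗ opTAll.{u, v} f X V n i = opTAll.{u, v} f Y V n i ∘ₗ L := by
  rw [opTAll, opTAll]
  split_ifs
  · have hP : L ∘ₗ opP f X V n = opP f Y V n ∘ₗ L := by
      rw [opP_eq_nestedProd f hn, opP_eq_nestedProd f hn]
      exact comp_nestedProd hT 1 (n - 1)
    have h1 := LinearMap.comp_ringInverse (isUnit_opP f hC n) (isUnit_opP f hC n) hP
    have h2 := LinearMap.comp_ringInverse (isUnit_opD hC n) (isUnit_opD hC n) hD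
    change L ∘ₗ (Ring.inverse (opP f X V n) ∘ₗ Ring.inverse (opD Q X V n)) =
      (Ring.inverse (opP f Y V n) ∘ₗ Ring.inverse (opD Q Y V n)) ∘ₗ L
    rw [← LinearMap.comp_assoc, h1, LinearMap.comp_assoc, h2, LinearMap.comp_assoc]
  · exact hT i

/-- The double affine braid group acts on all of `M ⊗ V_1 ⊗ ⋯ ⊗ V_n`. -/
theorem exists_doubleAffineBraidGroup_hom (hC : C.Separating) (f g : Q.Character)
    (M : NonDegDMod.{u, max u v} Q) (V : C.Obj) {n : ℕ} (hn : 1 ≤ n) :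
    ∃ ψ : DoubleAffineBraidGroup n →* (Module.End ℂ (iter.{u, v} M.snd V n))ˣ,
      (∀ i : Fin (n + 1), (ψ (DoubleAffineBraidGroup.T i)).val = opTAll.{u, v} f M.snd V n i) ∧
      (ψ (DoubleAffineBraidGroup.K n)).val = opK.{u, v} g M V n := by
  obtain ⟨ψ, h1, h2⟩ := (isBraidTuple_op (X := M.snd) (V := V) f hC n (opKFirst_ρ hC g M V)
    (opKFirst_quad hC g M V)).exists_hom_units hn (fun i => isUnit_opT f hC i n)
    (isUnit_opD hC n) (isUnit_opFirst (isUnit_opKFirst hC g M V) n)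
  exact ⟨ψ, fun i => by rw [h1, opTAll_eq hn], h2⟩

end Main

end

theorem theorem6p1 {U : Type u} [Ring U] [HopfAlgebra ℂ U] [BijectiveAntipode U]
    {C : TensorSubcat U} (hC : C.Separating) (Q : QuasiTriangular C)
    (f g : Q.Character) (V : C.Obj) (𝒲 : Set C.Obj) (hV : V ∈ 𝒲)
    (χ : f.noumi 𝒲 →ₐ[ℂ] ℂ) (n : ℕ) (hn : 1 ≤ n) :
    (∀ M : NonDegDMod.{u, max u v} Q,
      IsUnit (opP.{u, v} f M.snd V n) ∧ IsUnit (opD.{u, v} Q M.snd V n)) ∧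
    ∃ (ρ : ∀ M : NonDegDMod.{u, max u v} Q,
        Representation ℂ (DoubleAffineBraidGroup n) (homB.{u, v} χ M V n))
      (F : ∀ {M N : NonDegDMod.{u, max u v} Q}, NonDegDMod.Hom M N →
        (homB.{u, v} χ M V n →ₗ[ℂ] homB.{u, v} χ N V n)),
      (∀ (M : NonDegDMod.{u, max u v} Q) (φ : homB.{u, v} χ M V n),
        (∀ i : Fin (n + 1),
          (ρ M (DoubleAffineBraidGroup.T i) φ : ℂ →ₗ[ℂ] iter.{u, v} M.snd V n) =
            opTAll.{u, v} f M.snd V n i ∘ₗ φ) ∧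
        (ρ M (DoubleAffineBraidGroup.K n) φ : ℂ →ₗ[ℂ] iter.{u, v} M.snd V n) =
          opK.{u, v} g M V n ∘ₗ φ) ∧
      (∀ (M N : NonDegDMod.{u, max u v} Q) (h : NonDegDMod.Hom M N)
        (φ : homB.{u, v} χ M V n),
        (F h φ : ℂ →ₗ[ℂ] iter.{u, v} N.snd V n) =
            iterMap.{u, v} (X := M.snd) (Y := N.snd) V h.toLin n ∘ₗ φ ∧
        ∀ b : DoubleAffineBraidGroup n, F h (ρ M b φ) = ρ N b (F h φ)) ∧
      (∀ M : NonDegDMod.{u, max u v} Q, F (NonDegDMod.Hom.id M) = LinearMap.id) ∧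
      (∀ (M N P : NonDegDMod.{u, max u v} Q) (h : NonDegDMod.Hom M N)
        (k : NonDegDMod.Hom N P), F (k.comp h) = F k ∘ₗ F h) := by
  choose ψ hT hK using fun M : NonDegDMod.{u, max u v} Q =>
    exists_doubleAffineBraidGroup_hom.{u, v} hC f g M V hn
  -- elements of the coideal subalgebra commute with the generators, hence with the whole group
  have hψ : ∀ (M : NonDegDMod.{u, max u v} Q) (b : DoubleAffineBraidGroup n), ∀ x ∈ f.noumi 𝒲,
      (ψ M b).val ∘ₗ (iter.{u, v} M.snd V n).ρ x =
        (iter.{u, v} M.snd V n).ρ x ∘ₗ (ψ M b).val := fun M b x hx =>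
    (DoubleAffineBraidGroup.comp_eq (ψ M) (ψ M) _
      (fun i => by
        rw [hT]
        exact comp_opTAll hC hn (fun i => (opT_commute_ρ f hC i n hx).eq.symm)
          (opFirst_commute_ρ (QuasiTriangular.double_ρ hC V M.snd) n x).eq.symm i)
      (by
        rw [hK]
        exact (opFirst_commute_ρ (opKFirst_ρ hC g M V) n x).eq.symm) b).symm
  have hsnd : ∀ {M N : NonDegDMod.{u, max u v} Q} (h : NonDegDMod.Hom M N),
      URep.IsHom M.snd N.snd h.toLin := fun h x m => h.map_ρ _ m
  refine ⟨fun M => ⟨isUnit_opP f hC n, isUnit_opD hC n⟩, fun M => homB.rep χ (ψ M) (hψ M),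
    fun {M N} h => homB.map χ (iterMap V h.toLin n)
      (fun b _ => LinearMap.ext (iterMap_ρ (hsnd h) n b)),
    fun M φ => ⟨fun i => ?_, ?_⟩, fun M N h φ => ⟨rfl, fun b => ?_⟩, fun M => ?_,
    fun M N P h k => ?_⟩
  · exact congrArg (fun A : Module.End ℂ _ => A ∘ₗ φ.1) (hT M i)
  · exact congrArg (fun A : Module.End ℂ _ => A ∘ₗ φ.1) (hK M)
  · have h1 := DoubleAffineBraidGroup.comp_eq (ψ M) (ψ N) (iterMap V h.toLin n)
      (fun i => by
        rw [hT, hT]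
        exact comp_opTAll hC hn (fun i => iterMap_opT (X := M.snd) (Y := N.snd) h.toLin f i n)
          (iterMap_opFirst (LinearMap.ext (Q.double_natural V (hsnd h)) |>.symm) hn) i)
      (by
        rw [hK, hK]
        exact iterMap_opFirst (opKFirst_natural hC g h V) hn) b
    exact Subtype.ext (LinearMap.ext fun z => LinearMap.congr_fun h1 (φ.1 z))
  · exact LinearMap.ext fun φ => Subtype.ext (LinearMap.ext fun z =>
      LinearMap.congr_fun (iterMap_id (X := M.snd) n) (φ.1 z))
  · exact LinearMap.ext fun φ => Subtype.ext (LinearMap.ext fun z =>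
      LinearMap.congr_fun (iterMap_comp (X := M.snd) (Y := N.snd) (Z := P.snd) k.toLin h.toLin n)
        (φ.1 z))
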